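/- Let $k$ be an algebraically closed field of characteristic $0$ and let $A=k\langle x,y\rangle/(xy-yx-1)$ be the first Weyl algebra, $\mathbb Z$-graded by $\deg x=1$, $\deg y=-1$; put $z=xy$. Let $\operatorname{gr}A$ be the $k$-linear category of all $\mathbb Z$-graded right $A$-modules with degree-preserving homomorphisms, and write $M\langle n\rangle$ for the shift of $M$, $M\langle n\rangle_j=M_{j-n}$. Put $X=A/xA$, $Y=(A/yA)\langle 1\rangle$, and $M_\lambda=A/(z+\lambda)A$ for $\lambda\in k$. Let $\operatorname{Pic}(\operatorname{gr}A)$ be the group of $k$-linear autoequivalences of $\operatorname{gr}A$ modulo natural isomorphism, under composition. Let $\operatorname{Pic}_0(\operatorname{gr}A)$ be its subgroup of numerically trivial autoequivalences, that is, the classes of those $\mathcal F$ such that, up to isomorphism, $\{\mathcal F(X\langle n\rangle),\mathcal F(Y\langle n\rangle)\}=\{X\langle n\rangle,Y\langle n\rangle\}$ for all $n\in\mathbb Z$ and $\mathcal F(M_\lambda)\cong M_\lambda$ for all $\lambda\in k\smallsetminus\mathbb Z$. For $j\in\mathbb Z$ let $\iota_j\in\operatorname{Pic}(\operatorname{gr}A)$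 be the class of an autoequivalence whose restriction to the graded projective modules of rank one is naturally isomorphic to the functor sending $P$ to its reject of $X\langle j\rangle\oplus Y\langle j\rangle$ (the intersection of the kernels of all morphisms from $P$ to $X\langle j\rangle$ or $Y\langle j\rangle$ in $\operatorname{gr}A$) and a morphism to its restriction. For each $j$ such a class exists, is unique, and lies in $\operatorname{Pic}_0(\operatorname{gr}A)$. For a finite set $J\subset\mathbb Z$ put $\iota_J=\prod_{j\in J}\iota_j$ (in increasing order of $j$). Let $K_0(\operatorname{gr}A)$ be the Grothendieck group of finitely generated graded projective right $A$-modules: the abelian group generated by their isomorphism classes, with relations $[P\oplus Q]=[P]+[Q]$. Let $\widetilde{K_0}=K_0(\operatorname{gr}A)/([A])$ be its quotient by the subgroup generated by $[A]$. Then there is a unique group homomorphism $\theta:\widetilde{K_0}\to\operatorname{Pic}_0(\operatorname{gr}A)$ such that $\theta([\iota_JA])=\iota_J$ for every finite $J\subset\mathbb Z$. Further, $\theta$ induces an isomorphism of groups $\theta\otimes 1:\widetilde{K_0}\otimes_{\mathbb Z}\mathbb Z/2\mathbb Z\to\operatorname{Pic}_0(\operatorname{gr}A)$, with $a\otimes 1\mapsto\theta(a)$.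 -/

import Mathlib

open CategoryTheory CategoryTheory.Limits
open scoped DirectSum TensorProduct

universe u

/-! ## Graded right modules over a graded algebra -/

/-- A `ℤ`-graded right module over the `k`-algebra `R` with grading `𝒜`: a right `R`-module
(that is, a module over the opposite ring) which is the internal direct sum of subspaces
`deg i`, `i ∈ ℤ`, with `(deg i) * (𝒜 j) ⊆ deg (i + j)`. -/
structure GrMod {k R : Type u} [Field k] [Ring R] [Algebra k R] (𝒜 : ℤ → Submodule k R) :
    Type (u + 1) where
  carrier : Type u
  [addCommGroup : AddCommGroup carrier]
  [moduleBase : Module k carrier]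
  [module : Module Rᵐᵒᵖ carrier]
  [isScalarTower : IsScalarTower k Rᵐᵒᵖ carrier]
  deg : ℤ → Submodule k carrier
  isInternal : DirectSum.IsInternal deg
  smul_mem : ∀ {i j : ℤ} {m : carrier} {a : R},
    m ∈ deg i → a ∈ 𝒜 j → MulOpposite.op a • m ∈ deg (i + j)

namespace GrMod

section General

variable {k R : Type u} [Field k] [Ring R] [Algebra k R] {𝒜 : ℤ → Submodule k R}

instance : CoeSort (GrMod 𝒜) (Type u) := ⟨GrMod.carrier⟩

attribute [instance] addCommGroup moduleBase module isScalarTower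

instance (M : GrMod 𝒜) : SMulCommClass Rᵐᵒᵖ k M := IsScalarTower.to_smulCommClass'

noncomputable instance (M : GrMod 𝒜) : DirectSum.Decomposition M.deg :=
  M.isInternal.chooseDecomposition

/-- Projection of a graded module onto its component of degree `i`. -/
noncomputable def proj (M : GrMod 𝒜) (i : ℤ) : M →ₗ[k] M :=
  (M.deg i).subtype ∘ₗ DirectSum.component k ℤ (fun j => M.deg j) i ∘ₗ
    (DirectSum.decomposeLinearEquiv M.deg).toLinearMap

theorem proj_apply (M : GrMod 𝒜) (i : ℤ) (m : M) :
    M.proj i m = (DirectSum.decompose M.deg m i : M) := rfl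

theorem proj_mem (M : GrMod 𝒜) (i : ℤ) (m : M) : M.proj i m ∈ M.deg i :=
  (DirectSum.decompose M.deg m i).2

theorem proj_same (M : GrMod 𝒜) {i : ℤ} {m : M} (h : m ∈ M.deg i) : M.proj i m = m :=
  DirectSum.decompose_of_mem_same _ h

theorem proj_ne (M : GrMod 𝒜) {i j : ℤ} {m : M} (h : m ∈ M.deg i) (hij : i ≠ j) :
    M.proj j m = 0 :=
  DirectSum.decompose_of_mem_ne _ h hij

open Classical in
theorem sum_proj (M : GrMod 𝒜) (m : M) : ∃ s : Finset ℤ, ∑ i ∈ s, M.proj i m = m :=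
  ⟨_, DirectSum.sum_support_decompose M.deg m⟩

theorem isInternal_of_proj {V : Type u} [AddCommGroup V] [Module k V] (d : ℤ → Submodule k V)
    (p : ℤ → V →ₗ[k] V) (h1 : ∀ i m, m ∈ d i → p i m = m)
    (h2 : ∀ i j m, m ∈ d i → i ≠ j → p j m = 0)
    (h3 : ∀ m, ∃ s : Finset ℤ, ∃ f : ℤ → V, (∀ i, f i ∈ d i) ∧ ∑ i ∈ s, f i = m) :
    DirectSum.IsInternal d := by
  rw [DirectSum.isInternal_submodule_iff_iSupIndep_and_iSup_eq_top]
  constructor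
  · intro i
    rw [Submodule.disjoint_def]
    intro x hx hx'
    have h : (⨆ j, ⨆ (_ : j ≠ i), d j) ≤ LinearMap.ker (p i) :=
      iSup_le fun j => iSup_le fun hj => fun m hm => h2 j i m hm hj
    have h' := h hx'
    rw [LinearMap.mem_ker, h1 i x hx] at h'
    exact h'
  · rw [eq_top_iff]
    rintro m -
    obtain ⟨s, f, hf, rfl⟩ := h3 m
    exact Submodule.sum_mem _ fun i _ => Submodule.mem_iSup_of_mem i (hf i)

/-- A submodule is homogeneous if it contains the homogeneous components of its elements. -/
def IsHomog (M : GrMod 𝒜) (N : Submodule Rᵐᵒᵖ M) : Prop :=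
  ∀ m ∈ N, ∀ i, M.proj i m ∈ N

/-- A homogeneous submodule, as a graded module. -/
noncomputable def sub (M : GrMod 𝒜) (N : Submodule Rᵐᵒᵖ M) (hN : M.IsHomog N) : GrMod 𝒜 where
  carrier := N
  deg i := (M.deg i).comap (N.subtype.restrictScalars k)
  isInternal := by
    refine isInternal_of_proj _
      (fun i => ((M.proj i).restrict (p := N.restrictScalars k) (q := N.restrictScalars k)
        (fun m hm => hN m hm i) : N →ₗ[k] N)) ?_ ?_ ?_
    · intro i m hm
      exact Subtype.ext (M.proj_same hm)
    · intro i j m hm hij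
      exact Subtype.ext (M.proj_ne hm hij)
    · intro m
      obtain ⟨s, hs⟩ := M.sum_proj (m : M)
      refine ⟨s, fun i => ⟨M.proj i m, hN m m.2 i⟩, fun i => M.proj_mem i m, ?_⟩
      apply Subtype.ext
      rw [AddSubmonoidClass.coe_finsetSum]
      exact hs
  smul_mem := fun hm ha => M.smul_mem hm ha

/-- The quotient of a graded module by a homogeneous submodule. -/
noncomputable def quot (M : GrMod 𝒜) (N : Submodule Rᵐᵒᵖ M) (hN : M.IsHomog N) : GrMod 𝒜 where
  carrier := M ⧸ N
  deg i := (M.deg i).map (N.mkQ.restrictScalars k)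
  isInternal := by
    refine isInternal_of_proj _
      (fun i => ((N.restrictScalars k).mapQ (N.restrictScalars k) (M.proj i)
        (fun m hm => hN m hm i) : (M ⧸ N) →ₗ[k] (M ⧸ N))) ?_ ?_ ?_
    · rintro i _ ⟨m, hm, rfl⟩
      exact congrArg N.mkQ (M.proj_same hm)
    · rintro i j _ ⟨m, hm, rfl⟩ hij
      exact congrArg N.mkQ (M.proj_ne hm hij)
    · intro m
      obtain ⟨m, rfl⟩ := N.mkQ_surjective m
      obtain ⟨s, hs⟩ := M.sum_proj m
      refine ⟨s, fun i => N.mkQ (M.proj i m), fun i => ⟨_, M.proj_mem i m, rfl⟩, ?_⟩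
      rw [← map_sum, hs]
  smul_mem := by
    rintro i j _ a ⟨m, hm, rfl⟩ ha
    exact ⟨_, M.smul_mem hm ha, rfl⟩

/-- The shift `M⟨n⟩`, with `M⟨n⟩_j = M_{j - n}`. -/
def shift (M : GrMod 𝒜) (n : ℤ) : GrMod 𝒜 where
  carrier := M
  deg j := M.deg (j - n)
  isInternal := by
    have h := (DirectSum.isInternal_submodule_iff_iSupIndep_and_iSup_eq_top _).1 M.isInternal
    rw [DirectSum.isInternal_submodule_iff_iSupIndep_and_iSup_eq_top]
    refine ⟨h.1.comp (sub_left_injective), ?_⟩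
    rw [← h.2]
    exact (Equiv.subRight n).iSup_comp (g := M.deg)
  smul_mem := by
    intro i j m a hm ha
    have := M.smul_mem hm ha
    rwa [sub_add_eq_add_sub] at this

/-- The graded ring as a graded right module over itself. -/
def regular (𝒜 : ℤ → Submodule k R) [GradedAlgebra 𝒜] : GrMod 𝒜 where
  carrier := R
  deg := 𝒜
  isInternal := DirectSum.Decomposition.isInternal 𝒜
  smul_mem := fun hm ha => SetLike.mul_mem_graded hm ha

/-! ### The category of graded modules -/

/-- Morphisms: module homomorphisms which preserve degree. -/
def homSubmodule (M N : GrMod 𝒜) : Submodule k (M →ₗ[Rᵐᵒᵖ] N) where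
  carrier := {f | ∀ i, ∀ m ∈ M.deg i, f m ∈ N.deg i}
  zero_mem' := fun i _ _ => (N.deg i).zero_mem
  add_mem' := fun hf hg i m hm => (N.deg i).add_mem (hf i m hm) (hg i m hm)
  smul_mem' := fun c _ hf i m hm => (N.deg i).smul_mem c (hf i m hm)

instance : Category.{u} (GrMod 𝒜) where
  Hom M N := homSubmodule M N
  id M := ⟨LinearMap.id, fun _ _ hm => hm⟩
  comp f g := ⟨g.1 ∘ₗ f.1, fun i _ hm => g.2 i _ (f.2 i _ hm)⟩

@[ext] theorem hom_ext {M N : GrMod 𝒜} {f g : M ⟶ N} (h : ∀ m, f.1 m = g.1 m) : f = g :=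
  Subtype.ext (LinearMap.ext h)

@[simp] theorem id_apply {M : GrMod 𝒜} (m : M) : (𝟙 M : M ⟶ M).1 m = m := rfl

@[simp] theorem comp_apply {M N P : GrMod 𝒜} (f : M ⟶ N) (g : N ⟶ P) (m : M) :
    (f ≫ g).1 m = g.1 (f.1 m) := rfl

instance : Preadditive (GrMod 𝒜) where
  homGroup M N := inferInstanceAs (AddCommGroup (homSubmodule M N))
  add_comp _ _ _ f f' g := Subtype.ext (LinearMap.comp_add f.1 f'.1 g.1)
  comp_add _ _ _ f g g' := Subtype.ext (LinearMap.add_comp f.1 g'.1 g.1)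

@[simp] theorem zero_apply {M N : GrMod 𝒜} (m : M) : (0 : M ⟶ N).1 m = 0 := rfl

instance : Linear k (GrMod 𝒜) where
  homModule M N := inferInstanceAs (Module k (homSubmodule M N))
  smul_comp M N P r f g := hom_ext fun m => by
    have h : ∀ x : N, g.1 (r • x) = r • g.1 x := fun x => (g.1.restrictScalars k).map_smul r x
    exact h (f.1 m)
  comp_smul _ _ _ f r g := Subtype.ext (LinearMap.smul_comp r g.1 f.1)

theorem hom_proj {M N : GrMod 𝒜} (f : M ⟶ N) (m : M) (i : ℤ) :
    f.1 (M.proj i m) = N.proj i (f.1 m) := by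
  obtain ⟨s, hs⟩ := M.sum_proj m
  have h : ∀ j, N.proj i (f.1 (M.proj j m)) = f.1 (M.proj i (M.proj j m)) := by
    intro j
    by_cases hj : j = i
    · subst hj
      rw [N.proj_same (f.2 _ _ (M.proj_mem j m)), M.proj_same (M.proj_mem j m)]
    · rw [N.proj_ne (f.2 _ _ (M.proj_mem j m)) hj, M.proj_ne (M.proj_mem j m) hj, map_zero]
  conv_rhs => rw [← hs]
  rw [map_sum, map_sum, Finset.sum_congr rfl fun j _ => h j, ← map_sum, ← map_sum, hs]

theorem isHomog_ker {M N : GrMod 𝒜} (f : M ⟶ N) : M.IsHomog (LinearMap.ker f.1) := by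
  intro m hm i
  rw [LinearMap.mem_ker] at hm ⊢
  rw [hom_proj, hm, map_zero]

theorem isHomog_range {M N : GrMod 𝒜} (f : M ⟶ N) : N.IsHomog (LinearMap.range f.1) := by
  rintro _ ⟨m, rfl⟩ i
  exact ⟨M.proj i m, hom_proj f m i⟩

theorem isHomog_iInf {M : GrMod 𝒜} {ι : Sort*} {N : ι → Submodule Rᵐᵒᵖ M}
    (h : ∀ i, M.IsHomog (N i)) : M.IsHomog (⨅ i, N i) := by
  intro m hm j
  rw [Submodule.mem_iInf] at hm ⊢
  exact fun i => h i m (hm i) j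

theorem isHomog_iSup {M : GrMod 𝒜} {ι : Sort*} {N : ι → Submodule Rᵐᵒᵖ M}
    (h : ∀ i, M.IsHomog (N i)) : M.IsHomog (⨆ i, N i) := by
  intro m hm j
  induction hm using Submodule.iSup_induction' with
  | mem i x hx => exact Submodule.mem_iSup_of_mem i (h i x hx j)
  | zero => rw [map_zero]; exact Submodule.zero_mem _
  | add x y _ _ hx hy => rw [map_add]; exact Submodule.add_mem _ hx hy

/-- The projection onto a quotient by a homogeneous submodule. -/
noncomputable def quotMap (M : GrMod 𝒜) (N : Submodule Rᵐᵒᵖ M) (hN : M.IsHomog N) :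
    M ⟶ M.quot N hN :=
  ⟨N.mkQ, fun _ m hm => ⟨m, hm, rfl⟩⟩

theorem eq_top_of_quotMap_eq_zero {M : GrMod 𝒜} {N : Submodule Rᵐᵒᵖ M} {hN : M.IsHomog N}
    (h : M.quotMap N hN = 0) : N = ⊤ := by
  rw [eq_top_iff]
  rintro m -
  have : (M.quotMap N hN).1 m = (0 : M ⟶ M.quot N hN).1 m := by rw [h]
  exact (Submodule.Quotient.mk_eq_zero N).1 this

/-! ### Rejects -/

/-- The reject in `M` of a family of graded modules: the intersection of the kernels of all
degree-preserving homomorphisms from `M` to a member of the family. -/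
def reject {ι : Type} (S : ι → GrMod 𝒜) (M : GrMod 𝒜) : Submodule Rᵐᵒᵖ M :=
  ⨅ i, ⨅ f : M ⟶ S i, LinearMap.ker f.1

theorem isHomog_reject {ι : Type} (S : ι → GrMod 𝒜) (M : GrMod 𝒜) : M.IsHomog (reject S M) :=
  isHomog_iInf fun _ => isHomog_iInf fun f => isHomog_ker f

theorem reject_map {ι : Type} (S : ι → GrMod 𝒜) {M N : GrMod 𝒜} (g : M ⟶ N) {m : M}
    (hm : m ∈ reject S M) : g.1 m ∈ reject S N := by
  simp only [reject, Submodule.mem_iInf, LinearMap.mem_ker] at hm ⊢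
  exact fun i f => hm i (g ≫ f)

/-- The reject as a functor: it acts on morphisms by restriction. -/
noncomputable def rejectFunctor {ι : Type} (S : ι → GrMod 𝒜) : GrMod 𝒜 ⥤ GrMod 𝒜 where
  obj M := M.sub (reject S M) (isHomog_reject S M)
  map {M N} g := ⟨g.1.restrict (p := reject S M) (q := reject S N) (fun _ hm => reject_map S g hm),
    fun i m hm => g.2 i m.1 hm⟩

/-! ### Finitely generated graded projective modules -/

/-- `P` is a finitely generated graded projective module. -/
def IsFGProj : ObjectProperty (GrMod 𝒜) := fun P => Module.Finite Rᵐᵒᵖ P ∧ Projective P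

/-- `P` is a graded projective module of rank one (maximal size of a linearly independent set). -/
def IsRankOneProj : ObjectProperty (GrMod 𝒜) := fun P =>
  IsFGProj P ∧ Module.rank Rᵐᵒᵖ P = 1

section Regular

variable [GradedAlgebra 𝒜]

/-- A homogeneous element of degree `n` gives a homomorphism from `R⟨n⟩`. -/
def ofElem (M : GrMod 𝒜) (n : ℤ) (m : M) (hm : m ∈ M.deg n) : (regular 𝒜).shift n ⟶ M :=
  ⟨{ toFun := fun r : R => MulOpposite.op r • m
     map_add' := fun a b : R => add_smul (MulOpposite.op a) (MulOpposite.op b) m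
     map_smul' := fun a (b : R) => by
      change MulOpposite.op (b * a.unop) • m = a • MulOpposite.op b • m
      rw [MulOpposite.op_mul, MulOpposite.op_unop, mul_smul] },
   fun i (r : R) hr => by
    have := M.smul_mem hm (show r ∈ 𝒜 (i - n) from hr)
    rwa [add_sub_cancel] at this⟩

theorem ofElem_one (M : GrMod 𝒜) (n : ℤ) (m : M) (hm : m ∈ M.deg n) :
    (M.ofElem n m hm).1 (1 : R) = m :=
  one_smul _ m

theorem hom_eq_zero_of_ofElem {M N : GrMod 𝒜} (g : M ⟶ N)
    (h : ∀ n m hm, M.ofElem n m hm ≫ g = 0) : g = 0 := by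
  ext m
  obtain ⟨s, hs⟩ := M.sum_proj m
  rw [← hs, map_sum]
  refine Finset.sum_eq_zero fun i _ => ?_
  have := congrArg (fun f => f.1 (1 : R)) (h i _ (M.proj_mem i m))
  change g.1 ((M.ofElem i _ (M.proj_mem i m)).1 (1 : R)) = 0 at this
  rwa [ofElem_one] at this

theorem projective_regular : Projective (regular 𝒜) := by
  constructor
  intro E X f e he
  have hsurj : Function.Surjective e.1 := by
    have h0 : X.quotMap _ (isHomog_range e) = 0 := by
      rw [← cancel_epi e, comp_zero]
      ext m
      exact (Submodule.Quotient.mk_eq_zero _).2 ⟨m, rfl⟩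
    exact LinearMap.range_eq_top.1 (eq_top_of_quotMap_eq_zero h0)
  have h1 : f.1 (1 : R) ∈ X.deg 0 := f.2 0 _ (SetLike.one_mem_graded 𝒜)
  obtain ⟨m, hm⟩ := hsurj (f.1 (1 : R))
  have hm' : e.1 (E.proj 0 m) = f.1 (1 : R) := by rw [hom_proj, hm, X.proj_same h1]
  refine ⟨⟨(E.ofElem 0 _ (E.proj_mem 0 m)).1, fun i r hr => ?_⟩, ?_⟩
  · refine (E.ofElem 0 _ (E.proj_mem 0 m)).2 i r ?_
    change r ∈ 𝒜 (i - 0)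
    rwa [sub_zero]
  · ext r
    have h2 : ∀ a : R, e.1 (MulOpposite.op a • E.proj 0 m) = f.1 a := by
      intro a
      refine (e.1.map_smul (MulOpposite.op a) (E.proj 0 m)).trans ?_
      rw [hm']
      exact (f.1.map_smul (MulOpposite.op a) (1 : R)).symm.trans (congrArg f.1 (one_mul a))
    exact h2 r

theorem isFGProj_regular : IsFGProj (regular 𝒜) := by
  have h : (⊤ : Submodule Rᵐᵒᵖ R) = Submodule.span Rᵐᵒᵖ {(1 : R)} := by
    refine (eq_top_iff.2 ?_).symm
    rintro r -
    have := Submodule.smul_mem _ (MulOpposite.op r)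
      (Submodule.mem_span_singleton_self (R := Rᵐᵒᵖ) (1 : R))
    rwa [op_smul_eq_mul, one_mul] at this
  have h' : (⊤ : Submodule Rᵐᵒᵖ R).FG := h ▸ Submodule.fg_span_singleton _
  exact ⟨⟨h'⟩, projective_regular⟩

/-- Equivalences preserve finitely generated graded modules. -/
theorem finite_of_equivalence (e : GrMod 𝒜 ≌ GrMod 𝒜) [e.inverse.Additive] {P : GrMod 𝒜}
    (hP : Module.Finite Rᵐᵒᵖ P) : Module.Finite Rᵐᵒᵖ (e.functor.obj P) := by
  set Q := e.functor.obj P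
  let I := Σ n : ℤ, Q.deg n
  let g : ∀ i : I, (regular 𝒜).shift i.1 ⟶ Q := fun i => Q.ofElem i.1 i.2.1 i.2.2
  let h : ∀ i : I, e.inverse.obj ((regular 𝒜).shift i.1) ⟶ P :=
    fun i => e.inverse.map (g i) ≫ e.unitInv.app P
  have hUhom : P.IsHomog (⨆ i, LinearMap.range (h i).1) :=
    isHomog_iSup fun i => isHomog_range _
  have key : ∀ {Z : GrMod 𝒜} (p : Q ⟶ Z) (i : I),
      h i ≫ (e.unit.app P ≫ e.inverse.map p) = e.inverse.map (g i ≫ p) := by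
    intro Z p i
    simp [h, Q]
  have hU : (⨆ i, LinearMap.range (h i).1) = ⊤ := by
    refine eq_top_of_quotMap_eq_zero (hN := hUhom) ?_
    apply e.functor.map_injective
    have : e.symm.functor.Additive := inferInstanceAs e.inverse.Additive
    have : e.functor.Additive := inferInstanceAs e.symm.inverse.Additive
    rw [Functor.map_zero]
    refine hom_eq_zero_of_ofElem _ fun n m hm => ?_
    apply e.inverse.map_injective
    rw [Functor.map_zero, ← key _ ⟨n, m, hm⟩]
    have h0 : h ⟨n, m, hm⟩ ≫ P.quotMap _ hUhom = 0 := by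
      ext x
      refine (Submodule.Quotient.mk_eq_zero _).2 ?_
      exact Submodule.mem_iSup_of_mem (⟨n, m, hm⟩ : I) ⟨x, rfl⟩
    have h1 : e.unit.app P ≫ e.inverse.map (e.functor.map (P.quotMap _ hUhom)) =
        P.quotMap _ hUhom ≫ e.unit.app _ := (e.unit.naturality _).symm
    rw [h1]
    exact (Category.assoc _ _ _).symm.trans ((congrArg (· ≫ e.unit.app _) h0).trans zero_comp)
  obtain ⟨s, hs⟩ := CompleteLattice.IsCompactElement.exists_finset_of_le_iSup
    (Submodule Rᵐᵒᵖ P) ((Submodule.fg_iff_compact ⊤).1 hP.1) (fun i => LinearMap.range (h i).1)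
    hU.ge
  have hVhom : Q.IsHomog (⨆ i : s, LinearMap.range (g i).1) :=
    isHomog_iSup fun i => isHomog_range _
  have hV : (⨆ i : s, LinearMap.range (g i).1) = ⊤ := by
    refine eq_top_of_quotMap_eq_zero (hN := hVhom) ?_
    apply e.inverse.map_injective
    rw [Functor.map_zero, ← cancel_epi (e.unit.app P), comp_zero]
    have hk : (⊤ : Submodule Rᵐᵒᵖ P) ≤
        LinearMap.ker (e.unit.app P ≫ e.inverse.map (Q.quotMap _ hVhom)).1 := by
      refine hs.trans (iSup₂_le fun i hi => ?_)
      rintro _ ⟨x, rfl⟩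
      have h0 : g i ≫ Q.quotMap _ hVhom = 0 := by
        ext y
        refine (Submodule.Quotient.mk_eq_zero _).2 ?_
        exact Submodule.mem_iSup_of_mem (⟨i, hi⟩ : s) ⟨y, rfl⟩
      have := key (Q.quotMap _ hVhom) i
      rw [h0, Functor.map_zero] at this
      exact congrArg (fun f => f.1 x) this
    ext x
    exact hk (Submodule.mem_top (x := x))
  constructor
  rw [← hV]
  refine Submodule.fg_iSup _ fun i => ?_
  have : Module.Finite Rᵐᵒᵖ ((regular 𝒜).shift (i : I).1) := (isFGProj_regular (𝒜 := 𝒜)).1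
  exact Module.Finite.iff_fg.1 (Module.Finite.range (g i).1)

theorem isFGProj_of_equivalence (e : GrMod 𝒜 ≌ GrMod 𝒜) [e.inverse.Additive] {P : GrMod 𝒜}
    (hP : IsFGProj P) : IsFGProj (e.functor.obj P) :=
  ⟨finite_of_equivalence e hP.1, e.map_projective_iff P |>.2 hP.2⟩

end Regular

end General

end GrMod

/-! ## The Picard group of a `k`-linear category -/

/-- `k`-linear autoequivalences of `C`. -/
structure LinAutoequiv (k : Type u) [Field k] (C : Type*) [Category C] [Preadditive C]
    [Linear k C] where
  toEquiv : C ≌ C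
  [additive : toEquiv.functor.Additive]
  [linear : toEquiv.functor.Linear k]

attribute [instance] LinAutoequiv.additive LinAutoequiv.linear

section Pic

variable (k : Type u) [Field k] (C : Type*) [Category C] [Preadditive C] [Linear k C]

/-- Autoequivalences are identified when they are naturally isomorphic. -/
instance LinAutoequiv.setoid : Setoid (LinAutoequiv k C) where
  r e f := Nonempty (e.toEquiv.functor ≅ f.toEquiv.functor)
  iseqv := ⟨fun _ => ⟨Iso.refl _⟩, fun ⟨h⟩ => ⟨h.symm⟩, fun ⟨h⟩ ⟨h'⟩ => ⟨h ≪≫ h'⟩⟩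

/-- The Picard group: `k`-linear autoequivalences modulo natural isomorphism. -/
def PicGroup := Quotient (LinAutoequiv.setoid k C)

variable {k C}

/-- The composite `e ∘ f` (apply `f` first). -/
def LinAutoequiv.mul (e f : LinAutoequiv k C) : LinAutoequiv k C :=
  haveI : (f.toEquiv.trans e.toEquiv).functor.Additive :=
    inferInstanceAs (f.toEquiv.functor ⋙ e.toEquiv.functor).Additive
  haveI : (f.toEquiv.trans e.toEquiv).functor.Linear k :=
    inferInstanceAs ((f.toEquiv.functor ⋙ e.toEquiv.functor).Linear k)
  ⟨f.toEquiv.trans e.toEquiv⟩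

def LinAutoequiv.one : LinAutoequiv k C :=
  haveI : (CategoryTheory.Equivalence.refl (C := C)).functor.Additive :=
    inferInstanceAs (𝟭 C).Additive
  haveI : (CategoryTheory.Equivalence.refl (C := C)).functor.Linear k :=
    inferInstanceAs ((𝟭 C).Linear k)
  ⟨CategoryTheory.Equivalence.refl⟩

def LinAutoequiv.inv (e : LinAutoequiv k C) : LinAutoequiv k C :=
  haveI : e.toEquiv.symm.functor.Additive := inferInstanceAs e.toEquiv.inverse.Additive
  haveI : e.toEquiv.symm.functor.Linear k := inferInstanceAs (e.toEquiv.inverse.Linear k)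
  ⟨e.toEquiv.symm⟩

instance : Group (PicGroup k C) where
  mul := Quotient.map₂ LinAutoequiv.mul fun _ _ ⟨h⟩ _ _ ⟨h'⟩ => ⟨CategoryTheory.NatIso.hcomp h' h⟩
  one := Quotient.mk _ LinAutoequiv.one
  inv := Quotient.map LinAutoequiv.inv fun e f ⟨h⟩ => ⟨Iso.isoInverseOfIsoFunctor h⟩
  mul_assoc := by
    rintro ⟨a⟩ ⟨b⟩ ⟨c⟩
    exact Quotient.sound ⟨(Functor.associator _ _ _).symm⟩
  one_mul := by
    rintro ⟨a⟩
    exact Quotient.sound ⟨Functor.rightUnitor _⟩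
  mul_one := by
    rintro ⟨a⟩
    exact Quotient.sound ⟨Functor.leftUnitor _⟩
  inv_mul_cancel := by
    rintro ⟨a⟩
    exact Quotient.sound ⟨a.toEquiv.unitIso.symm⟩

end Pic

/-! ## The Grothendieck group of finitely generated graded projective modules -/

section K0

variable {k R : Type u} [Field k] [Ring R] [Algebra k R] (𝒜 : ℤ → Submodule k R)

/-- Isomorphism classes of finitely generated graded projective modules. -/
def FGProjClass : Type (u + 1) :=
  Quotient (isIsomorphicSetoid (GrMod.IsFGProj (𝒜 := 𝒜)).FullSubcategory)

/-- The isomorphism class of a finitely generated graded projective module. -/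
def FGProjClass.mk {𝒜 : ℤ → Submodule k R} (P : GrMod 𝒜) (hP : GrMod.IsFGProj P) :
    FGProjClass 𝒜 :=
  Quotient.mk _ ⟨P, hP⟩

/-- The relations `[P ⊕ Q] = [P] + [Q]`. -/
def K0Relations : AddSubgroup (FreeAbelianGroup (FGProjClass 𝒜)) :=
  AddSubgroup.closure {r | ∃ (P Q S : GrMod 𝒜) (hP : GrMod.IsFGProj P) (hQ : GrMod.IsFGProj Q)
    (hS : GrMod.IsFGProj S) (b : BinaryBicone P Q),
    Nonempty b.IsBilimit ∧ Nonempty (b.pt ≅ S) ∧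
    r = FreeAbelianGroup.of (FGProjClass.mk S hS) -
      (FreeAbelianGroup.of (FGProjClass.mk P hP) + FreeAbelianGroup.of (FGProjClass.mk Q hQ))}

/-- The graded Grothendieck group. -/
abbrev GrK0 : Type (u + 1) := FreeAbelianGroup (FGProjClass 𝒜) ⧸ K0Relations 𝒜

/-- The class in the Grothendieck group of an isomorphism class of modules. -/
def GrK0.of (c : FGProjClass 𝒜) : GrK0 𝒜 :=
  QuotientAddGroup.mk (FreeAbelianGroup.of c)

variable [GradedAlgebra 𝒜]

/-- The reduced graded Grothendieck group: the quotient by the subgroup generated by the class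
of the graded ring itself. -/
abbrev ReducedGrK0 : Type (u + 1) :=
  GrK0 𝒜 ⧸ AddSubgroup.zmultiples
    (GrK0.of 𝒜 (FGProjClass.mk (GrMod.regular 𝒜) GrMod.isFGProj_regular))

/-- The isomorphism class of the module `F(R)`, for `F` in the Picard group. -/
def PicGroup.evalRegular (c : PicGroup k (GrMod 𝒜)) : FGProjClass 𝒜 :=
  Quotient.lift
    (fun e : LinAutoequiv k (GrMod 𝒜) => FGProjClass.mk (e.toEquiv.functor.obj (GrMod.regular 𝒜))
      (GrMod.isFGProj_of_equivalence e.toEquiv GrMod.isFGProj_regular))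
    (fun _ _ (h : Nonempty (_ ≅ _)) => h.elim fun i =>
      Quotient.sound ⟨ObjectProperty.isoMk _ (i.app _)⟩) c

/-- The class `[F(R)]` in the reduced Grothendieck group, for `F` in the Picard group. -/
def PicGroup.reducedClass (c : PicGroup k (GrMod 𝒜)) : ReducedGrK0 𝒜 :=
  QuotientAddGroup.mk (GrK0.of 𝒜 (PicGroup.evalRegular 𝒜 c))

end K0

/-! ## The first Weyl algebra with the Euler grading -/

/-- The defining relation `x y = y x + 1`, where `x`, `y` are the generators indexed by `true`,
`false`. -/
inductive WeylRel (k : Type u) [Field k] : FreeAlgebra k Bool → FreeAlgebra k Bool → Prop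
  | rel : WeylRel k (FreeAlgebra.ι k true * FreeAlgebra.ι k false)
      (FreeAlgebra.ι k false * FreeAlgebra.ι k true + 1)

/-- The first Weyl algebra `k⟨x, y⟩ / (x y - y x - 1)`. -/
def Weyl (k : Type u) [Field k] : Type u := RingQuot (WeylRel k)

namespace Weyl

variable (k : Type u) [Field k]

instance : Ring (Weyl k) := inferInstanceAs (Ring (RingQuot (WeylRel k)))

instance : Algebra k (Weyl k) := inferInstanceAs (Algebra k (RingQuot (WeylRel k)))

/-- The quotient map from the free algebra. -/
def mk : FreeAlgebra k Bool →ₐ[k] Weyl k := RingQuot.mkAlgHom k (WeylRel k)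

/-- The generators. -/
def gen (b : Bool) : Weyl k := mk k (FreeAlgebra.ι k b)

abbrev x : Weyl k := gen k true

abbrev y : Weyl k := gen k false

abbrev z : Weyl k := x k * y k

theorem rel : x k * y k = y k * x k + 1 := by
  have : mk k _ = mk k _ := RingQuot.mkAlgHom_rel k (WeylRel.rel (k := k))
  rwa [map_add, map_mul, map_mul, map_one] at this

/-- The element of the Weyl algebra given by a word in `x` and `y`. -/
def word (l : List Bool) : Weyl k := (l.map (gen k)).prod

variable {k} in
/-- The degree of a word: `deg x = 1`, `deg y = -1`. -/
def wordDeg (l : List Bool) : ℤ := (l.map fun b => if b then (1 : ℤ) else -1).sum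

/-- The Euler grading: the component of degree `n` is spanned by the words of degree `n`. -/
def grading (n : ℤ) : Submodule k (Weyl k) :=
  Submodule.span k {w | ∃ l : List Bool, wordDeg l = n ∧ w = word k l}

theorem word_mem (l : List Bool) : word k l ∈ grading k (wordDeg l) :=
  Submodule.subset_span ⟨l, rfl, rfl⟩

theorem gen_mem (b : Bool) : gen k b ∈ grading k (if b then 1 else -1) := by
  have := word_mem k [b]
  simpa [word, wordDeg] using this

instance : SetLike.GradedMonoid (grading k) where
  one_mem := word_mem k []
  mul_mem i j a b ha hb := by
    have h : a * b ∈ grading k i * grading k j := Submodule.mul_mem_mul ha hb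
    rw [grading, grading, Submodule.span_mul_span] at h
    refine Submodule.span_mono ?_ h
    rintro _ ⟨_, ⟨l, rfl, rfl⟩, _, ⟨l', rfl, rfl⟩, rfl⟩
    exact ⟨l ++ l', by simp [wordDeg], by simp [word]⟩

/-- The generators, as homogeneous elements of the direct sum of the components. -/
def genComponent (b : Bool) : ⨁ i, grading k i :=
  DirectSum.of (fun i => grading k i) (if b then 1 else -1) ⟨gen k b, gen_mem k b⟩

/-- The decomposition into homogeneous components. -/
def decomposeHom : Weyl k →ₐ[k] ⨁ i, grading k i :=
  RingQuot.liftAlgHom k ⟨FreeAlgebra.lift k (genComponent k), by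
    rintro _ _ ⟨⟩
    rw [map_add, map_mul, map_mul, map_one, FreeAlgebra.lift_ι_apply, FreeAlgebra.lift_ι_apply]
    rw [genComponent, genComponent, DirectSum.of_mul_of, DirectSum.of_mul_of]
    change DirectSum.of (fun i => grading k i) 0 _ = DirectSum.of (fun i => grading k i) 0 _ +
      DirectSum.of (fun i => grading k i) 0 _
    rw [← map_add]
    exact congrArg _ (Subtype.ext (rel k))⟩

theorem decomposeHom_gen (b : Bool) : decomposeHom k (gen k b) = genComponent k b := by
  refine (RingQuot.liftAlgHom_mkAlgHom_apply k _ _ _).trans ?_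
  rw [FreeAlgebra.lift_ι_apply]

theorem decomposeHom_word (l : List Bool) : decomposeHom k (word k l) =
    DirectSum.of (fun i => grading k i) (wordDeg l) ⟨word k l, word_mem k l⟩ := by
  induction l with
  | nil => exact map_one _
  | cons b l ih =>
    have h : word k (b :: l) = gen k b * word k l := by simp [word]
    refine ((congrArg _ h).trans (map_mul _ _ _)).trans ?_
    rw [ih, decomposeHom_gen, genComponent, DirectSum.of_mul_of]
    exact DirectSum.of_eq_of_gradedMonoid_eq (Sigma.subtype_ext
      (show (if b then (1 : ℤ) else -1) + wordDeg l = wordDeg (b :: l) by simp [wordDeg]) h.symm)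

instance : GradedAlgebra (grading k) :=
  GradedAlgebra.ofAlgHom (grading k) (decomposeHom k)
    (by
      apply RingQuot.ringQuot_ext'
      apply FreeAlgebra.hom_ext
      funext b
      change DirectSum.coeAlgHom (grading k) (decomposeHom k (gen k b)) = gen k b
      rw [decomposeHom_gen, genComponent, DirectSum.coeAlgHom_of])
    (by
      rintro i ⟨a, ha⟩
      have key : ∀ a ∈ grading k i, ∀ h : a ∈ grading k i,
          decomposeHom k a = DirectSum.of (fun i => grading k i) i ⟨a, h⟩ := by
        intro a ha
        refine Submodule.span_induction (p := fun a _ => ∀ h : a ∈ grading k i,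
          decomposeHom k a = DirectSum.of (fun i => grading k i) i ⟨a, h⟩) ?_ ?_ ?_ ?_ ha
        · rintro _ ⟨l, rfl, rfl⟩ h
          exact decomposeHom_word k l
        · intro h
          rw [map_zero]
          exact (map_zero (DirectSum.of (fun i => grading k i) i)).symm
        · intro a b ha hb iha ihb h
          rw [map_add, iha ha, ihb hb, ← map_add]
          rfl
        · intro c a ha iha h
          rw [map_smul, iha ha]
          exact ((DirectSum.lof k ℤ (fun i => grading k i) i).map_smul c ⟨a, ha⟩).symm
      exact key a ha ha)

/-! ### The graded simple modules -/

/-- The category of graded right modules over the Weyl algebra. -/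
abbrev Gr : Type (u + 1) := GrMod (grading k)

/-- The Weyl algebra as a graded right module over itself. -/
abbrev reg : Gr k := GrMod.regular (grading k)

/-- The right ideal generated by an element. -/
def rightIdeal (a : Weyl k) : Submodule (Weyl k)ᵐᵒᵖ (reg k) :=
  Submodule.span (Weyl k)ᵐᵒᵖ {(a : Weyl k)}

theorem isHomog_rightIdeal {a : Weyl k} {n : ℤ} (ha : a ∈ grading k n) :
    (reg k).IsHomog (rightIdeal k a) := by
  have h := GrMod.isHomog_range ((reg k).ofElem n a ha)
  have h' : LinearMap.range ((reg k).ofElem n a ha).1 = rightIdeal k a := by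
    apply le_antisymm
    · rintro _ ⟨r, rfl⟩
      exact Submodule.smul_mem _ (MulOpposite.op (α := Weyl k) r) (Submodule.mem_span_singleton_self _)
    · refine Submodule.span_le.2 ?_
      rintro _ rfl
      exact ⟨(1 : Weyl k), GrMod.ofElem_one _ _ _ _⟩
  rwa [h'] at h

/-- `A / aA`, for a homogeneous element `a`. -/
noncomputable def cyclic (a : Weyl k) {n : ℤ} (ha : a ∈ grading k n) : Gr k :=
  (reg k).quot (rightIdeal k a) (isHomog_rightIdeal k ha)

/-- The simple module `X = A / xA`. -/
noncomputable def X : Gr k := cyclic k (x k) (gen_mem k true)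

/-- The simple module `Y = (A / yA)⟨1⟩`. -/
noncomputable def Y : Gr k := (cyclic k (y k) (gen_mem k false)).shift 1

theorem z_add_mem (c : k) : z k + algebraMap k (Weyl k) c ∈ grading k 0 := by
  refine Submodule.add_mem _ ?_ ?_
  · have := word_mem k [true, false]
    simpa [word, wordDeg] using this
  · rw [Algebra.algebraMap_eq_smul_one]
    exact Submodule.smul_mem _ c (word_mem k [])

/-- The module `M_c = A / (z + c)A`. -/
noncomputable def M (c : k) : Gr k := cyclic k _ (z_add_mem k c)

/-! ### Sign, rank, and numerically trivial autoequivalences -/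

variable {k}

/-- `F` has sign `a` and rank `b`: up to isomorphism, `F` carries the pair `{X⟨n⟩, Y⟨n⟩}` to the
pair `{X⟨an+b⟩, Y⟨an+b⟩}` for every integer `n`, and `M_c` to `M_{ac+b}` for every `c ∉ ℤ`. -/
def HasSignRank (F : Gr k ⥤ Gr k) (a b : ℤ) : Prop :=
  (∀ n : ℤ,
    (Nonempty (F.obj ((X k).shift n) ≅ (X k).shift (a * n + b)) ∧
      Nonempty (F.obj ((Y k).shift n) ≅ (Y k).shift (a * n + b))) ∨
    (Nonempty (F.obj ((X k).shift n) ≅ (Y k).shift (a * n + b)) ∧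
      Nonempty (F.obj ((Y k).shift n) ≅ (X k).shift (a * n + b)))) ∧
  ∀ c : k, c ∉ Set.range (Int.cast : ℤ → k) → Nonempty (F.obj (M k c) ≅ M k (a * c + b))

/-- A functor is numerically trivial if it is even (has sign `1`) and has rank `0`. -/
def NumericallyTrivial (F : Gr k ⥤ Gr k) : Prop := HasSignRank F 1 0

theorem numericallyTrivial_iff (F : Gr k ⥤ Gr k) : NumericallyTrivial F ↔
    (∀ n : ℤ,
      (Nonempty (F.obj ((X k).shift n) ≅ (X k).shift n) ∧
        Nonempty (F.obj ((Y k).shift n) ≅ (Y k).shift n)) ∨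
      (Nonempty (F.obj ((X k).shift n) ≅ (Y k).shift n) ∧
        Nonempty (F.obj ((Y k).shift n) ≅ (X k).shift n))) ∧
    ∀ c : k, c ∉ Set.range (Int.cast : ℤ → k) → Nonempty (F.obj (M k c) ≅ M k c) := by
  simp only [NumericallyTrivial, HasSignRank, one_mul, add_zero, Int.cast_one, Int.cast_zero]

theorem NumericallyTrivial.id : NumericallyTrivial (𝟭 (Gr k)) :=
  (numericallyTrivial_iff _).2
    ⟨fun _ => Or.inl ⟨⟨Iso.refl _⟩, ⟨Iso.refl _⟩⟩, fun _ _ => ⟨Iso.refl _⟩⟩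

theorem NumericallyTrivial.comp {F G : Gr k ⥤ Gr k} (hF : NumericallyTrivial F)
    (hG : NumericallyTrivial G) : NumericallyTrivial (F ⋙ G) := by
  rw [numericallyTrivial_iff] at *
  refine ⟨fun n => ?_, fun c hc => ?_⟩
  · rcases hF.1 n with ⟨⟨f1⟩, ⟨f2⟩⟩ | ⟨⟨f1⟩, ⟨f2⟩⟩ <;>
      rcases hG.1 n with ⟨⟨g1⟩, ⟨g2⟩⟩ | ⟨⟨g1⟩, ⟨g2⟩⟩
    · exact Or.inl ⟨⟨G.mapIso f1 ≪≫ g1⟩, ⟨G.mapIso f2 ≪≫ g2⟩⟩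
    · exact Or.inr ⟨⟨G.mapIso f1 ≪≫ g1⟩, ⟨G.mapIso f2 ≪≫ g2⟩⟩
    · exact Or.inr ⟨⟨G.mapIso f1 ≪≫ g2⟩, ⟨G.mapIso f2 ≪≫ g1⟩⟩
    · exact Or.inl ⟨⟨G.mapIso f1 ≪≫ g2⟩, ⟨G.mapIso f2 ≪≫ g1⟩⟩
  · obtain ⟨f⟩ := hF.2 c hc
    obtain ⟨g⟩ := hG.2 c hc
    exact ⟨G.mapIso f ≪≫ g⟩

theorem NumericallyTrivial.inverse {e : Gr k ≌ Gr k} (h : NumericallyTrivial e.functor) :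
    NumericallyTrivial e.inverse := by
  rw [numericallyTrivial_iff] at *
  have key : ∀ {S T : Gr k}, (e.functor.obj S ≅ T) → (e.inverse.obj T ≅ S) := fun i =>
    e.inverse.mapIso i.symm ≪≫ (e.unitIso.app _).symm
  refine ⟨fun n => ?_, fun c hc => ?_⟩
  · rcases h.1 n with ⟨⟨f1⟩, ⟨f2⟩⟩ | ⟨⟨f1⟩, ⟨f2⟩⟩
    · exact Or.inl ⟨⟨key f1⟩, ⟨key f2⟩⟩
    · exact Or.inr ⟨⟨key f2⟩, ⟨key f1⟩⟩
  · obtain ⟨f⟩ := h.2 c hc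
    exact ⟨key f⟩

variable (k)

/-- The Picard group of the category of graded right modules over the Weyl algebra. -/
abbrev Pic : Type (u + 1) := PicGroup k (Gr k)

/-- The subgroup of numerically trivial autoequivalences. -/
def Pic₀ : Subgroup (Pic k) where
  carrier := {c | ∃ e : LinAutoequiv k (Gr k),
    Quotient.mk _ e = c ∧ NumericallyTrivial e.toEquiv.functor}
  mul_mem' := by
    rintro _ _ ⟨e, rfl, he⟩ ⟨f, rfl, hf⟩
    exact ⟨LinAutoequiv.mul e f, rfl, hf.comp he⟩
  one_mem' := ⟨LinAutoequiv.one, rfl, NumericallyTrivial.id⟩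
  inv_mem' := by
    rintro _ ⟨e, rfl, he⟩
    exact ⟨LinAutoequiv.inv e, rfl, he.inverse⟩

/-! ### The involutions -/

/-- The pair of simple modules `X⟨j⟩`, `Y⟨j⟩`. -/
noncomputable def simplePair (j : ℤ) : Bool → Gr k
  | true => (X k).shift j
  | false => (Y k).shift j

/-- `c` is the class of the autoequivalence `ι_j`: the (extension to all graded modules of the)
functor which sends a graded projective module of rank one to its reject of `X⟨j⟩ ⊕ Y⟨j⟩`, and a
homomorphism between two such modules to its restriction. -/
def IsIota (j : ℤ) (c : Pic k) : Prop :=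
  ∃ e : LinAutoequiv k (Gr k), Quotient.mk _ e = c ∧
    Nonempty ((GrMod.IsRankOneProj (𝒜 := grading k)).ι ⋙ e.toEquiv.functor ≅
      (GrMod.IsRankOneProj (𝒜 := grading k)).ι ⋙ GrMod.rejectFunctor (simplePair k j))

variable {k} in
/-- The product `ι_J` of the `ι_j`, `j ∈ J`, taken in increasing order. -/
def iotaProd (ι : ℤ → Pic₀ k) (J : Finset ℤ) : Pic₀ k :=
  ((J.sort (· ≤ ·)).map ι).prod

end Weyl

/-! A graded right module is a sequence of spaces M_n with maps x : M_n → M_{n+1} and y : M_{n+1} →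
M_n, and M_n = Hom(A⟨n⟩, M). The pair X⟨j⟩, Y⟨j⟩ sits at the gap between degrees j and j+1: X⟨j⟩
lives in degrees ≤ j and Y⟨j⟩ in degrees > j. Morphisms M → X⟨j⟩ are the functionals on M_j /
M_{j+1}y, and morphisms M → Y⟨j⟩ are the functionals on M_{j+1} / M_j x. In particular A⟨n⟩ maps
nontrivially to exactly one member of each pair: to X⟨j⟩ if n ≤ j, to Y⟨j⟩ otherwise.

Existence of ι_j. Membership in the reject of X⟨j⟩ ⊕ Y⟨j⟩ is an equation with a witness. Keeping the
witness as a second coordinate gives a functor `iotaFunctor` on all modules, which reflects a module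
at the gap: the components of degrees j and j+1 trade places, and so do x and y between them. It is
an involution (`etaIso`, by a Bézout identity in k[z] that needs characteristic zero), it exchanges
X⟨j⟩ and Y⟨j⟩, it fixes the pairs with other parameters and the M_λ with λ not an integer, and it
agrees with the reject on finitely generated projectives, because these are torsion-free over k[z].

Rigidity. A numerically trivial autoequivalence F has a swap pattern ℤ → ℤ/2, recording the pairs
that it exchanges; this defines the homomorphism `swapHom`. It is injective (`swapHom_injective`):
if every X⟨j⟩ and Y⟨j⟩ is fixed, then F A⟨n⟩ has the same dimensions of morphisms to these simples
as A⟨n⟩, hence is isomorphic to it (`nonempty_iso_sh`). The scalars by which z acts on Hom(A⟨n⟩,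
X⟨j⟩) show that F fixes z ∈ End A⟨n⟩, and rescaling then makes the isomorphisms compatible with x
and y, so that F ≅ id. Consequently Pic₀ is abelian of exponent two.

The Grothendieck group. Let S_j be the member of the pair j that is not a quotient of A. The parity
of dim Hom(P, S_j) is additive in P and vanishes on A, so it gives `parity` from the reduced group
to ℤ → ℤ/2. For F in Pic₀ the parity of [F A] is the swap pattern of F (`parity_reducedClass`). The
group K₀ is generated by the [A⟨n⟩] (`shSubgroup_eq_top`): Schanuel's lemma and 0 → A⟨j⟩ → A⟨j+1⟩ →
Y⟨j⟩ → 0 cut any P down to a sum of copies of a single A⟨n⟩. Each A⟨n⟩ is ι_J A for an interval J,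
so all parities are swap patterns, and θ is `parity` followed by the inverse of `swapHom`.

Then θ([F A]) = F for every F in Pic₀, so θ is onto. The reduced group is generated by the
differences [A⟨j+1⟩] − [A⟨j⟩], and the parity at j of a combination of these is its coefficient at j
modulo two. Hence the kernel of θ consists of the multiples of two, and θ ⊗ 1 is an isomorphism. -/

namespace GrMod

/-! ### Morphisms and elements examined degree by degree -/

section Degreewise

variable {k R : Type u} [Field k] [Ring R] [Algebra k R] {𝒜 : ℤ → Submodule k R}

theorem ext_proj {M : GrMod 𝒜} {m m' : M} (h : ∀ i, M.proj i m = M.proj i m') : m = m' := by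
  have : ∀ i, M.proj i (m - m') = 0 := fun i => by rw [map_sub, h, sub_self]
  obtain ⟨s, hs⟩ := M.sum_proj (m - m')
  rw [Finset.sum_eq_zero fun i _ => this i] at hs
  exact sub_eq_zero.1 hs.symm

/-- Induction over homogeneous elements. -/
theorem induction_homog {M : GrMod 𝒜} {p : M → Prop} (zero : p 0)
    (add : ∀ m m', p m → p m' → p (m + m')) (homog : ∀ n, ∀ m ∈ M.deg n, p m) (m : M) : p m := by
  obtain ⟨s, hs⟩ := M.sum_proj m
  rw [← hs]
  exact Finset.sum_induction _ p add zero fun i _ => homog i _ (M.proj_mem i m)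

theorem hom_ext_homog {M N : GrMod 𝒜} {f g : M ⟶ N} (h : ∀ n, ∀ m ∈ M.deg n, f.1 m = g.1 m) :
    f = g := by
  ext m
  refine induction_homog (by simp) (fun a b ha hb => ?_) h m
  rw [map_add, map_add, ha, hb]

@[simp] theorem add_apply {M N : GrMod 𝒜} (f g : M ⟶ N) (m : M) : (f + g).1 m = f.1 m + g.1 m := rfl

@[simp] theorem sub_apply {M N : GrMod 𝒜} (f g : M ⟶ N) (m : M) : (f - g).1 m = f.1 m - g.1 m :=
  rfl

@[simp] theorem smul_apply {M N : GrMod 𝒜} (c : k) (f : M ⟶ N) (m : M) :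
    (c • f).1 m = c • f.1 m := rfl

theorem hom_smul {M N : GrMod 𝒜} (f : M ⟶ N) (c : k) (m : M) : f.1 (c • m) = c • f.1 m :=
  (f.1.restrictScalars k).map_smul c m

/-- A morphism as a `k`-linear map. -/
def lin {M N : GrMod 𝒜} (f : M ⟶ N) : M →ₗ[k] N := f.1.restrictScalars k

@[simp] theorem lin_apply {M N : GrMod 𝒜} (f : M ⟶ N) (m : M) : lin f m = f.1 m := rfl

theorem injective_of_homog {M N : GrMod 𝒜} (f : M ⟶ N)
    (h : ∀ n, ∀ m ∈ M.deg n, f.1 m = 0 → m = 0) : Function.Injective f.1 := by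
  rw [injective_iff_map_eq_zero]
  intro m hm
  refine ext_proj fun i => ?_
  rw [map_zero]
  refine h i _ (M.proj_mem i m) ?_
  rw [hom_proj, hm, map_zero]

theorem surjective_of_homog {M N : GrMod 𝒜} (f : M ⟶ N)
    (h : ∀ n, ∀ m ∈ N.deg n, ∃ m' : M, f.1 m' = m) : Function.Surjective f.1 :=
  induction_homog ⟨0, map_zero _⟩
    (fun _ _ ⟨a, ha⟩ ⟨b, hb⟩ => ⟨a + b, by rw [map_add, ha, hb]⟩) h

theorem exists_homog_preimage {M N : GrMod 𝒜} (f : M ⟶ N) (hf : Function.Surjective f.1) {n : ℤ}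
    {m : N} (hm : m ∈ N.deg n) : ∃ m' ∈ M.deg n, f.1 m' = m := by
  obtain ⟨m', rfl⟩ := hf m
  exact ⟨M.proj n m', M.proj_mem n m', by rw [hom_proj, N.proj_same hm]⟩

/-- A bijective morphism is an isomorphism. -/
noncomputable def isoOfBijective {M N : GrMod 𝒜} (f : M ⟶ N) (hi : Function.Injective f.1)
    (hs : Function.Surjective f.1) : M ≅ N :=
  let e := LinearEquiv.ofBijective f.1 ⟨hi, hs⟩
  { hom := f
    inv := ⟨e.symm.toLinearMap, fun i m hm => by
      obtain ⟨m', hm', rfl⟩ := exists_homog_preimage f hs hm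
      have : e.symm (f.1 m') = m' := e.symm_apply_apply m'
      exact this.symm ▸ hm'⟩
    hom_inv_id := hom_ext fun m => e.symm_apply_apply m
    inv_hom_id := hom_ext fun m => e.apply_symm_apply m }

theorem iso_injective {M N : GrMod 𝒜} (e : M ≅ N) : Function.Injective e.hom.1 := fun a b h => by
  have := congrArg e.inv.1 h
  rwa [← comp_apply, ← comp_apply, e.hom_inv_id] at this

theorem epi_of_surjective {M N : GrMod 𝒜} (f : M ⟶ N) (hs : Function.Surjective f.1) : Epi f :=
  ⟨fun g h hgh => hom_ext fun m => by
    obtain ⟨m, rfl⟩ := hs m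
    exact congrArg (fun q => q.1 m) hgh⟩

theorem surjective_of_epi {M N : GrMod 𝒜} (f : M ⟶ N) [Epi f] : Function.Surjective f.1 := by
  have h0 : N.quotMap _ (isHomog_range f) = 0 := by
    rw [← cancel_epi f, comp_zero]
    ext m
    exact (Submodule.Quotient.mk_eq_zero _).2 ⟨m, rfl⟩
  exact LinearMap.range_eq_top.1 (eq_top_of_quotMap_eq_zero h0)

/-- The inclusion of a homogeneous submodule. -/
noncomputable def subMap (M : GrMod 𝒜) (N : Submodule Rᵐᵒᵖ M) (hN : M.IsHomog N) : M.sub N hN ⟶ M :=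
  ⟨N.subtype, fun _ _ hm => hm⟩

/-- Corestriction to a homogeneous submodule. -/
noncomputable def subLift {M L : GrMod 𝒜} (N : Submodule Rᵐᵒᵖ M) (hN : M.IsHomog N) (f : L ⟶ M)
    (hf : ∀ m, f.1 m ∈ N) : L ⟶ M.sub N hN :=
  ⟨f.1.codRestrict N hf, fun i m hm => f.2 i m hm⟩

section Regular

variable [GradedAlgebra 𝒜]

/-- The generator of `R⟨n⟩`. -/
def unit (𝒜 : ℤ → Submodule k R) [GradedAlgebra 𝒜] (n : ℤ) : (regular 𝒜).shift n := (1 : R)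

theorem unit_mem (n : ℤ) : unit 𝒜 n ∈ ((regular 𝒜).shift n).deg n := by
  change (1 : R) ∈ 𝒜 (n - n)
  rw [sub_self]
  exact SetLike.one_mem_graded 𝒜

@[simp] theorem ofElem_unit (M : GrMod 𝒜) (n : ℤ) (m : M) (hm : m ∈ M.deg n) :
    (M.ofElem n m hm).1 (unit 𝒜 n) = m := ofElem_one M n m hm

theorem hom_regular_apply {M : GrMod 𝒜} {n : ℤ} (f : (regular 𝒜).shift n ⟶ M)
    (r : (regular 𝒜).shift n) :
    f.1 r = MulOpposite.op (α := R) r • f.1 (unit 𝒜 n) := by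
  have := f.1.map_smul (MulOpposite.op (α := R) r) (unit 𝒜 n)
  rw [← this]
  exact congrArg f.1 (one_mul (M := R) r).symm

/-- Morphisms from `R⟨n⟩` are homogeneous elements of degree `n`. -/
def homRegularEquiv (M : GrMod 𝒜) (n : ℤ) : ((regular 𝒜).shift n ⟶ M) ≃ₗ[k] M.deg n where
  toFun f := ⟨f.1 (unit 𝒜 n), f.2 n _ (unit_mem n)⟩
  invFun m := M.ofElem n m.1 m.2
  left_inv f := hom_ext fun r => (hom_regular_apply f r).symm
  right_inv m := Subtype.ext (ofElem_one M n m.1 m.2)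
  map_add' _ _ := rfl
  map_smul' _ _ := rfl

theorem hom_regular_ext {M : GrMod 𝒜} {n : ℤ} {f g : (regular 𝒜).shift n ⟶ M}
    (h : f.1 (unit 𝒜 n) = g.1 (unit 𝒜 n)) : f = g :=
  (homRegularEquiv M n).injective (Subtype.ext h)

theorem ofElem_comp {M N : GrMod 𝒜} (n : ℤ) (m : M) (hm : m ∈ M.deg n) (f : M ⟶ N) :
    M.ofElem n m hm ≫ f = N.ofElem n (f.1 m) (f.2 n m hm) :=
  hom_regular_ext (by rw [comp_apply, ofElem_unit, ofElem_unit])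

theorem projective_shift_regular (n : ℤ) : Projective ((regular 𝒜).shift n) := by
  constructor
  intro E X f e he
  obtain ⟨m, hm, hme⟩ := exists_homog_preimage e (surjective_of_epi e)
    (f.2 n _ (unit_mem n))
  refine ⟨E.ofElem n m hm, hom_regular_ext ?_⟩
  rw [comp_apply, ofElem_unit, hme]

theorem isFGProj_shift_regular (n : ℤ) : IsFGProj ((regular 𝒜).shift n) :=
  ⟨(isFGProj_regular (𝒜 := 𝒜)).1, projective_shift_regular n⟩

end Regular

end Degreewise

end GrMod

/-! ### The action of the generators, and morphisms given on homogeneous components -/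

namespace Weyl

open MulOpposite

variable {k : Type u} [Field k]

theorem induction {C : Weyl k → Prop} (hk : ∀ c : k, C (algebraMap k _ c)) (hg : ∀ b, C (gen k b))
    (hmul : ∀ a b, C a → C b → C (a * b)) (hadd : ∀ a b, C a → C b → C (a + b)) (a : Weyl k) :
    C a := by
  obtain ⟨a, rfl⟩ : ∃ f, mk k f = a := RingQuot.mkAlgHom_surjective k (WeylRel k) a
  induction a using FreeAlgebra.induction with
  | grade0 c => rw [AlgHom.commutes]; exact hk c
  | grade1 b => exact hg b
  | mul a b ha hb => rw [map_mul]; exact hmul _ _ ha hb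
  | add a b ha hb => rw [map_add]; exact hadd _ _ ha hb

/-- The right action of an element of the Weyl algebra, as a linear map. -/
def act (M : Gr k) (a : Weyl k) : M →ₗ[k] M where
  toFun m := op a • m
  map_add' := smul_add _
  map_smul' c m := smul_comm (op a) c m

theorem act_apply (M : Gr k) (a : Weyl k) (m : M) : act M a m = op a • m := rfl

/-- Right multiplication by `x`. -/
def mX (M : Gr k) : M →ₗ[k] M := act M (x k)

/-- Right multiplication by `y`. -/
def mY (M : Gr k) : M →ₗ[k] M := act M (y k)

theorem act_mul (M : Gr k) (a b : Weyl k) (m : M) : act M (a * b) m = act M b (act M a m) := by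
  rw [act_apply, op_mul, mul_smul]; rfl

theorem act_add (M : Gr k) (a b : Weyl k) (m : M) : act M (a + b) m = act M a m + act M b m := by
  exact add_smul (op a) (op b) m

theorem act_sub (M : Gr k) (a b : Weyl k) (m : M) : act M (a - b) m = act M a m - act M b m := by
  exact sub_smul (op a) (op b) m

theorem act_one (M : Gr k) (m : M) : act M 1 m = m := by
  rw [act_apply, op_one, one_smul]

theorem act_algebraMap (M : Gr k) (c : k) (m : M) : act M (algebraMap k _ c) m = c • m := by
  rw [act_apply]
  exact algebraMap_smul (Weyl k)ᵐᵒᵖ c m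

theorem hom_act {M N : Gr k} (f : M ⟶ N) (a : Weyl k) (m : M) :
    f.1 (act M a m) = act N a (f.1 m) := f.1.map_smul _ _

theorem hom_mX {M N : Gr k} (f : M ⟶ N) (m : M) : f.1 (mX M m) = mX N (f.1 m) := hom_act f _ m

theorem hom_mY {M N : Gr k} (f : M ⟶ N) (m : M) : f.1 (mY M m) = mY N (f.1 m) := hom_act f _ m

theorem act_z (M : Gr k) (m : M) : act M (z k) m = mY M (mX M m) := act_mul _ _ _ _

/-- The relation `xy = yx + 1` on modules. -/
theorem mY_mX (M : Gr k) (m : M) : mY M (mX M m) = mX M (mY M m) + m := by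
  have := congrArg (fun a => act M a m) (rel k)
  simp only [act_mul, act_add, act_one] at this
  exact this

theorem act_mem {M : Gr k} {n d : ℤ} {m : M} {a : Weyl k} (hm : m ∈ M.deg n) (ha : a ∈ grading k d) :
    act M a m ∈ M.deg (n + d) := M.smul_mem hm ha

theorem mX_mem {M : Gr k} {n : ℤ} {m : M} (hm : m ∈ M.deg n) : mX M m ∈ M.deg (n + 1) :=
  M.smul_mem hm (gen_mem k true)

theorem mY_mem {M : Gr k} {n : ℤ} {m : M} (hm : m ∈ M.deg (n + 1)) : mY M m ∈ M.deg n := by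
  have := M.smul_mem hm (gen_mem k false)
  simp only [Bool.false_eq_true, if_false, add_neg_cancel_right] at this
  exact this

theorem mY_mem' {M : Gr k} {n : ℤ} {m : M} (hm : m ∈ M.deg n) : mY M m ∈ M.deg (n - 1) :=
  mY_mem (by rwa [sub_add_cancel])

theorem mX_pow_mem {M : Gr k} {n : ℤ} {m : M} (hm : m ∈ M.deg n) (d : ℕ) :
    (mX M ^ d) m ∈ M.deg (n + d) := by
  induction d with
  | zero => simpa using hm
  | succ d ih =>
    rw [pow_succ', Module.End.mul_apply]
    have := mX_mem ih
    rwa [add_assoc] at this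

theorem mY_pow_mem {M : Gr k} {n : ℤ} {m : M} (hm : m ∈ M.deg n) (d : ℕ) :
    (mY M ^ d) m ∈ M.deg (n - d) := by
  induction d with
  | zero => simpa using hm
  | succ d ih =>
    rw [pow_succ', Module.End.mul_apply]
    have := mY_mem' ih
    rwa [sub_sub] at this

theorem hom_mX_pow {M N : Gr k} (f : M ⟶ N) (d : ℕ) (m : M) :
    f.1 ((mX M ^ d) m) = (mX N ^ d) (f.1 m) := by
  induction d generalizing m with
  | zero => rfl
  | succ d ih => rw [pow_succ, pow_succ, Module.End.mul_apply, ih, hom_mX]; rfl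

theorem hom_mY_pow {M N : Gr k} (f : M ⟶ N) (d : ℕ) (m : M) :
    f.1 ((mY M ^ d) m) = (mY N ^ d) (f.1 m) := by
  induction d generalizing m with
  | zero => rfl
  | succ d ih => rw [pow_succ, pow_succ, Module.End.mul_apply, ih, hom_mY]; rfl

/-- A morphism from compatible linear maps on the homogeneous components. -/
theorem exists_hom {M N : Gr k} (f : ℤ → M →ₗ[k] N) (hdeg : ∀ n, ∀ m ∈ M.deg n, f n m ∈ N.deg n)
    (hx : ∀ n, ∀ m ∈ M.deg n, f (n + 1) (mX M m) = mX N (f n m))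
    (hy : ∀ n, ∀ m ∈ M.deg (n + 1), f n (mY M m) = mY N (f (n + 1) m)) :
    ∃ F : M ⟶ N, ∀ n, ∀ m ∈ M.deg n, F.1 m = f n m := by
  classical
  let F : M →ₗ[k] N := DirectSum.toModule k ℤ N (fun n => f n ∘ₗ (M.deg n).subtype) ∘ₗ
    (DirectSum.decomposeLinearEquiv M.deg).toLinearMap
  have hF : ∀ n, ∀ m ∈ M.deg n, F m = f n m := by
    intro n m hm
    have h1 : DirectSum.decompose M.deg m = DirectSum.of (fun i => M.deg i) n ⟨m, hm⟩ :=
      DirectSum.decompose_of_mem _ hm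
    change DirectSum.toModule k ℤ N (fun n => f n ∘ₗ (M.deg n).subtype)
      (DirectSum.decompose M.deg m) = _
    rw [h1]
    exact DirectSum.toModule_lof k n _
  have hgx : ∀ m, F (mX M m) = mX N (F m) := by
    refine GrMod.induction_homog (by simp) (fun a b ha hb => ?_) fun n m hm => ?_
    · rw [map_add, map_add, map_add, map_add, ha, hb]
    · rw [hF _ _ (mX_mem hm), hx n m hm, hF n m hm]
  have hgy : ∀ m, F (mY M m) = mY N (F m) := by
    refine GrMod.induction_homog (by simp) (fun a b ha hb => ?_) fun n m hm => ?_
    · rw [map_add, map_add, map_add, map_add, ha, hb]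
    · obtain ⟨n, rfl⟩ : ∃ i, n = i + 1 := ⟨n - 1, by ring⟩
      rw [hF _ _ (mY_mem hm), hy n m hm, hF _ m hm]
  -- The elements whose action commutes with `F` form a subalgebra, so the two generators suffice.
  have hall : ∀ a : Weyl k, ∀ m, F (act M a m) = act N a (F m) := by
    refine induction ?_ ?_ ?_ ?_
    · intro c m
      rw [act_algebraMap, act_algebraMap, map_smul]
    · rintro (_ | _) m
      exacts [hgy m, hgx m]
    · intro a b ha hb m
      rw [act_mul, act_mul, hb, ha]
    · intro a b ha hb m
      rw [act_add, act_add, map_add, ha, hb]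
  refine ⟨⟨{ F with map_smul' := fun a m => hall a.unop m }, fun n m hm => ?_⟩, hF⟩
  have := hdeg n m hm
  rwa [← hF n m hm] at this

/-! ### Graded modules from sequences of vector spaces -/

variable (k) in
/-- A sequence of subspaces `W n` of a vector space, with maps `x n : W n → W (n + 1)` and
`y n : W (n + 1) → W n` satisfying the relation of the Weyl algebra. -/
structure Seq : Type (u + 1) where
  U : Type u
  [addCommGroup : AddCommGroup U]
  [module : Module k U]
  W : ℤ → Submodule k U
  x : ℤ → U →ₗ[k] U
  y : ℤ → U →ₗ[k] U
  x_mem : ∀ n, ∀ u ∈ W n, x n u ∈ W (n + 1)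
  y_mem : ∀ n, ∀ u ∈ W (n + 1), y n u ∈ W n
  rel : ∀ n, ∀ u ∈ W (n + 1), y (n + 1) (x (n + 1) u) = x n (y n u) + u

namespace Seq

attribute [instance] addCommGroup module

variable (S : Seq k)

/-- The direct sum of the terms of a sequence. -/
def total : Submodule k (ℤ →₀ S.U) where
  carrier := {f | ∀ n, f n ∈ S.W n}
  zero_mem' n := (S.W n).zero_mem
  add_mem' hf hg n := (S.W n).add_mem (hf n) (hg n)
  smul_mem' c _ hf n := (S.W n).smul_mem c (hf n)

/-- The maps `x n` on finitely supported functions. -/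
noncomputable def xFun : (ℤ →₀ S.U) →ₗ[k] (ℤ →₀ S.U) :=
  Finsupp.lsum k fun n => Finsupp.lsingle (n + 1) ∘ₗ S.x n

/-- The maps `y n` on finitely supported functions. -/
noncomputable def yFun : (ℤ →₀ S.U) →ₗ[k] (ℤ →₀ S.U) :=
  Finsupp.lsum k fun n => Finsupp.lsingle (n - 1) ∘ₗ S.y (n - 1)

theorem xFun_apply (f : ℤ →₀ S.U) (n : ℤ) : S.xFun f (n + 1) = S.x n (f n) := by
  induction f using Finsupp.induction_linear with
  | zero => simp
  | add f g hf hg => rw [map_add S.xFun, Finsupp.add_apply, hf, hg, Finsupp.add_apply, map_add (S.x n)]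
  | single i u =>
    by_cases h : i = n
    · subst h; simp [xFun]
    · simp [xFun, h]

theorem yFun_apply (f : ℤ →₀ S.U) (n : ℤ) : S.yFun f n = S.y n (f (n + 1)) := by
  induction f using Finsupp.induction_linear with
  | zero => simp
  | add f g hf hg => rw [map_add S.yFun, Finsupp.add_apply, hf, hg, Finsupp.add_apply, map_add (S.y n)]
  | single i u =>
    by_cases h : i = n + 1
    · subst h; simp [yFun]
    · have h' : i - 1 ≠ n := fun h' => h (by rw [← h']; ring)
      simp [yFun, h, h']

theorem xFun_mem : ∀ f ∈ S.total, S.xFun f ∈ S.total := fun f hf n => by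
  obtain ⟨n, rfl⟩ : ∃ i, n = i + 1 := ⟨n - 1, by ring⟩
  rw [xFun_apply]
  exact S.x_mem n _ (hf n)

theorem yFun_mem : ∀ f ∈ S.total, S.yFun f ∈ S.total := fun f hf n => by
  rw [yFun_apply]
  exact S.y_mem n _ (hf _)

/-- The action of the Weyl algebra on the direct sum of the terms of a sequence. -/
noncomputable def actHom : Weyl k →ₐ[k] (Module.End k S.total)ᵐᵒᵖ :=
  RingQuot.liftAlgHom k ⟨FreeAlgebra.lift k fun b =>
    op (if b then S.xFun.restrict S.xFun_mem else S.yFun.restrict S.yFun_mem), by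
    rintro _ _ ⟨⟩
    rw [map_add, map_mul, map_mul, map_one, FreeAlgebra.lift_ι_apply, FreeAlgebra.lift_ι_apply]
    apply unop_injective
    ext f n
    -- In the opposite of the endomorphism ring the product xy is "first x, then y", as it must be
    -- for a right action.
    change S.yFun (S.xFun f.1) n = (S.xFun (S.yFun f.1) + f.1) n
    obtain ⟨n, rfl⟩ : ∃ i, n = i + 1 := ⟨n - 1, by ring⟩
    rw [yFun_apply, xFun_apply, Finsupp.add_apply, xFun_apply, yFun_apply]
    exact S.rel n _ (f.2 _)⟩

theorem actHom_gen (b : Bool) : S.actHom (gen k b) =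
    op (if b then S.xFun.restrict S.xFun_mem else S.yFun.restrict S.yFun_mem) := by
  refine (RingQuot.liftAlgHom_mkAlgHom_apply k _ _ _).trans ?_
  rw [FreeAlgebra.lift_ι_apply]

/-- The terms of a sequence as subspaces of the direct sum. -/
def totalDeg (n : ℤ) : Submodule k S.total where
  carrier := {f | ∀ i, i ≠ n → f.1 i = 0}
  zero_mem' _ _ := rfl
  add_mem' {f g} hf hg i hi := by
    change f.1 i + g.1 i = 0
    rw [hf i hi, hg i hi, add_zero]
  smul_mem' c f hf i hi := by
    change c • f.1 i = 0
    rw [hf i hi, smul_zero]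

/-- An element of the direct sum concentrated in one degree. -/
noncomputable def single (n : ℤ) (u : S.U) (hu : u ∈ S.W n) : S.total :=
  ⟨Finsupp.single n u, fun i => by
    by_cases h : i = n
    · subst h; simpa using hu
    · rw [Finsupp.single_eq_of_ne h]; exact Submodule.zero_mem _⟩

/-- The ring homomorphism defining the module structure. -/
noncomputable def actRingHom : (Weyl k)ᵐᵒᵖ →+* Module.End k S.total where
  toFun a := (S.actHom a.unop).unop
  map_one' := by simp
  map_mul' a b := by simp
  map_zero' := by simp
  map_add' a b := by simp

theorem totalDeg_isInternal : DirectSum.IsInternal S.totalDeg := by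
  classical
  refine GrMod.isInternal_of_proj _ (fun n => ((Finsupp.lsingle n ∘ₗ Finsupp.lapply n :
    (ℤ →₀ S.U) →ₗ[k] (ℤ →₀ S.U)).restrict (p := S.total) (q := S.total) fun f hf =>
      (S.single n (f n) (hf n)).2)) ?_ ?_ ?_
  · intro n f hf
    ext i : 2
    change Finsupp.single n (f.1 n) i = f.1 i
    by_cases h : i = n
    · subst h; simp
    · rw [Finsupp.single_eq_of_ne h, hf i h]
  · intro n j f hf hij
    ext i : 2
    change Finsupp.single j (f.1 j) i = 0
    rw [hf j hij.symm, Finsupp.single_zero, Finsupp.zero_apply]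
  · intro f
    refine ⟨f.1.support, fun n => S.single n (f.1 n) (f.2 n), fun n i hi =>
      Finsupp.single_eq_of_ne hi, ?_⟩
    ext : 1
    rw [AddSubmonoidClass.coe_finsetSum]
    exact f.1.sum_single

/-- The graded module given by a sequence. -/
noncomputable def toGr : Gr k where
  carrier := S.total
  module := Module.compHom S.total S.actRingHom
  isScalarTower := by
    let _ : Module (Weyl k)ᵐᵒᵖ S.total := Module.compHom S.total S.actRingHom
    refine ⟨fun c a f => ?_⟩
    change (S.actHom (c • a.unop)).unop f = c • (S.actHom a.unop).unop f
    rw [map_smul]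
    rfl
  deg := S.totalDeg
  isInternal := S.totalDeg_isInternal
  smul_mem := by
    let _ : Module (Weyl k)ᵐᵒᵖ S.total := Module.compHom S.total S.actRingHom
    intro n d f a hf ha
    have hw : ∀ l : List Bool, ∀ n, ∀ f ∈ S.totalDeg n,
        (S.actHom (word k l)).unop f ∈ S.totalDeg (n + wordDeg l) := by
      intro l
      induction l with
      | nil =>
        intro n f hf
        simpa [word, wordDeg] using hf
      | cons b l ih =>
        intro n f hf
        have h1 : word k (b :: l) = gen k b * word k l := by simp [word]
        have h2 : wordDeg (b :: l) = (if b then (1 : ℤ) else -1) + wordDeg l := by simp [wordDeg]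
        rw [h1, map_mul, unop_mul, Module.End.mul_apply, h2, ← add_assoc]
        apply ih
        rw [actHom_gen]
        cases b with
        | true =>
          intro i hi
          obtain ⟨i, rfl⟩ : ∃ j, i = j + 1 := ⟨i - 1, by ring⟩
          change S.xFun f.1 (i + 1) = 0
          rw [xFun_apply, hf i (by simpa using hi), map_zero]
        | false =>
          intro i hi
          change S.yFun f.1 i = 0
          rw [yFun_apply, hf (i + 1) (fun h => hi (by rw [← h]; simp)), map_zero]
    change (S.actHom a).unop f ∈ S.totalDeg (n + d)
    refine Submodule.span_induction (p := fun a _ => (S.actHom a).unop f ∈ S.totalDeg (n + d))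
      ?_ ?_ ?_ ?_ ha
    · rintro _ ⟨l, rfl, rfl⟩
      exact hw l n f hf
    · rw [map_zero]; exact Submodule.zero_mem _
    · intro a b _ _ ha hb
      rw [map_add]; exact Submodule.add_mem _ ha hb
    · intro c a _ ha
      rw [map_smul]; exact Submodule.smul_mem _ c ha

/-- The component of degree `n`. -/
noncomputable def val (n : ℤ) : S.toGr →ₗ[k] S.U := Finsupp.lapply n ∘ₗ S.total.subtype

theorem val_mem (n : ℤ) (f : S.toGr) : S.val n f ∈ S.W n := f.2 n

variable {S} in
theorem ext_val {f g : S.toGr} (h : ∀ n, S.val n f = S.val n g) : f = g :=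
  Subtype.ext (Finsupp.ext h)

theorem val_mX (n : ℤ) (f : S.toGr) : S.val (n + 1) (mX _ f) = S.x n (S.val n f) := by
  change ((S.actHom (gen k true)).unop f).1 (n + 1) = _
  rw [actHom_gen]
  exact S.xFun_apply _ _

theorem val_mY (n : ℤ) (f : S.toGr) : S.val n (mY _ f) = S.y n (S.val (n + 1) f) := by
  change ((S.actHom (gen k false)).unop f).1 n = _
  rw [actHom_gen]
  exact S.yFun_apply _ _

theorem val_ne {n i : ℤ} {f : S.toGr} (hf : f ∈ S.toGr.deg n) (h : i ≠ n) : S.val i f = 0 := hf i h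

theorem ext_deg {n : ℤ} {f g : S.toGr} (hf : f ∈ S.toGr.deg n) (hg : g ∈ S.toGr.deg n)
    (h : S.val n f = S.val n g) : f = g :=
  ext_val fun i => by
    by_cases hi : i = n
    · subst hi; exact h
    · rw [S.val_ne hf hi, S.val_ne hg hi]

/-- An element of the graded module concentrated in one degree. -/
noncomputable def elt (n : ℤ) (u : S.U) (hu : u ∈ S.W n) : S.toGr := S.single n u hu

theorem elt_mem (n : ℤ) (u : S.U) (hu : u ∈ S.W n) : S.elt n u hu ∈ S.toGr.deg n :=
  fun _ hi => Finsupp.single_eq_of_ne hi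

@[simp] theorem val_elt (n : ℤ) (u : S.U) (hu : u ∈ S.W n) : S.val n (S.elt n u hu) = u :=
  Finsupp.single_eq_same

/-- Morphisms into the module of a sequence. -/
theorem exists_hom_toGr {M : Gr k} (f : ℤ → M →ₗ[k] S.U) (hdeg : ∀ n, ∀ m ∈ M.deg n, f n m ∈ S.W n)
    (hx : ∀ n, ∀ m ∈ M.deg n, f (n + 1) (mX M m) = S.x n (f n m))
    (hy : ∀ n, ∀ m ∈ M.deg (n + 1), f n (mY M m) = S.y n (f (n + 1) m)) :
    ∃ F : M ⟶ S.toGr, ∀ n, ∀ m ∈ M.deg n, S.val n (F.1 m) = f n m := by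
  let g : ∀ n : ℤ, M →ₗ[k] S.toGr := fun n =>
    (Finsupp.lsingle n ∘ₗ f n ∘ₗ M.proj n).codRestrict S.total fun m =>
      (S.single n (f n (M.proj n m)) (hdeg n _ (M.proj_mem n m))).2
  have hg : ∀ n, ∀ m ∈ M.deg n, S.val n (g n m) = f n m := by
    intro n m hm
    refine (Finsupp.single_eq_same).trans ?_
    exact congrArg (f n) (M.proj_same hm)
  have hgd : ∀ n, ∀ m ∈ M.deg n, g n m ∈ S.toGr.deg n := fun n m hm i hi =>
    Finsupp.single_eq_of_ne hi
  obtain ⟨F, hF⟩ := exists_hom g hgd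
    (fun n m hm => S.ext_deg (hgd _ _ (mX_mem hm)) (mX_mem (hgd _ _ hm)) (by
      rw [hg _ _ (mX_mem hm), val_mX, hg _ _ hm, hx n m hm]))
    (fun n m hm => S.ext_deg (hgd _ _ (mY_mem hm)) (mY_mem (hgd _ _ hm)) (by
      rw [hg _ _ (mY_mem hm), val_mY, hg _ _ hm, hy n m hm]))
  exact ⟨F, fun n m hm => by rw [hF n m hm, hg n m hm]⟩

end Seq

end Weyl

/-! ### Moving `z` past powers of `x` and `y`; modules on which `z` acts by scalars -/

namespace Weyl

open MulOpposite

variable {k : Type u} [Field k]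

/-- Right multiplications compose in the order opposite to products, so `mY ∘ mX` is the action of z
= xy. The identity is z x^d = x^d (z − d): each passage past an x lowers z by one. -/
theorem mX_pow_z (M : Gr k) (d : ℕ) (m : M) :
    (mX M ^ d) (mY M (mX M m)) = mY M (mX M ((mX M ^ d) m)) - (d : k) • (mX M ^ d) m := by
  induction d generalizing m with
  | zero => simp
  | succ d ih =>
    have h : mX M (mY M (mX M m)) = mY M (mX M (mX M m)) - mX M m := by
      rw [mY_mX M (mX M m), add_sub_cancel_right]
    rw [pow_succ, Module.End.mul_apply, h, map_sub, ih, Module.End.mul_apply]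
    push_cast
    module

theorem mY_pow_z (M : Gr k) (d : ℕ) (m : M) :
    (mY M ^ d) (mY M (mX M m)) = mY M (mX M ((mY M ^ d) m)) + (d : k) • (mY M ^ d) m := by
  induction d generalizing m with
  | zero => simp
  | succ d ih =>
    have h : mY M (mY M (mX M m)) = mY M (mX M (mY M m)) + mY M m := by
      rw [← map_add, ← mY_mX]
    rw [pow_succ, Module.End.mul_apply, h, map_add, ih, Module.End.mul_apply]
    push_cast
    module

/-- `z` acts on the component of degree `n` by the scalar `n + c`. -/
def ScalarZ (M : Gr k) (c : k) : Prop := ∀ n, ∀ m ∈ M.deg n, mY M (mX M m) = ((n : k) + c) • m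

namespace ScalarZ

variable {M : Gr k} {c : k} (h : ScalarZ M c)

include h

theorem mX_mY {n : ℤ} {m : M} (hm : m ∈ M.deg n) : mX M (mY M m) = ((n : k) - 1 + c) • m := by
  rw [← add_right_cancel_iff (a := m), ← mY_mX, h n m hm]
  module

theorem eq_zero_of_mX {n : ℤ} {m : M} (hm : m ∈ M.deg n) (hc : (n : k) + c ≠ 0)
    (h0 : mX M m = 0) : m = 0 := by
  have := h n m hm
  rw [h0, map_zero] at this
  exact (smul_eq_zero.1 this.symm).resolve_left hc

theorem eq_zero_of_mY {n : ℤ} {m : M} (hm : m ∈ M.deg n) (hc : (n : k) - 1 + c ≠ 0)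
    (h0 : mY M m = 0) : m = 0 := by
  have := h.mX_mY hm
  rw [h0, map_zero] at this
  exact (smul_eq_zero.1 this.symm).resolve_left hc

theorem act_aeval (p : Polynomial k) {n : ℤ} {m : M} (hm : m ∈ M.deg n) :
    act M (Polynomial.aeval (z k) p) m = p.eval ((n : k) + c) • m := by
  induction p using Polynomial.induction_on' with
  | add p q hp hq => rw [map_add, act_add, hp, hq, Polynomial.eval_add, add_smul]
  | monomial d a =>
    rw [Polynomial.aeval_monomial, act_mul, act_algebraMap, Polynomial.eval_monomial]
    induction d with
    | zero => rw [pow_zero, act_one, pow_zero, mul_one]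
    | succ d ih =>
      rw [pow_succ, act_mul, ih, map_smul, act_z, h n m hm, smul_smul, pow_succ, mul_assoc]

end ScalarZ

/-! ### Models of the simple modules -/

variable (k) in
/-- The sequence of the simple module with nonzero components in degrees at most `j`. -/
abbrev xSeq (j : ℤ) : Seq k where
  U := k
  W n := if n ≤ j then ⊤ else ⊥
  x n := if n = j then 0 else LinearMap.id
  -- With x normalised to the identity below the top degree there is no freedom left for y: z
  -- vanishes in the top degree j, and the relation makes it grow by one from each degree to the
  -- next.
  y n := ((n : k) - j) • LinearMap.id
  x_mem n u hu := by
    by_cases h : n = j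
    · simp [h]
    · by_cases h' : n ≤ j
      · rw [if_pos (by omega)]; trivial
      · rw [if_neg h', Submodule.mem_bot] at hu
        rw [hu, map_zero]; exact Submodule.zero_mem _
  y_mem n u hu := by
    by_cases h' : n + 1 ≤ j
    · rw [if_pos (by omega)]; trivial
    · rw [if_neg h', Submodule.mem_bot] at hu
      rw [hu, map_zero]; exact Submodule.zero_mem _
  rel n u hu := by
    by_cases h' : n + 1 ≤ j
    · rw [if_neg (show n ≠ j by omega)]
      by_cases h : n + 1 = j
      · subst h; simp
      · rw [if_neg h]; simp; ring
    · rw [if_neg h', Submodule.mem_bot] at hu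
      simp [hu]

variable (k) in
/-- The sequence of the simple module with nonzero components in degrees greater than `j`. -/
abbrev ySeq (j : ℤ) : Seq k where
  U := k
  W n := if j < n then ⊤ else ⊥
  x n := ((n : k) - j) • LinearMap.id
  y n := if n = j then 0 else LinearMap.id
  y_mem n u hu := by
    by_cases h : n = j
    · simp [h]
    · by_cases h' : j < n + 1
      · rw [if_pos (by omega)]; trivial
      · rw [if_neg h', Submodule.mem_bot] at hu
        rw [hu, map_zero]; exact Submodule.zero_mem _
  x_mem n u hu := by
    by_cases h' : j < n
    · rw [if_pos (by omega)]; trivial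
    · rw [if_neg h', Submodule.mem_bot] at hu
      rw [hu, map_zero]; exact Submodule.zero_mem _
  rel n u hu := by
    by_cases h' : j < n + 1
    · rw [if_neg (show n + 1 ≠ j by omega)]
      by_cases h : n = j
      · subst h; simp
      · rw [if_neg h]; simp; ring
    · rw [if_neg h', Submodule.mem_bot] at hu
      simp [hu]

variable (k) in
/-- The model of `X⟨j⟩`. -/
noncomputable abbrev xMod (j : ℤ) : Gr k := (xSeq k j).toGr

variable (k) in
/-- The model of `Y⟨j⟩`. -/
noncomputable abbrev yMod (j : ℤ) : Gr k := (ySeq k j).toGr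

theorem xSeq_W {j n : ℤ} (h : n ≤ j) (u : k) : u ∈ (xSeq k j).W n := by
  change u ∈ (if n ≤ j then ⊤ else ⊥ : Submodule k k)
  rw [if_pos h]; trivial

theorem ySeq_W {j n : ℤ} (h : j < n) (u : k) : u ∈ (ySeq k j).W n := by
  change u ∈ (if j < n then ⊤ else ⊥ : Submodule k k)
  rw [if_pos h]; trivial

theorem xMod_eq_zero {j n : ℤ} (h : j < n) {m : xMod k j} (hm : m ∈ (xMod k j).deg n) : m = 0 := by
  refine Seq.ext_deg _ hm (Submodule.zero_mem _) ?_
  have : (xSeq k j).val n m ∈ (if n ≤ j then ⊤ else ⊥ : Submodule k k) := Seq.val_mem _ n m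
  rw [if_neg (by omega), Submodule.mem_bot] at this
  rw [map_zero]; exact this

theorem yMod_eq_zero {j n : ℤ} (h : n ≤ j) {m : yMod k j} (hm : m ∈ (yMod k j).deg n) : m = 0 := by
  refine Seq.ext_deg _ hm (Submodule.zero_mem _) ?_
  have : (ySeq k j).val n m ∈ (if j < n then ⊤ else ⊥ : Submodule k k) := Seq.val_mem _ n m
  rw [if_neg (by omega), Submodule.mem_bot] at this
  rw [map_zero]; exact this

theorem xMod_scalarZ (j : ℤ) : ScalarZ (xMod k j) (-(j : k)) := by
  intro n m hm
  by_cases h : j < n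
  · rw [xMod_eq_zero h hm]; simp
  refine Seq.ext_deg _ (mY_mem (mX_mem hm)) (Submodule.smul_mem _ _ hm) ?_
  rw [Seq.val_mY, Seq.val_mX, map_smul]
  change ((n : k) - j) • (if n = j then (0 : k →ₗ[k] k) else LinearMap.id) _ = _
  by_cases h' : n = j
  · rw [if_pos h', h', add_neg_cancel, zero_smul, sub_self, zero_smul]
  · rw [if_neg h', sub_eq_add_neg]; rfl

theorem yMod_scalarZ (j : ℤ) : ScalarZ (yMod k j) (-(j : k)) := by
  intro n m hm
  by_cases h : n ≤ j
  · rw [yMod_eq_zero h hm]; simp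
  refine Seq.ext_deg _ (mY_mem (mX_mem hm)) (Submodule.smul_mem _ _ hm) ?_
  rw [Seq.val_mY, Seq.val_mX, map_smul]
  change (if n = j then (0 : k →ₗ[k] k) else LinearMap.id) (((n : k) - j) • (ySeq k j).val n m) = _
  rw [if_neg (by omega), sub_eq_add_neg]; rfl

/-- Morphisms to the model of `X⟨j⟩`. -/
theorem exists_hom_xMod {M : Gr k} (j : ℤ) (φ : M →ₗ[k] k)
    (hφ : ∀ m ∈ M.deg (j + 1), φ (mY M m) = 0) :
    ∃ F : M ⟶ xMod k j, ∀ d : ℕ, ∀ m ∈ M.deg (j - d),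
      (xSeq k j).val (j - d) (F.1 m) = φ ((mX M ^ d) m) := by
  -- In the model x is the identity up to the top degree j, so compatibility with x forces the value
  -- at m of degree n ≤ j to be that of φ at m x^{j-n}.
  let f : ℤ → M →ₗ[k] (xSeq k j).U := fun n =>
    if n ≤ j then φ ∘ₗ (mX M ^ (j - n).toNat) else 0
  have f1 : ∀ (d : ℕ) m, f (j - d) m = φ ((mX M ^ d) m) := fun d m => by
    simp only [f]
    rw [if_pos (by omega), show (j - (j - (d : ℤ))).toNat = d by omega]; rfl
  have f2 : ∀ n, j < n → f n = 0 := fun n hn => by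
    simp only [f]; rw [if_neg (by omega)]
  suffices h : ∃ F : M ⟶ xMod k j, ∀ n, ∀ m ∈ M.deg n, (xSeq k j).val n (F.1 m) = f n m by
    obtain ⟨F, hF⟩ := h
    exact ⟨F, fun d m hm => by rw [hF _ m hm, f1]⟩
  refine (xSeq k j).exists_hom_toGr f ?_ ?_ ?_
  · intro n m hm
    by_cases h : n ≤ j
    · exact xSeq_W h _
    · rw [f2 n (by omega)]; exact Submodule.zero_mem _
  · intro n m hm
    change _ = (if n = j then (0 : k →ₗ[k] k) else LinearMap.id) (f n m)
    by_cases h : n < j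
    · obtain ⟨d, rfl⟩ : ∃ d : ℕ, n = j - (d + 1 : ℕ) := ⟨(j - n - 1).toNat, by omega⟩
      rw [if_neg (by omega), show j - ((d + 1 : ℕ) : ℤ) + 1 = j - d by push_cast; ring, f1, f1,
        pow_succ]; rfl
    · rw [f2 (n + 1) (by omega)]
      by_cases h' : n = j
      · rw [if_pos h']; rfl
      · rw [f2 n (by omega)]; simp
  · intro n m hm
    change _ = ((n : k) - j) • (f (n + 1) m)
    by_cases h : n < j
    · obtain ⟨d, rfl⟩ : ∃ d : ℕ, n = j - (d + 1 : ℕ) := ⟨(j - n - 1).toNat, by omega⟩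
      have hn : j - ((d + 1 : ℕ) : ℤ) + 1 = j - d := by push_cast; ring
      rw [hn] at hm ⊢
      have h1 : mX M (mY M m) = mY M (mX M m) - m := by rw [mY_mX, add_sub_cancel_right]
      -- The element m x^{d+1} has degree j+1, so the condition on φ applies to its product with y.
      have h2 : φ (mY M (mX M ((mX M ^ d) m))) = 0 := by
        refine hφ _ (mX_mem ?_)
        have := mX_pow_mem hm d
        rwa [sub_add_cancel] at this
      rw [f1, f1, pow_succ, Module.End.mul_apply, h1, map_sub, mX_pow_z, map_sub, map_sub, h2,
        map_smul]
      push_cast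
      simp only [smul_eq_mul]
      ring
    · rw [f2 (n + 1) (by omega)]
      by_cases h' : n = j
      · subst h'
        have := f1 0 (mY M m)
        rw [Nat.cast_zero, sub_zero] at this
        rw [this, pow_zero, Module.End.one_apply, hφ m hm]; simp
      · rw [f2 n (by omega)]; simp

/-- Morphisms to the model of `Y⟨j⟩`. -/
theorem exists_hom_yMod {M : Gr k} (j : ℤ) (φ : M →ₗ[k] k)
    (hφ : ∀ m ∈ M.deg j, φ (mX M m) = 0) :
    ∃ F : M ⟶ yMod k j, ∀ d : ℕ, ∀ m ∈ M.deg (j + 1 + d),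
      (ySeq k j).val (j + 1 + d) (F.1 m) = φ ((mY M ^ d) m) := by
  let f : ℤ → M →ₗ[k] (ySeq k j).U := fun n =>
    if j < n then φ ∘ₗ (mY M ^ (n - j - 1).toNat) else 0
  have f1 : ∀ (d : ℕ) m, f (j + 1 + d) m = φ ((mY M ^ d) m) := fun d m => by
    simp only [f]
    rw [if_pos (by omega), show (j + 1 + (d : ℤ) - j - 1).toNat = d by omega]; rfl
  have f2 : ∀ n, n ≤ j → f n = 0 := fun n hn => by
    simp only [f]; rw [if_neg (by omega)]
  suffices h : ∃ F : M ⟶ yMod k j, ∀ n, ∀ m ∈ M.deg n, (ySeq k j).val n (F.1 m) = f n m by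
    obtain ⟨F, hF⟩ := h
    exact ⟨F, fun d m hm => by rw [hF _ m hm, f1]⟩
  refine (ySeq k j).exists_hom_toGr f ?_ ?_ ?_
  · intro n m hm
    by_cases h : j < n
    · exact ySeq_W h _
    · rw [f2 n (by omega)]; exact Submodule.zero_mem _
  · intro n m hm
    change _ = ((n : k) - j) • (f n m)
    by_cases h : j < n
    · obtain ⟨d, rfl⟩ : ∃ d : ℕ, n = j + 1 + d := ⟨(n - j - 1).toNat, by omega⟩
      have h2 : φ (mY M (mX M ((mY M ^ d) m))) = φ ((mY M ^ d) m) := by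
        have h3 := mY_pow_mem hm d
        rw [add_sub_cancel_right] at h3
        rw [mY_mX, map_add, hφ _ (mY_mem h3), zero_add]
      rw [show j + 1 + (d : ℤ) + 1 = j + 1 + (d + 1 : ℕ) by push_cast; ring, f1, f1, pow_succ,
        Module.End.mul_apply, mY_pow_z, map_add, h2, map_smul]
      push_cast
      simp only [smul_eq_mul]
      ring
    · rw [f2 n (by omega)]
      by_cases h' : n = j
      · subst h'
        have := f1 0 (mX M m)
        rw [Nat.cast_zero, add_zero] at this
        rw [this, pow_zero, Module.End.one_apply, hφ m hm]; simp
      · rw [f2 (n + 1) (by omega)]; simp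
  · intro n m hm
    change _ = (if n = j then (0 : k →ₗ[k] k) else LinearMap.id) (f (n + 1) m)
    by_cases h : j < n
    · obtain ⟨d, rfl⟩ : ∃ d : ℕ, n = j + 1 + d := ⟨(n - j - 1).toNat, by omega⟩
      rw [if_neg (by omega), show j + 1 + (d : ℤ) + 1 = j + 1 + (d + 1 : ℕ) by push_cast; ring, f1,
        f1, pow_succ]; rfl
    · rw [f2 n (by omega)]
      by_cases h' : n = j
      · rw [if_pos h']; rfl
      · rw [f2 (n + 1) (by omega)]; simp

theorem hom_xMod_mY {M : Gr k} {j : ℤ} (F : M ⟶ xMod k j) {m : M} (hm : m ∈ M.deg (j + 1)) :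
    F.1 (mY M m) = 0 := by
  rw [hom_mY, xMod_eq_zero (lt_add_one j) (F.2 _ _ hm), map_zero]

theorem hom_yMod_mX {M : Gr k} {j : ℤ} (F : M ⟶ yMod k j) {m : M} (hm : m ∈ M.deg j) :
    F.1 (mX M m) = 0 := by
  rw [hom_mX, yMod_eq_zero le_rfl (F.2 _ _ hm), map_zero]

section CharZero

variable [CharZero k]

theorem cast_sub_ne {n j : ℤ} (h : n ≠ j) : (n : k) + -(j : k) ≠ 0 := by
  rw [← sub_eq_add_neg, sub_ne_zero]
  exact_mod_cast h

theorem cast_sub_ne' {n j : ℤ} (h : n ≠ j + 1) : (n : k) - 1 + -(j : k) ≠ 0 := by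
  have := cast_sub_ne (k := k) h
  push_cast at this
  intro h'
  exact this (by rw [← h']; ring)

variable {N : Gr k} {j : ℤ} (hz : ScalarZ N (-(j : k)))

include hz

/-- Away from the gap between j and j+1 the scalars of xy and yx are nonzero integers. So a power of
x or y that does not cross the gap kills nothing; this and the next three lemmas treat the four
directions: below the gap towards it, above it towards it, and away from it on either side. -/
theorem ScalarZ.mX_pow_ne_zero (d : ℕ) {m : N} (hm : m ∈ N.deg (j - d)) (h0 : (mX N ^ d) m = 0) :
    m = 0 := by
  induction d generalizing m with
  | zero => simpa using h0
  | succ d ih =>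
    rw [pow_succ, Module.End.mul_apply] at h0
    have h1 : mX N m ∈ N.deg (j - d) := by
      have := mX_mem hm
      rwa [show j - ((d + 1 : ℕ) : ℤ) + 1 = j - d by push_cast; ring] at this
    exact hz.eq_zero_of_mX hm (cast_sub_ne (by omega)) (ih h1 h0)

theorem ScalarZ.mY_pow_ne_zero (d : ℕ) {m : N} (hm : m ∈ N.deg (j + 1 + d))
    (h0 : (mY N ^ d) m = 0) : m = 0 := by
  induction d generalizing m with
  | zero => simpa using h0
  | succ d ih =>
    rw [pow_succ, Module.End.mul_apply] at h0
    have h1 : mY N m ∈ N.deg (j + 1 + d) := by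
      have := mY_mem' hm
      rwa [show j + 1 + ((d + 1 : ℕ) : ℤ) - 1 = j + 1 + d by push_cast; ring] at this
    exact hz.eq_zero_of_mY hm (cast_sub_ne' (by omega)) (ih h1 h0)

theorem ScalarZ.mY_pow_ne_zero' (d : ℕ) {m : N} (hm : m ∈ N.deg j) (h0 : (mY N ^ d) m = 0) :
    m = 0 := by
  induction d with
  | zero => simpa using h0
  | succ d ih =>
    rw [pow_succ', Module.End.mul_apply] at h0
    exact ih (hz.eq_zero_of_mY (mY_pow_mem hm d) (cast_sub_ne' (by omega)) h0)

theorem ScalarZ.mX_pow_ne_zero' (d : ℕ) {m : N} (hm : m ∈ N.deg (j + 1)) (h0 : (mX N ^ d) m = 0) :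
    m = 0 := by
  induction d with
  | zero => simpa using h0
  | succ d ih =>
    rw [pow_succ', Module.End.mul_apply] at h0
    exact ih (hz.eq_zero_of_mX (mX_pow_mem hm d) (cast_sub_ne (by omega)) h0)

/-- A functional that does not vanish on `v` gives a morphism to the model. Every homogeneous
element can be moved without loss to degree j or j+1, which gives injectivity; the components of the
model are at most lines, and multiples of v y^d fill them. -/
theorem nonempty_iso_xMod (h1 : ∀ m ∈ N.deg (j + 1), m = 0) {v : N} (hv : v ∈ N.deg j) (hv0 : v ≠ 0)
    (hspan : ∀ m ∈ N.deg j, ∃ c : k, m = c • v) : Nonempty (N ≅ xMod k j) := by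
  obtain ⟨φ, hφ, -⟩ := Submodule.exists_le_ker_of_notMem (p := (⊥ : Submodule k N)) (v := v)
    (by simpa using hv0)
  obtain ⟨F, hF⟩ := exists_hom_xMod j φ fun m hm => by rw [h1 m hm, map_zero, map_zero]
  have hinj : ∀ n, ∀ m ∈ N.deg n, F.1 m = 0 → m = 0 := by
    intro n m hm h0
    by_cases h : n ≤ j
    · obtain ⟨d, rfl⟩ : ∃ d : ℕ, n = j - d := ⟨(j - n).toNat, by omega⟩
      have hd := hF d m hm
      have hm' := mX_pow_mem hm d
      rw [sub_add_cancel] at hm'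
      obtain ⟨c, hc⟩ := hspan _ hm'
      rw [h0, map_zero, hc, map_smul, smul_eq_mul, eq_comm, mul_eq_zero, or_iff_left hφ] at hd
      rw [hd, zero_smul] at hc
      exact hz.mX_pow_ne_zero d hm hc
    · obtain ⟨d, rfl⟩ : ∃ d : ℕ, n = j + 1 + d := ⟨(n - j - 1).toNat, by omega⟩
      refine hz.mY_pow_ne_zero d hm (h1 _ ?_)
      have := mY_pow_mem hm d
      rwa [add_sub_cancel_right] at this
  refine ⟨GrMod.isoOfBijective F (GrMod.injective_of_homog F hinj)
    (GrMod.surjective_of_homog F fun n m hm => ?_)⟩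
  by_cases h : n ≤ j
  · obtain ⟨d, rfl⟩ : ∃ d : ℕ, n = j - d := ⟨(j - n).toNat, by omega⟩
    have hw := mY_pow_mem hv d
    have hw0 : F.1 ((mY N ^ d) v) ≠ 0 := fun h0 => hv0 (hz.mY_pow_ne_zero' d hv (hinj _ _ hw h0))
    have hw1 : (xSeq k j).val (j - d) (F.1 ((mY N ^ d) v)) ≠ 0 := fun h0 => hw0
      (Seq.ext_deg _ (F.2 _ _ hw) (Submodule.zero_mem _) (by rw [h0, map_zero]))
    refine ⟨((xSeq k j).val (j - d) m / (xSeq k j).val (j - d) (F.1 ((mY N ^ d) v))) •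
      (mY N ^ d) v, ?_⟩
    rw [GrMod.hom_smul]
    refine Seq.ext_deg _ (Submodule.smul_mem _ _ (F.2 _ _ hw)) hm ?_
    rw [map_smul, smul_eq_mul, div_mul_cancel₀ _ hw1]
  · exact ⟨0, by rw [map_zero, xMod_eq_zero (by omega) hm]⟩

theorem nonempty_iso_yMod (h1 : ∀ m ∈ N.deg j, m = 0) {v : N} (hv : v ∈ N.deg (j + 1)) (hv0 : v ≠ 0)
    (hspan : ∀ m ∈ N.deg (j + 1), ∃ c : k, m = c • v) : Nonempty (N ≅ yMod k j) := by
  obtain ⟨φ, hφ, -⟩ := Submodule.exists_le_ker_of_notMem (p := (⊥ : Submodule k N)) (v := v)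
    (by simpa using hv0)
  obtain ⟨F, hF⟩ := exists_hom_yMod j φ fun m hm => by rw [h1 m hm, map_zero, map_zero]
  have hinj : ∀ n, ∀ m ∈ N.deg n, F.1 m = 0 → m = 0 := by
    intro n m hm h0
    by_cases h : j < n
    · obtain ⟨d, rfl⟩ : ∃ d : ℕ, n = j + 1 + d := ⟨(n - j - 1).toNat, by omega⟩
      have hd := hF d m hm
      have hm' := mY_pow_mem hm d
      rw [add_sub_cancel_right] at hm'
      obtain ⟨c, hc⟩ := hspan _ hm'
      rw [h0, map_zero, hc, map_smul, smul_eq_mul, eq_comm, mul_eq_zero, or_iff_left hφ] at hd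
      rw [hd, zero_smul] at hc
      exact hz.mY_pow_ne_zero d hm hc
    · obtain ⟨d, rfl⟩ : ∃ d : ℕ, n = j - d := ⟨(j - n).toNat, by omega⟩
      refine hz.mX_pow_ne_zero d hm (h1 _ ?_)
      have := mX_pow_mem hm d
      rwa [sub_add_cancel] at this
  refine ⟨GrMod.isoOfBijective F (GrMod.injective_of_homog F hinj)
    (GrMod.surjective_of_homog F fun n m hm => ?_)⟩
  by_cases h : j < n
  · obtain ⟨d, rfl⟩ : ∃ d : ℕ, n = j + 1 + d := ⟨(n - j - 1).toNat, by omega⟩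
    have hw := mX_pow_mem hv d
    have hw0 : F.1 ((mX N ^ d) v) ≠ 0 := fun h0 => hv0 (hz.mX_pow_ne_zero' d hv (hinj _ _ hw h0))
    have hw1 : (ySeq k j).val (j + 1 + d) (F.1 ((mX N ^ d) v)) ≠ 0 := fun h0 => hw0
      (Seq.ext_deg _ (F.2 _ _ hw) (Submodule.zero_mem _) (by rw [h0, map_zero]))
    refine ⟨((ySeq k j).val (j + 1 + d) m / (ySeq k j).val (j + 1 + d) (F.1 ((mX N ^ d) v))) •
      (mX N ^ d) v, ?_⟩
    rw [GrMod.hom_smul]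
    refine Seq.ext_deg _ (Submodule.smul_mem _ _ (F.2 _ _ hw)) hm ?_
    rw [map_smul, smul_eq_mul, div_mul_cancel₀ _ hw1]
  · exact ⟨0, by rw [map_zero, yMod_eq_zero (by omega) hm]⟩

end CharZero

/-! ### The structure of the Weyl algebra -/

variable (k) in
/-- The generator of the component of degree `d` over `k[z]`. -/
def homogGen : ℤ → Weyl k
  | .ofNat e => x k ^ e
  | .negSucc e => y k ^ (e + 1)

variable (k) in
theorem x_pow_mem (e : ℕ) : x k ^ e ∈ grading k e := by
  have := SetLike.pow_mem_graded (A := grading k) e (gen_mem k true)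
  simpa using this

variable (k) in
theorem y_pow_mem (e : ℕ) : y k ^ e ∈ grading k (-e) := by
  have := SetLike.pow_mem_graded (A := grading k) e (gen_mem k false)
  simpa using this

theorem y_mul_x : y k * x k = z k - 1 := by
  rw [show z k = x k * y k from rfl, rel, add_sub_cancel_right]

theorem z_mul_x_pow (e : ℕ) : z k * x k ^ e = x k ^ e * (z k - algebraMap k _ (e : k)) := by
  have h : z k * x k = x k * (z k - 1) := by rw [mul_assoc, y_mul_x]
  induction e with
  | zero => simp
  | succ e ih =>
    rw [pow_succ, ← mul_assoc, ih, mul_assoc, sub_mul, h, mul_assoc, Algebra.commutes]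
    push_cast
    noncomm_ring

theorem z_mul_y_pow (e : ℕ) : z k * y k ^ e = y k ^ e * (z k + algebraMap k _ (e : k)) := by
  have h : z k * y k = y k * (z k + 1) := by
    have : y k * z k = (z k - 1) * y k := by rw [← y_mul_x]; noncomm_ring
    rw [mul_add, this]
    noncomm_ring
  induction e with
  | zero => simp
  | succ e ih =>
    rw [pow_succ, ← mul_assoc, ih, mul_assoc, add_mul, h, mul_assoc, Algebra.commutes]
    push_cast
    noncomm_ring

theorem homogGen_natCast (e : ℕ) : homogGen k e = x k ^ e := rfl

theorem homogGen_neg (e : ℕ) : homogGen k (-e) = y k ^ e := by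
  cases e with
  | zero => exact (pow_zero (x k)).trans (pow_zero (y k)).symm
  | succ e => rfl

theorem homogGen_mem (d : ℤ) : homogGen k d ∈ grading k d := by
  obtain ⟨e, rfl | rfl⟩ := d.eq_nat_or_neg
  · exact x_pow_mem k e
  · rw [homogGen_neg]; exact y_pow_mem k e

theorem homogGen_mul_z (d : ℤ) :
    homogGen k d * z k = (z k + algebraMap k _ (d : k)) * homogGen k d := by
  obtain ⟨e, rfl | rfl⟩ := d.eq_nat_or_neg
  · rw [homogGen_natCast, add_mul, z_mul_x_pow, mul_sub, Algebra.commutes]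
    simp
  · rw [homogGen_neg, add_mul, z_mul_y_pow, mul_add, Algebra.commutes]
    simp

/-- A new letter either lengthens the power or cancels against it, and a cancellation leaves a
linear polynomial in z: x y^{e+1} = z y^e and y x^{e+1} = (z − 1) x^e. -/
theorem gen_mul_homogGen (b : Bool) (d : ℤ) : ∃ p : Polynomial k,
    gen k b * homogGen k d = homogGen k ((if b then 1 else -1) + d) * Polynomial.aeval (z k) p := by
  cases b with
  | true =>
    simp only [if_true]
    cases d with
    | ofNat e =>
      refine ⟨1, ?_⟩
      rw [map_one, mul_one, add_comm]
      exact (pow_succ' (x k) e).symm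
    | negSucc e =>
      refine ⟨Polynomial.X + Polynomial.C (e : k), ?_⟩
      rw [show (1 : ℤ) + Int.negSucc e = -(e : ℤ) by omega, homogGen_neg, map_add,
        Polynomial.aeval_X, Polynomial.aeval_C, ← z_mul_y_pow]
      change x k * y k ^ (e + 1) = _
      rw [pow_succ', mul_assoc]
  | false =>
    simp only [Bool.false_eq_true, if_false]
    obtain ⟨e, rfl | rfl⟩ := d.eq_nat_or_neg
    · cases e with
      | zero => exact ⟨1, by
        rw [map_one, mul_one, homogGen_natCast, pow_zero, mul_one]
        exact (pow_one (y k)).symm⟩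
      | succ e =>
        refine ⟨Polynomial.X - Polynomial.C ((e : k) + 1), ?_⟩
        rw [show (-1 : ℤ) + ((e + 1 : ℕ) : ℤ) = (e : ℤ) by push_cast; ring, homogGen_natCast,
          homogGen_natCast, map_sub, Polynomial.aeval_X, Polynomial.aeval_C, pow_succ', ← mul_assoc,
          y_mul_x, sub_mul, z_mul_x_pow, map_add, map_one]
        noncomm_ring
    · refine ⟨1, ?_⟩
      rw [map_one, mul_one, homogGen_neg, show (-1 : ℤ) + -(e : ℤ) = -((e + 1 : ℕ) : ℤ) by
        push_cast; ring, homogGen_neg, pow_succ']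

/-- The component of degree `d` is generated by one element over `k[z]`. -/
theorem exists_eq_homogGen_mul {d : ℤ} {a : Weyl k} (ha : a ∈ grading k d) :
    ∃ p : Polynomial k, a = homogGen k d * Polynomial.aeval (z k) p := by
  refine Submodule.span_induction (p := fun a _ => ∃ p : Polynomial k,
    a = homogGen k d * Polynomial.aeval (z k) p) ?_ ⟨0, by simp⟩ ?_ ?_ ha
  · rintro _ ⟨l, rfl, rfl⟩
    clear ha
    induction l with
    | nil => exact ⟨1, by simp [word, wordDeg, homogGen]⟩
    | cons b l ih =>
      obtain ⟨p, hp⟩ := ih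
      obtain ⟨q, hq⟩ := gen_mul_homogGen (k := k) b (wordDeg l)
      refine ⟨q * p, ?_⟩
      rw [show wordDeg (b :: l) = (if b then (1 : ℤ) else -1) + wordDeg l by simp [wordDeg],
        show word k (b :: l) = gen k b * word k l by simp [word], hp, ← mul_assoc, hq, map_mul,
        mul_assoc]
  · rintro _ _ _ _ ⟨p, rfl⟩ ⟨q, rfl⟩
    exact ⟨p + q, by rw [map_add, mul_add]⟩
  · rintro c _ _ ⟨p, rfl⟩
    exact ⟨Polynomial.C c * p, by
      rw [map_mul, Polynomial.aeval_C, ← mul_assoc, ← Algebra.commutes, mul_assoc,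
        Algebra.smul_def]⟩

theorem commute_z_aeval (p : Polynomial k) : Commute (z k) (Polynomial.aeval (z k) p) := by
  have := (Polynomial.commute_X p).map (Polynomial.aeval (z k) : Polynomial k →ₐ[k] Weyl k)
  rwa [Polynomial.aeval_X] at this

theorem mul_z_of_mem {d : ℤ} {a : Weyl k} (ha : a ∈ grading k d) :
    a * z k = (z k + algebraMap k _ (d : k)) * a := by
  obtain ⟨p, rfl⟩ := exists_eq_homogGen_mul ha
  rw [mul_assoc, ← (commute_z_aeval p).eq, ← mul_assoc, homogGen_mul_z, mul_assoc]

theorem act_homogGen_natCast (M : Gr k) (e : ℕ) (m : M) :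
    act M (homogGen k e) m = (mX M ^ e) m := by
  rw [homogGen_natCast]
  induction e with
  | zero => rw [pow_zero, act_one]; rfl
  | succ e ih => rw [pow_succ, act_mul, ih, pow_succ', Module.End.mul_apply]; rfl

theorem act_homogGen_neg (M : Gr k) (e : ℕ) (m : M) :
    act M (homogGen k (-e)) m = (mY M ^ e) m := by
  rw [homogGen_neg]
  induction e with
  | zero => rw [pow_zero, act_one]; rfl
  | succ e ih => rw [pow_succ, act_mul, ih, pow_succ', Module.End.mul_apply]; rfl

section CharZero

variable [CharZero k]

theorem act_homogGen_ne_zero {N : Gr k} {j : ℤ} (hz : ScalarZ N (-(j : k))) {n d : ℤ} (hn : n ≤ j)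
    (hd : n + d ≤ j) {m : N} (hm : m ∈ N.deg n) (h0 : act N (homogGen k d) m = 0) : m = 0 := by
  obtain ⟨e, rfl | rfl⟩ := d.eq_nat_or_neg
  · rw [act_homogGen_natCast] at h0
    induction e with
    | zero => simpa using h0
    | succ e ih =>
      rw [pow_succ', Module.End.mul_apply] at h0
      push_cast at hd
      exact ih (by omega) (hz.eq_zero_of_mX (mX_pow_mem hm e) (cast_sub_ne (by omega)) h0)
  · rw [act_homogGen_neg] at h0
    induction e with
    | zero => simpa using h0
    | succ e ih =>
      rw [pow_succ', Module.End.mul_apply] at h0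
      push_cast at hd
      exact ih (by omega) (hz.eq_zero_of_mY (mY_pow_mem hm e) (cast_sub_ne' (by omega)) h0)

/-- The components of the Weyl algebra are free over `k[z]`. -/
theorem eq_zero_of_homogGen_mul {d : ℤ} {p : Polynomial k}
    (h : homogGen k d * Polynomial.aeval (z k) p = 0) : p = 0 := by
  refine Polynomial.eq_zero_of_infinite_isRoot p ?_
  have hinj : Function.Injective fun i : ℕ => (d : k) + -(((d.natAbs + i : ℤ) : k)) :=
    fun a b hab => by simpa using hab
  refine (Set.infinite_range_of_injective hinj).mono ?_
  rintro _ ⟨i, rfl⟩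
  -- Test on the degree 0 vector v of X⟨j⟩: since 0 ≤ j and d ≤ j, the generator of degree d carries
  -- v to a nonzero vector, on which p(z) acts by p(d − j). Letting j grow produces infinitely many
  -- roots.
  have key : ∀ j : ℤ, 0 ≤ j → d ≤ j → p.eval ((d : k) + -(j : k)) = 0 := by
    intro j h0 hj
    have hz := xMod_scalarZ (k := k) j
    have hv := (xSeq k j).elt_mem 0 1 (xSeq_W h0 _)
    set v : xMod k j := (xSeq k j).elt 0 1 (xSeq_W h0 _) with hvdef
    have hv0 : v ≠ 0 := fun hv0 => by
      have := (xSeq k j).val_elt 0 1 (xSeq_W h0 _)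
      rw [← hvdef, hv0, map_zero] at this
      exact zero_ne_one this
    have h1 := congrArg (fun a => act (xMod k j) a v) h
    simp only [act_mul] at h1
    have h2 := act_mem hv (homogGen_mem (k := k) d)
    rw [zero_add] at h2
    rw [hz.act_aeval p h2, act_apply _ 0, MulOpposite.op_zero, zero_smul, smul_eq_zero] at h1
    exact h1.resolve_right fun h3 => hv0 (act_homogGen_ne_zero hz h0 (by omega) hv h3)
  exact key _ (by omega) (by omega)

end CharZero

end Weyl

/-! ### Cyclic presentations, and the identification of `X⟨j⟩` and `Y⟨j⟩` with the models -/

namespace Weyl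

open MulOpposite

variable {k : Type u} [Field k]

theorem mem_rightIdeal {a : Weyl k} {b : reg k} :
    b ∈ rightIdeal k a ↔ ∃ c : Weyl k, Eq (α := Weyl k) b (a * c) := by
  refine (Submodule.mem_span_singleton (R := (Weyl k)ᵐᵒᵖ) (M := reg k)).trans ⟨?_, ?_⟩
  · rintro ⟨c, rfl⟩; exact ⟨c.unop, rfl⟩
  · rintro ⟨c, rfl⟩; exact ⟨op c, rfl⟩

/-- A presentation of a graded module as `(A / aA)⟨s⟩`. -/
structure CyclicPres (N : Gr k) (a : Weyl k) (s : ℤ) where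
  cls : Weyl k →ₗ[k] N
  cls_eq_zero : ∀ {b}, cls b = 0 ↔ ∃ c, b = a * c
  act_cls : ∀ b c, act N c (cls b) = cls (b * c)
  mem_deg : ∀ {n m}, m ∈ N.deg n ↔ ∃ b ∈ grading k (n - s), cls b = m

namespace CyclicPres

/-- The presentation of `A / aA`. -/
noncomputable def cyclic (a : Weyl k) {n : ℤ} (ha : a ∈ grading k n) :
    CyclicPres (Weyl.cyclic k a ha) a 0 where
  cls :=
    { toFun := fun b => Submodule.Quotient.mk (p := rightIdeal k a) (M := reg k) b
      map_add' := fun _ _ => rfl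
      map_smul' := fun _ _ => rfl }
  cls_eq_zero := (Submodule.Quotient.mk_eq_zero _).trans mem_rightIdeal
  act_cls _ _ := rfl
  mem_deg {n m} := by rw [sub_zero]; exact Iff.rfl

/-- The presentation of a shift. -/
def shift {N : Gr k} {a : Weyl k} {s : ℤ} (P : CyclicPres N a s) (j : ℤ) :
    CyclicPres (N.shift j) a (s + j) where
  cls := P.cls
  cls_eq_zero := P.cls_eq_zero
  act_cls := P.act_cls
  mem_deg {n m} := by rw [add_comm s, ← sub_sub]; exact P.mem_deg

variable {N : Gr k} {a : Weyl k} {s : ℤ} (P : CyclicPres N a s)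

-- For b of degree n − s one has b z = (z + (n − s)) b. As z + c lies in aA, so does (z + c) b, and
-- only the scalar n − s − c survives in the quotient.
include P in
theorem scalarZ {c : k} (h : ∃ e, z k + algebraMap k _ c = a * e) : ScalarZ N (-c - s) := by
  intro n m hm
  obtain ⟨b, hb, rfl⟩ := P.mem_deg.1 hm
  rw [← act_z, P.act_cls, ← sub_eq_zero, ← map_smul, ← map_sub, P.cls_eq_zero, mul_z_of_mem hb]
  obtain ⟨e, he⟩ := h
  refine ⟨e * b, ?_⟩
  rw [← mul_assoc, ← he, Algebra.smul_def, ← sub_mul]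
  congr 1
  simp only [Int.cast_sub, map_add, map_sub, map_neg]
  noncomm_ring

theorem cls_one_mem : P.cls 1 ∈ N.deg s :=
  P.mem_deg.2 ⟨1, by rw [sub_self]; exact SetLike.one_mem_graded _, rfl⟩

theorem exists_poly {n : ℤ} {m : N} (hm : m ∈ N.deg n) :
    ∃ p : Polynomial k, m = P.cls (homogGen k (n - s) * Polynomial.aeval (z k) p) := by
  obtain ⟨b, hb, rfl⟩ := P.mem_deg.1 hm
  obtain ⟨p, rfl⟩ := exists_eq_homogGen_mul hb
  exact ⟨p, rfl⟩

theorem exists_smul {c : k} (h : ∃ e, z k + algebraMap k _ c = a * e) {m : N} (hm : m ∈ N.deg s) :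
    ∃ r : k, m = r • P.cls 1 := by
  obtain ⟨p, rfl⟩ := P.exists_poly hm
  have hz := P.scalarZ h
  rw [sub_self, show homogGen k 0 = 1 from pow_zero _, ← P.act_cls]
  exact ⟨_, hz.act_aeval p P.cls_one_mem⟩

/-- If 1 were in aA, then v = v·1 would vanish with v·a. -/
theorem cls_one_ne_zero {L : Gr k} {v : L} (hv : v ≠ 0) (h : act L a v = 0) : P.cls 1 ≠ 0 := by
  intro h0
  obtain ⟨c, hc⟩ := P.cls_eq_zero.1 h0
  have h1 := congrArg (fun b => act L b v) hc
  simp only [act_one, act_mul, h, map_zero] at h1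
  exact hv h1

end CyclicPres

variable (k) in
/-- The presentation of `X⟨j⟩`. -/
noncomputable def presX (j : ℤ) : CyclicPres ((X k).shift j) (x k) (0 + j) :=
  (CyclicPres.cyclic _ (gen_mem k true)).shift j

variable (k) in
/-- The presentation of `Y⟨j⟩`. -/
noncomputable def presY (j : ℤ) : CyclicPres ((Y k).shift j) (y k) (0 + 1 + j) :=
  ((CyclicPres.cyclic _ (gen_mem k false)).shift 1).shift j

theorem exists_z_eq_x_mul : ∃ e, z k + algebraMap k _ 0 = x k * e := ⟨y k, by simp⟩

theorem exists_z_eq_y_mul : ∃ e, z k + algebraMap k _ (-1) = y k * e :=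
  ⟨x k, by rw [y_mul_x, map_neg, map_one, sub_eq_add_neg]⟩

theorem scalarZ_X (j : ℤ) : ScalarZ ((X k).shift j) (-(j : k)) := by
  have h := (presX k j).scalarZ exists_z_eq_x_mul
  rwa [zero_add, neg_zero, zero_sub] at h

/-- The shift in the definition of Y absorbs the constant in z − 1 = yx ∈ yA, so that X⟨j⟩ and Y⟨j⟩
carry the same scalars and meet at the same gap. -/
theorem scalarZ_Y (j : ℤ) : ScalarZ ((Y k).shift j) (-(j : k)) := by
  have h := (presY k j).scalarZ exists_z_eq_y_mul
  rwa [show -(-1 : k) - ((0 + 1 + j : ℤ) : k) = -(j : k) by push_cast; ring] at h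

theorem scalarZ_M (c : k) : ScalarZ (M k c) (-c) := by
  have h := (CyclicPres.cyclic _ (z_add_mem k c)).scalarZ (c := c) ⟨1, by simp⟩
  rwa [Int.cast_zero, sub_zero] at h

section CharZero

variable [CharZero k]

variable (k) in
theorem nonempty_X_iso (j : ℤ) : Nonempty ((X k).shift j ≅ xMod k j) := by
  have P := presX k j
  rw [zero_add] at P
  have hW := xSeq_W (k := k) (le_refl j) 1
  refine nonempty_iso_xMod (scalarZ_X j) ?_ P.cls_one_mem ?_ fun m hm =>
    P.exists_smul exists_z_eq_x_mul hm
  · intro m hm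
    obtain ⟨p, rfl⟩ := P.exists_poly hm
    rw [P.cls_eq_zero, add_sub_cancel_left]
    exact ⟨_, by rw [show homogGen k 1 = x k from pow_one _]⟩
  · refine P.cls_one_ne_zero (L := xMod k j) (v := (xSeq k j).elt j 1 hW) (fun h0 => ?_)
      (xMod_eq_zero (lt_add_one j) (mX_mem (Seq.elt_mem _ j 1 hW)))
    have := (xSeq k j).val_elt j 1 hW
    rw [h0, map_zero] at this
    exact zero_ne_one this

variable (k) in
theorem nonempty_Y_iso (j : ℤ) : Nonempty ((Y k).shift j ≅ yMod k j) := by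
  have P := presY k j
  rw [zero_add, add_comm] at P
  have hW := ySeq_W (k := k) (lt_add_one j) 1
  refine nonempty_iso_yMod (scalarZ_Y j) ?_ P.cls_one_mem ?_ fun m hm =>
    P.exists_smul exists_z_eq_y_mul hm
  · intro m hm
    obtain ⟨p, rfl⟩ := P.exists_poly hm
    rw [P.cls_eq_zero, show j - (j + 1) = -((1 : ℕ) : ℤ) by simp]
    exact ⟨_, by rw [homogGen_neg, pow_one]⟩
  · refine P.cls_one_ne_zero (L := yMod k j) (v := (ySeq k j).elt (j + 1) 1 hW) (fun h0 => ?_)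
      (yMod_eq_zero le_rfl (mY_mem (Seq.elt_mem _ (j + 1) 1 hW)))
    have := (ySeq k j).val_elt (j + 1) 1 hW
    rw [h0, map_zero] at this
    exact zero_ne_one this

variable (k) in
/-- The isomorphism of `X⟨j⟩` with its model. -/
noncomputable def isoX (j : ℤ) : (X k).shift j ≅ xMod k j := (nonempty_X_iso k j).some

variable (k) in
/-- The isomorphism of `Y⟨j⟩` with its model. -/
noncomputable def isoY (j : ℤ) : (Y k).shift j ≅ yMod k j := (nonempty_Y_iso k j).some

/-! ### Rejects of the pairs of simple modules -/

theorem mem_reject_iff {M : Gr k} {j : ℤ} {m : M} : m ∈ GrMod.reject (simplePair k j) M ↔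
    (∀ F : M ⟶ xMod k j, F.1 m = 0) ∧ ∀ F : M ⟶ yMod k j, F.1 m = 0 := by
  simp only [GrMod.reject, Submodule.mem_iInf, LinearMap.mem_ker]
  have key : ∀ {S T : Gr k} (e : S ≅ T),
      (∀ f : M ⟶ S, f.1 m = 0) → ∀ F : M ⟶ T, F.1 m = 0 := fun e h F => by
    apply GrMod.iso_injective e.symm
    rw [map_zero]
    exact h (F ≫ e.inv)
  constructor
  · intro h
    exact ⟨key (isoX k j) (h true), key (isoY k j) (h false)⟩
  · rintro ⟨h1, h2⟩ (_ | _)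
    · exact key (isoY k j).symm h2
    · exact key (isoX k j).symm h1

/-- Morphisms to X⟨j⟩ are the functionals on M_j / M_{j+1}y, evaluated at m x^d, and functionals
separate the points of a vector space. -/
theorem forall_hom_xMod_iff {M : Gr k} {j : ℤ} {d : ℕ} {m : M} (hm : m ∈ M.deg (j - d)) :
    (∀ F : M ⟶ xMod k j, F.1 m = 0) ↔ ∃ m' ∈ M.deg (j + 1), (mX M ^ d) m = mY M m' := by
  constructor
  · intro h
    by_contra hne
    have hnot : (mX M ^ d) m ∉ (M.deg (j + 1)).map (mY M) := by
      rintro ⟨m', hm', h'⟩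
      exact hne ⟨m', hm', h'.symm⟩
    obtain ⟨φ, hφ, hle⟩ := Submodule.exists_le_ker_of_notMem hnot
    obtain ⟨F, hF⟩ := exists_hom_xMod j φ fun m' hm' => hle ⟨m', hm', rfl⟩
    refine hφ ?_
    rw [← hF d m hm, h F, map_zero]
  · rintro ⟨m', hm', h⟩ F
    refine (xMod_scalarZ j).mX_pow_ne_zero d (F.2 _ _ hm) ?_
    rw [← hom_mX_pow, h, hom_xMod_mY F hm']

theorem forall_hom_yMod_iff {M : Gr k} {j : ℤ} {d : ℕ} {m : M} (hm : m ∈ M.deg (j + 1 + d)) :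
    (∀ F : M ⟶ yMod k j, F.1 m = 0) ↔ ∃ m' ∈ M.deg j, (mY M ^ d) m = mX M m' := by
  constructor
  · intro h
    by_contra hne
    have hnot : (mY M ^ d) m ∉ (M.deg j).map (mX M) := by
      rintro ⟨m', hm', h'⟩
      exact hne ⟨m', hm', h'.symm⟩
    obtain ⟨φ, hφ, hle⟩ := Submodule.exists_le_ker_of_notMem hnot
    obtain ⟨F, hF⟩ := exists_hom_yMod j φ fun m' hm' => hle ⟨m', hm', rfl⟩
    refine hφ ?_
    rw [← hF d m hm, h F, map_zero]
  · rintro ⟨m', hm', h⟩ F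
    refine (yMod_scalarZ j).mY_pow_ne_zero d (F.2 _ _ hm) ?_
    rw [← hom_mY_pow, h, hom_yMod_mX F hm']

theorem mem_reject_iff_left {M : Gr k} {j : ℤ} {d : ℕ} {m : M} (hm : m ∈ M.deg (j - d)) :
    m ∈ GrMod.reject (simplePair k j) M ↔ ∃ m' ∈ M.deg (j + 1), (mX M ^ d) m = mY M m' := by
  rw [mem_reject_iff, forall_hom_xMod_iff hm, and_iff_left]
  exact fun F => yMod_eq_zero (by omega) (F.2 _ _ hm)

theorem mem_reject_iff_right {M : Gr k} {j : ℤ} {d : ℕ} {m : M} (hm : m ∈ M.deg (j + 1 + d)) :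
    m ∈ GrMod.reject (simplePair k j) M ↔ ∃ m' ∈ M.deg j, (mY M ^ d) m = mX M m' := by
  rw [mem_reject_iff, forall_hom_yMod_iff hm, and_iff_right]
  exact fun F => xMod_eq_zero (by omega) (F.2 _ _ hm)

end CharZero

end Weyl

/-! ### The modification of a module at the gap between degrees `j` and `j + 1` -/

namespace Weyl

open MulOpposite

variable {k : Type u} [Field k]

theorem eq_sub_or_eq_or_eq_add (n j : ℤ) :
    (∃ d : ℕ, n = j - (d + 1 : ℕ)) ∨ n = j ∨ ∃ d : ℕ, n = j + 1 + d := by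
  rcases lt_trichotomy n j with h | h | h
  · exact Or.inl ⟨(j - n - 1).toNat, by omega⟩
  · exact Or.inr (Or.inl h)
  · exact Or.inr (Or.inr ⟨(n - j - 1).toNat, by omega⟩)

theorem eq_sub_or_eq_add (n j : ℤ) : (∃ d : ℕ, n = j - d) ∨ ∃ d : ℕ, n = j + 1 + d := by
  rcases le_or_gt n j with h | h
  · exact Or.inl ⟨(j - n).toNat, by omega⟩
  · exact Or.inr ⟨(n - j - 1).toNat, by omega⟩

theorem sub_succ_add_one (j : ℤ) (d : ℕ) : j - ((d + 1 : ℕ) : ℤ) + 1 = j - d := by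
  push_cast; ring

theorem add_natCast_add_one (j : ℤ) (d : ℕ) : j + (d : ℤ) + 1 = j + (d + 1 : ℕ) := by
  push_cast; ring

theorem mX_mY (M : Gr k) (m : M) : mX M (mY M m) = mY M (mX M m) - m := by
  rw [mY_mX, add_sub_cancel_right]

theorem mX_z (M : Gr k) (m : M) : mX M (mY M (mX M m)) = mY M (mX M (mX M m)) - mX M m := by
  rw [mX_mY]

theorem mY_z (M : Gr k) (m : M) : mY M (mY M (mX M m)) = mY M (mX M (mY M m)) + mY M m := by
  rw [← map_add, ← mY_mX]

/-- The components of the modification of a module at the pair `X⟨j⟩`, `Y⟨j⟩`. -/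
def iotaW (M : Gr k) (j n : ℤ) : Submodule k (M × M) where
  carrier := {p | p.1 ∈ M.deg n ∧
    -- The first coordinate lies in the reject and the second is a witness of this, kept as data
    -- because on a general module it is not determined. In degree j a pair is determined by its
    -- witness in M_{j+1}, in degree j+1 by its witness in M_j: the module is reflected at the gap.
    if n ≤ j then p.2 ∈ M.deg (j + 1) ∧ (mX M ^ (j - n).toNat) p.1 = mY M p.2
    else p.2 ∈ M.deg j ∧ (mY M ^ (n - (j + 1)).toNat) p.1 = mX M p.2}
  zero_mem' := ⟨Submodule.zero_mem _, by split_ifs <;> simp⟩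
  add_mem' {p q} hp hq := ⟨Submodule.add_mem _ hp.1 hq.1, by
    have h1 := hp.2
    have h2 := hq.2
    split_ifs at h1 h2 ⊢
    · exact ⟨Submodule.add_mem _ h1.1 h2.1, by
        rw [Prod.fst_add, Prod.snd_add, map_add, map_add, h1.2, h2.2]⟩
    · exact ⟨Submodule.add_mem _ h1.1 h2.1, by
        rw [Prod.fst_add, Prod.snd_add, map_add, map_add, h1.2, h2.2]⟩⟩
  smul_mem' c p hp := ⟨Submodule.smul_mem _ c hp.1, by
    have h1 := hp.2
    split_ifs at h1 ⊢
    · exact ⟨Submodule.smul_mem _ c h1.1, by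
        rw [Prod.smul_fst, Prod.smul_snd, map_smul, map_smul, h1.2]⟩
    · exact ⟨Submodule.smul_mem _ c h1.1, by
        rw [Prod.smul_fst, Prod.smul_snd, map_smul, map_smul, h1.2]⟩⟩

theorem mem_iotaW_left {M : Gr k} {j : ℤ} {d : ℕ} {p : M × M} : p ∈ iotaW M j (j - d) ↔
    p.1 ∈ M.deg (j - d) ∧ p.2 ∈ M.deg (j + 1) ∧ (mX M ^ d) p.1 = mY M p.2 := by
  change (_ ∧ ite _ _ _) ↔ _
  rw [if_pos (by omega), show (j - (j - (d : ℤ))).toNat = d by omega]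

theorem mem_iotaW_right {M : Gr k} {j : ℤ} {d : ℕ} {p : M × M} : p ∈ iotaW M j (j + 1 + d) ↔
    p.1 ∈ M.deg (j + 1 + d) ∧ p.2 ∈ M.deg j ∧ (mY M ^ d) p.1 = mX M p.2 := by
  change (_ ∧ ite _ _ _) ↔ _
  rw [if_neg (by omega), show (j + 1 + (d : ℤ) - (j + 1)).toNat = d by omega]

theorem mem_iotaW_self {M : Gr k} {j : ℤ} {p : M × M} : p ∈ iotaW M j j ↔
    p.1 ∈ M.deg j ∧ p.2 ∈ M.deg (j + 1) ∧ p.1 = mY M p.2 := by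
  have := mem_iotaW_left (M := M) (j := j) (d := 0) (p := p)
  rwa [Nat.cast_zero, sub_zero, pow_zero] at this

theorem mem_iotaW_succ {M : Gr k} {j : ℤ} {p : M × M} : p ∈ iotaW M j (j + 1) ↔
    p.1 ∈ M.deg (j + 1) ∧ p.2 ∈ M.deg j ∧ p.1 = mX M p.2 := by
  have := mem_iotaW_right (M := M) (j := j) (d := 0) (p := p)
  rwa [Nat.cast_zero, add_zero, pow_zero] at this

/-- The second coordinate of multiplication by `x` on the modification of a module. -/
def iotaX (M : Gr k) (j n : ℤ) : M →ₗ[k] M :=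
  -- The defining equation dictates the new witness. Below the gap it is unchanged; at the gap y
  -- takes the place of x; above it, moving x past y^{n-j-1} and then past the x in front of the
  -- witness multiplies the witness by z + (n − j).
  if n < j then LinearMap.id else if n = j then mY M
    else mY M ∘ₗ mX M + ((n : k) - j) • LinearMap.id

/-- The second coordinate of multiplication by `y` on the modification of a module. -/
def iotaY (M : Gr k) (j n : ℤ) : M →ₗ[k] M :=
  -- The mirror image: below the gap y has to pass x^{j-n-1} and the y in front of the witness,
  -- which leaves z + (n − j − 1).
  if n < j then mY M ∘ₗ mX M + ((n : k) - j - 1) • LinearMap.id else if n = j then mX M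
    else LinearMap.id

section

variable (M : Gr k) {j n : ℤ} (m : M)

theorem iotaX_lt (h : n < j) : iotaX M j n m = m := by
  rw [iotaX, if_pos h]; rfl

theorem iotaX_self : iotaX M j j m = mY M m := by
  rw [iotaX, if_neg (lt_irrefl j), if_pos rfl]

theorem iotaX_gt (h : j < n) : iotaX M j n m = mY M (mX M m) + ((n : k) - j) • m := by
  rw [iotaX, if_neg (by omega), if_neg (by omega)]; rfl

theorem iotaY_lt (h : n < j) : iotaY M j n m = mY M (mX M m) + ((n : k) - j - 1) • m := by
  rw [iotaY, if_pos h]; rfl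

theorem iotaY_self : iotaY M j j m = mX M m := by
  rw [iotaY, if_neg (lt_irrefl j), if_pos rfl]

theorem iotaY_gt (h : j < n) : iotaY M j n m = m := by
  rw [iotaY, if_neg (by omega), if_neg (by omega)]; rfl

end

/-- The modification of a module at the pair `X⟨j⟩`, `Y⟨j⟩`, as a sequence. -/
def iotaSeq (j : ℤ) (M : Gr k) : Seq k where
  U := M × M
  W := iotaW M j
  x n := (mX M).prodMap (iotaX M j n)
  y n := (mY M).prodMap (iotaY M j n)
  x_mem n := by
    rintro ⟨p, q⟩ h
    change (mX M p, iotaX M j n q) ∈ _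
    rcases eq_sub_or_eq_or_eq_add n j with ⟨d, rfl⟩ | rfl | ⟨d, rfl⟩
    · obtain ⟨h1, h2, h3⟩ := mem_iotaW_left.1 h
      have h4 := mX_mem h1
      rw [iotaX_lt _ _ (by omega)]
      rw [sub_succ_add_one] at h4 ⊢
      refine mem_iotaW_left.2 ⟨h4, h2, ?_⟩
      rw [← h3, pow_succ]; rfl
    · obtain ⟨h1, h2, h3⟩ := mem_iotaW_self.1 h
      rw [iotaX_self]
      exact mem_iotaW_succ.2 ⟨mX_mem h1, mY_mem h2, congrArg _ h3⟩
    · obtain ⟨h1, h2, h3⟩ := mem_iotaW_right.1 h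
      have h4 := mX_mem h1
      rw [iotaX_gt _ _ (by omega)]
      rw [add_natCast_add_one] at h4 ⊢
      refine mem_iotaW_right.2 ⟨h4, Submodule.add_mem _ (mY_mem (mX_mem h2))
        (Submodule.smul_mem _ _ h2), ?_⟩
      simp only at h3 ⊢
      rw [pow_succ, Module.End.mul_apply, mY_pow_z, h3, map_add, map_smul, mX_z]
      push_cast
      module
  y_mem n := by
    rintro ⟨p, q⟩ h
    change (mY M p, iotaY M j n q) ∈ _
    rcases eq_sub_or_eq_or_eq_add n j with ⟨d, rfl⟩ | rfl | ⟨d, rfl⟩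
    · rw [iotaY_lt _ _ (by omega)]
      have h' := h
      rw [sub_succ_add_one] at h'
      obtain ⟨h1, h2, h3⟩ := mem_iotaW_left.1 h'
      refine mem_iotaW_left.2 ⟨mY_mem h.1, Submodule.add_mem _ (mY_mem (mX_mem h2))
        (Submodule.smul_mem _ _ h2), ?_⟩
      simp only at h3 ⊢
      rw [pow_succ, Module.End.mul_apply, mX_mY, map_sub, mX_pow_z, h3, map_add, map_smul, mY_z]
      push_cast
      module
    · obtain ⟨h1, h2, h3⟩ := mem_iotaW_succ.1 h
      rw [iotaY_self]
      exact mem_iotaW_self.2 ⟨mY_mem h1, mX_mem h2, congrArg _ h3⟩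
    · rw [iotaY_gt _ _ (by omega)]
      have h' := h
      rw [add_natCast_add_one] at h'
      obtain ⟨h1, h2, h3⟩ := mem_iotaW_right.1 h'
      refine mem_iotaW_right.2 ⟨mY_mem h.1, h2, ?_⟩
      rw [← h3, pow_succ]; rfl
  rel n := by
    rintro ⟨p, q⟩ -
    refine Prod.ext (mY_mX M p) ?_
    change iotaY M j (n + 1) (iotaX M j (n + 1) q) = iotaX M j n (iotaY M j n q) + q
    rcases eq_sub_or_eq_or_eq_add n j with ⟨d, rfl⟩ | rfl | ⟨d, rfl⟩
    · have h1 : j - ((d + 1 : ℕ) : ℤ) < j := by omega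
      rw [iotaY_lt _ _ h1, iotaX_lt _ _ h1]
      cases d with
      | zero =>
        rw [sub_succ_add_one, Nat.cast_zero, sub_zero, iotaX_self, iotaY_self, mX_mY]
        push_cast
        module
      | succ d =>
        have h2 : j - ((d + 1 + 1 : ℕ) : ℤ) + 1 < j := by push_cast; omega
        rw [iotaX_lt _ _ h2, iotaY_lt _ _ h2]
        push_cast
        module
    · rw [iotaX_self, iotaY_self, iotaX_gt _ _ (by omega), iotaY_gt _ _ (by omega)]
      push_cast
      module
    · rw [iotaX_gt _ _ (by omega), iotaX_gt _ _ (by omega), iotaY_gt _ _ (by omega),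
        iotaY_gt _ _ (by omega)]
      push_cast
      module

/-- The modification of a module at the pair `X⟨j⟩`, `Y⟨j⟩`. -/
noncomputable abbrev iotaObj (j : ℤ) (M : Gr k) : Gr k := (iotaSeq j M).toGr

/-- The first coordinate of the component of degree `n`. -/
noncomputable def fstAt (j : ℤ) (M : Gr k) (n : ℤ) : iotaObj j M →ₗ[k] M :=
  LinearMap.fst k M M ∘ₗ (iotaSeq j M).val n

/-- The second coordinate of the component of degree `n`. -/
noncomputable def sndAt (j : ℤ) (M : Gr k) (n : ℤ) : iotaObj j M →ₗ[k] M :=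
  LinearMap.snd k M M ∘ₗ (iotaSeq j M).val n

section

variable {j : ℤ} {M : Gr k}

theorem fstAt_mX (n : ℤ) (p : iotaObj j M) : fstAt j M (n + 1) (mX _ p) = mX M (fstAt j M n p) :=
  congrArg Prod.fst ((iotaSeq j M).val_mX n p)

theorem sndAt_mX (n : ℤ) (p : iotaObj j M) :
    sndAt j M (n + 1) (mX _ p) = iotaX M j n (sndAt j M n p) :=
  congrArg Prod.snd ((iotaSeq j M).val_mX n p)

theorem fstAt_mY (n : ℤ) (p : iotaObj j M) : fstAt j M n (mY _ p) = mY M (fstAt j M (n + 1) p) :=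
  congrArg Prod.fst ((iotaSeq j M).val_mY n p)

theorem sndAt_mY (n : ℤ) (p : iotaObj j M) :
    sndAt j M n (mY _ p) = iotaY M j n (sndAt j M (n + 1) p) :=
  congrArg Prod.snd ((iotaSeq j M).val_mY n p)

theorem mem_iotaW (n : ℤ) (p : iotaObj j M) : (fstAt j M n p, sndAt j M n p) ∈ iotaW M j n :=
  (iotaSeq j M).val_mem n p

theorem iota_ext {n : ℤ} {p q : iotaObj j M} (hp : p ∈ (iotaObj j M).deg n)
    (hq : q ∈ (iotaObj j M).deg n) (h1 : fstAt j M n p = fstAt j M n q)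
    (h2 : sndAt j M n p = sndAt j M n q) : p = q :=
  (iotaSeq j M).ext_deg hp hq (Prod.ext h1 h2)

/-- The element of the modification with given coordinates. -/
noncomputable def iotaElt (n : ℤ) (p q : M) (h : (p, q) ∈ iotaW M j n) : iotaObj j M :=
  (iotaSeq j M).elt n (p, q) h

theorem iotaElt_mem (n : ℤ) (p q : M) (h : (p, q) ∈ iotaW M j n) :
    iotaElt n p q h ∈ (iotaObj j M).deg n := Seq.elt_mem _ _ _ _

theorem fstAt_iotaElt (n : ℤ) (p q : M) (h : (p, q) ∈ iotaW M j n) :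
    fstAt j M n (iotaElt n p q h) = p := congrArg Prod.fst ((iotaSeq j M).val_elt n (p, q) h)

theorem sndAt_iotaElt (n : ℤ) (p q : M) (h : (p, q) ∈ iotaW M j n) :
    sndAt j M n (iotaElt n p q h) = q := congrArg Prod.snd ((iotaSeq j M).val_elt n (p, q) h)

theorem exists_homToIota {L : Gr k} (f g : ℤ → L →ₗ[k] M)
    (h : ∀ n, ∀ m ∈ L.deg n, (f n m, g n m) ∈ iotaW M j n)
    (hfx : ∀ n, ∀ m ∈ L.deg n, f (n + 1) (mX L m) = mX M (f n m))
    (hfy : ∀ n, ∀ m ∈ L.deg (n + 1), f n (mY L m) = mY M (f (n + 1) m))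
    (hgx : ∀ n, ∀ m ∈ L.deg n, g (n + 1) (mX L m) = iotaX M j n (g n m))
    (hgy : ∀ n, ∀ m ∈ L.deg (n + 1), g n (mY L m) = iotaY M j n (g (n + 1) m)) :
    ∃ F : L ⟶ iotaObj j M, ∀ n, ∀ m ∈ L.deg n,
      fstAt j M n (F.1 m) = f n m ∧ sndAt j M n (F.1 m) = g n m := by
  obtain ⟨F, hF⟩ := (iotaSeq j M).exists_hom_toGr (fun n => (f n).prod (g n)) h
    (fun n m hm => Prod.ext (hfx n m hm) (hgx n m hm))
    (fun n m hm => Prod.ext (hfy n m hm) (hgy n m hm))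
  exact ⟨F, fun n m hm => ⟨congrArg Prod.fst (hF n m hm), congrArg Prod.snd (hF n m hm)⟩⟩

theorem hom_iotaX {N : Gr k} (f : M ⟶ N) (n : ℤ) (m : M) :
    f.1 (iotaX M j n m) = iotaX N j n (f.1 m) := by
  rcases lt_trichotomy n j with h | rfl | h
  · rw [iotaX_lt _ _ h, iotaX_lt _ _ h]
  · rw [iotaX_self, iotaX_self, hom_mY]
  · rw [iotaX_gt _ _ h, iotaX_gt _ _ h, map_add, hom_mY, hom_mX, GrMod.hom_smul]

theorem hom_iotaY {N : Gr k} (f : M ⟶ N) (n : ℤ) (m : M) :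
    f.1 (iotaY M j n m) = iotaY N j n (f.1 m) := by
  rcases lt_trichotomy n j with h | rfl | h
  · rw [iotaY_lt _ _ h, iotaY_lt _ _ h, map_add, hom_mY, hom_mX, GrMod.hom_smul]
  · rw [iotaY_self, iotaY_self, hom_mX]
  · rw [iotaY_gt _ _ h, iotaY_gt _ _ h]

theorem hom_mem_iotaW {N : Gr k} (f : M ⟶ N) {n : ℤ} {p q : M} (h : (p, q) ∈ iotaW M j n) :
    (f.1 p, f.1 q) ∈ iotaW N j n := by
  rcases eq_sub_or_eq_add n j with ⟨d, rfl⟩ | ⟨d, rfl⟩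
  · obtain ⟨h1, h2, h3⟩ := mem_iotaW_left.1 h
    exact mem_iotaW_left.2 ⟨f.2 _ _ h1, f.2 _ _ h2, by rw [← hom_mX_pow, ← hom_mY]; exact congrArg _ h3⟩
  · obtain ⟨h1, h2, h3⟩ := mem_iotaW_right.1 h
    exact mem_iotaW_right.2 ⟨f.2 _ _ h1, f.2 _ _ h2, by rw [← hom_mY_pow, ← hom_mX]; exact congrArg _ h3⟩

theorem exists_iotaMap {N : Gr k} (j : ℤ) (f : M ⟶ N) :
    ∃ F : iotaObj j M ⟶ iotaObj j N, ∀ n, ∀ m ∈ (iotaObj j M).deg n,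
      fstAt j N n (F.1 m) = f.1 (fstAt j M n m) ∧ sndAt j N n (F.1 m) = f.1 (sndAt j M n m) := by
  refine exists_homToIota (fun n => GrMod.lin f ∘ₗ fstAt j M n) (fun n => GrMod.lin f ∘ₗ sndAt j M n)
    ?_ ?_ ?_ ?_ ?_
  · exact fun n m _ => hom_mem_iotaW f (mem_iotaW n m)
  · intro n m _
    simp only [LinearMap.comp_apply, GrMod.lin_apply, fstAt_mX, hom_mX]
  · intro n m _
    simp only [LinearMap.comp_apply, GrMod.lin_apply, fstAt_mY, hom_mY]
  · intro n m _
    simp only [LinearMap.comp_apply, GrMod.lin_apply, sndAt_mX, hom_iotaX]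
  · intro n m _
    simp only [LinearMap.comp_apply, GrMod.lin_apply, sndAt_mY, hom_iotaY]

/-- The functoriality of the modification. -/
noncomputable def iotaMap {N : Gr k} (j : ℤ) (f : M ⟶ N) : iotaObj j M ⟶ iotaObj j N :=
  (exists_iotaMap j f).choose

theorem fstAt_iotaMap {N : Gr k} (f : M ⟶ N) {n : ℤ} {m : iotaObj j M}
    (hm : m ∈ (iotaObj j M).deg n) : fstAt j N n ((iotaMap j f).1 m) = f.1 (fstAt j M n m) :=
  ((exists_iotaMap j f).choose_spec n m hm).1

theorem sndAt_iotaMap {N : Gr k} (f : M ⟶ N) {n : ℤ} {m : iotaObj j M}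
    (hm : m ∈ (iotaObj j M).deg n) : sndAt j N n ((iotaMap j f).1 m) = f.1 (sndAt j M n m) :=
  ((exists_iotaMap j f).choose_spec n m hm).2

theorem iota_hom_ext {L : Gr k} {f g : L ⟶ iotaObj j M}
    (h : ∀ n, ∀ m ∈ L.deg n, fstAt j M n (f.1 m) = fstAt j M n (g.1 m) ∧
      sndAt j M n (f.1 m) = sndAt j M n (g.1 m)) : f = g :=
  GrMod.hom_ext_homog fun n m hm =>
    iota_ext (f.2 n m hm) (g.2 n m hm) (h n m hm).1 (h n m hm).2

end

variable (k) in
/-- The modification at the pair `X⟨j⟩`, `Y⟨j⟩` as a functor. -/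
noncomputable def iotaFunctor (j : ℤ) : Gr k ⥤ Gr k where
  obj M := iotaObj j M
  map f := iotaMap j f
  map_id M := iota_hom_ext fun n m hm => by
    rw [fstAt_iotaMap _ hm, sndAt_iotaMap _ hm]; exact ⟨rfl, rfl⟩
  map_comp f g := iota_hom_ext fun n m hm => by
    rw [fstAt_iotaMap _ hm, sndAt_iotaMap _ hm, GrMod.comp_apply, GrMod.comp_apply,
      GrMod.comp_apply, fstAt_iotaMap _ ((iotaMap j f).2 _ _ hm), fstAt_iotaMap _ hm,
      sndAt_iotaMap _ ((iotaMap j f).2 _ _ hm), sndAt_iotaMap _ hm]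
    exact ⟨rfl, rfl⟩

theorem iotaMap_add {M N : Gr k} (j : ℤ) (f g : M ⟶ N) :
    iotaMap j (f + g) = iotaMap j f + iotaMap j g := iota_hom_ext fun n m hm => by
  rw [GrMod.add_apply, map_add, map_add, fstAt_iotaMap _ hm, sndAt_iotaMap _ hm,
    fstAt_iotaMap _ hm, sndAt_iotaMap _ hm, fstAt_iotaMap _ hm, sndAt_iotaMap _ hm]
  exact ⟨rfl, rfl⟩

theorem iotaMap_smul {M N : Gr k} (j : ℤ) (c : k) (f : M ⟶ N) :
    iotaMap j (c • f) = c • iotaMap j f := iota_hom_ext fun n m hm => by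
  rw [GrMod.smul_apply, map_smul, map_smul, fstAt_iotaMap _ hm, sndAt_iotaMap _ hm,
    fstAt_iotaMap _ hm, sndAt_iotaMap _ hm]
  exact ⟨rfl, rfl⟩

instance (j : ℤ) : (iotaFunctor k j).Additive where
  map_add := iotaMap_add j _ _

instance (j : ℤ) : (iotaFunctor k j).Linear k where
  map_smul f c := iotaMap_smul j c f

end Weyl

/-! ### The linear algebra over `k[z]` behind the involution -/

namespace Weyl

open MulOpposite Polynomial

variable {k : Type u} [Field k]

/-- The eigenvalue of z on m x^i is c + i, so as long as this is nonzero m x^i is recovered from m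
x^{i+1} by applying y. -/
theorem eq_zero_of_mX_pow {M : Gr k} {c : k} {m : M} (hm : mY M (mX M m) = c • m) (d : ℕ)
    (hc : ∀ i : ℕ, i < d → c + i ≠ 0) (h : (mX M ^ d) m = 0) : m = 0 := by
  induction d with
  | zero => exact h
  | succ d ih =>
    refine ih (fun i hi => hc i (by omega)) ?_
    have h1 := mX_pow_z M d m
    rw [pow_succ', Module.End.mul_apply] at h
    rw [h, map_zero, hm, map_smul, zero_sub] at h1
    have h2 : (c + d) • (mX M ^ d) m = 0 := by rw [add_smul, h1, neg_add_cancel]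
    exact (smul_eq_zero.1 h2).resolve_left (hc d (by omega))

theorem eq_zero_of_mY_pow {M : Gr k} {c : k} {m : M} (hm : mY M (mX M m) = c • m) (d : ℕ)
    (hc : ∀ i : ℕ, i < d → c - (i + 1) ≠ 0) (h : (mY M ^ d) m = 0) : m = 0 := by
  induction d with
  | zero => exact h
  | succ d ih =>
    refine ih (fun i hi => hc i (by omega)) ?_
    have h1 := mY_pow_z M d m
    rw [pow_succ', Module.End.mul_apply] at h
    rw [mY_mX M ((mY M ^ d) m), h, map_zero, hm, map_smul, zero_add] at h1
    have h2 : (c - (d + 1)) • (mY M ^ d) m = 0 := by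
      rw [sub_smul, h1]
      module
    exact (smul_eq_zero.1 h2).resolve_left (hc d (by omega))

theorem aeval_z_mem (p : k[X]) : aeval (z k) p ∈ grading k 0 := by
  induction p using Polynomial.induction_on' with
  | add p q hp hq => rw [map_add]; exact Submodule.add_mem _ hp hq
  | monomial n a =>
    have hz : z k ∈ grading k 0 := by simpa using z_add_mem k 0
    rw [aeval_monomial, ← Algebra.smul_def]
    have := SetLike.pow_mem_graded (A := grading k) n hz
    rw [nsmul_zero] at this
    exact Submodule.smul_mem _ _ this

theorem act_aeval_mem {M : Gr k} {n : ℤ} {m : M} (hm : m ∈ M.deg n) (p : k[X]) :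
    act M (aeval (z k) p) m ∈ M.deg n := by
  have := act_mem hm (aeval_z_mem p)
  rwa [add_zero] at this

theorem act_aeval_mul (M : Gr k) (p q : k[X]) (m : M) :
    act M (aeval (z k) (p * q)) m = act M (aeval (z k) p) (act M (aeval (z k) q) m) := by
  rw [mul_comm, map_mul, act_mul]

theorem act_aeval_X_add_C (M : Gr k) (c : k) (m : M) :
    act M (aeval (z k) (Polynomial.X + C c)) m = mY M (mX M m) + c • m := by
  rw [map_add, aeval_X, aeval_C, act_add, act_z, act_algebraMap]

theorem mY_pow_mX_pow (M : Gr k) (d : ℕ) (m : M) : (mY M ^ d) ((mX M ^ d) m) =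
    act M (aeval (z k) (∏ i ∈ Finset.range d, (Polynomial.X + C (i : k)))) m := by
  induction d with
  | zero => simp [act_one]
  | succ d ih =>
    rw [pow_succ, pow_succ', Module.End.mul_apply, Module.End.mul_apply, mY_pow_z, ih,
      Finset.prod_range_succ, mul_comm, act_aeval_mul, act_aeval_X_add_C]

theorem mX_pow_mY_pow (M : Gr k) (d : ℕ) (m : M) : (mX M ^ d) ((mY M ^ d) m) =
    act M (aeval (z k) (∏ i ∈ Finset.range d, (Polynomial.X + C (-(i + 1 : k))))) m := by
  induction d with
  | zero => simp [act_one]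
  | succ d ih =>
    rw [pow_succ, pow_succ', Module.End.mul_apply, Module.End.mul_apply, mX_mY, map_sub, mX_pow_z,
      ih, Finset.prod_range_succ, mul_comm, act_aeval_mul, act_aeval_X_add_C]
    module

section CharZero

variable [CharZero k]

/-- The product is x^d y^d written in z. In characteristic zero its roots 0, −1, …, −(d − 1) avoid
−d. -/
theorem isCoprime_prod_left (d : ℕ) :
    IsCoprime (∏ i ∈ Finset.range d, (Polynomial.X + C (i : k))) (Polynomial.X + C (d : k)) := by
  refine IsCoprime.prod_left fun i hi => ?_
  rw [Finset.mem_range] at hi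
  have := isCoprime_X_sub_C_of_isUnit_sub (a := -(i : k)) (b := -(d : k)) (by
    rw [isUnit_iff_ne_zero, ne_eq, sub_eq_zero, neg_inj]
    exact_mod_cast hi.ne)
  simpa using this

theorem isCoprime_prod_right (d : ℕ) :
    IsCoprime (∏ i ∈ Finset.range d, (Polynomial.X + C (-(i + 1 : k)))) (Polynomial.X + C (-(d + 1 : k))) := by
  refine IsCoprime.prod_left fun i hi => ?_
  rw [Finset.mem_range] at hi
  have := isCoprime_X_sub_C_of_isUnit_sub (a := (i + 1 : k)) (b := (d + 1 : k)) (by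
    rw [isUnit_iff_ne_zero, ne_eq, sub_eq_zero, add_left_inj]
    exact_mod_cast hi.ne)
  simpa [sub_eq_add_neg] using this

/-- With P = x^d y^d as a polynomial in z, Q = z + d and aP + bQ = 1, a solution w must equal (aP +
bQ) w, which the two required equations rewrite as a·(q y^d) + b·m. The hypothesis makes this
candidate work, since it gives Q·(q y^d) = P·m. -/
theorem exists_left {M : Gr k} {n l : ℤ} {d : ℕ} (hn : l - d = n) {m q : M} (hm : m ∈ M.deg n)
    (hq : q ∈ M.deg l) (h : (mX M ^ d) m = mY M (mX M q)) :
    ∃ w ∈ M.deg n, mY M (mX M w) + (d : k) • w = m ∧ (mX M ^ d) w = q := by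
  obtain ⟨a, b, hab⟩ := isCoprime_prod_left (k := k) d
  set P : k[X] := ∏ i ∈ Finset.range d, (Polynomial.X + C (i : k))
  set Q : k[X] := Polynomial.X + C (d : k)
  let A : k[X] → M →ₗ[k] M := fun p => act M (aeval (z k) p)
  have hA : ∀ p q m, A (p * q) m = A p (A q m) := act_aeval_mul M
  have hAadd : ∀ p q m, A (p + q) m = A p m + A q m := fun p q m => by
    simp only [A]; rw [map_add, act_add]
  have hA1 : ∀ m, A (a * P) m + A (b * Q) m = m := fun m => by
    rw [← hAadd, hab]; simp only [A]; rw [map_one, act_one]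
  have hQ : ∀ m, A Q m = mY M (mX M m) + (d : k) • m := act_aeval_X_add_C M _
  have hP : ∀ m, A P m = (mY M ^ d) ((mX M ^ d) m) := fun m => (mY_pow_mX_pow M d m).symm
  have hYq : A Q ((mY M ^ d) q) = A P m := by rw [hQ, ← mY_pow_z, ← h, hP]
  have hYd : (mY M ^ d) q ∈ M.deg n := hn ▸ mY_pow_mem hq d
  have hw1 : A Q (A b m + A a ((mY M ^ d) q)) = m := by
    rw [map_add, ← hA, ← hA, mul_comm Q b, mul_comm Q a, hA a, hYq, ← hA, add_comm, hA1]
  refine ⟨A b m + A a ((mY M ^ d) q), Submodule.add_mem _ (act_aeval_mem hm b)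
    (act_aeval_mem hYd a), by rw [← hQ, hw1], ?_⟩
  set w := A b m + A a ((mY M ^ d) q)
  rw [← sub_eq_zero]
  -- The difference w x^d − q is killed by z and by y^d. On the kernel of z the successive
  -- eigenvalues of yx along the powers of y are −1, −2, …, so y^d is injective there.
  refine eq_zero_of_mY_pow (c := 0) ?_ d (fun i _ => by
    rw [zero_sub, neg_ne_zero]; exact_mod_cast i.succ_ne_zero) ?_
  · have h1 := mX_pow_z M d w
    have h2 : mY M (mX M w) = m - (d : k) • w := by rw [← hw1, hQ, add_sub_cancel_right]
    rw [h2, map_sub, map_smul, sub_left_inj, h] at h1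
    rw [map_sub, map_sub, ← h1, sub_self, zero_smul]
  · rw [map_sub, ← hP, map_add, ← hA, ← hA, mul_comm P b, mul_comm P a, hA b, ← hYq, ← hA,
      sub_eq_zero, add_comm, hA1]

theorem exists_right {M : Gr k} {n l : ℤ} {d : ℕ} (hn : l + d = n) {m q : M} (hm : m ∈ M.deg n)
    (hq : q ∈ M.deg l) (h : (mY M ^ d) m = mX M (mY M q)) :
    ∃ w ∈ M.deg n, mY M (mX M w) + (-(d + 1 : k)) • w = m ∧ (mY M ^ d) w = q := by
  obtain ⟨a, b, hab⟩ := isCoprime_prod_right (k := k) d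
  set P : k[X] := ∏ i ∈ Finset.range d, (Polynomial.X + C (-(i + 1 : k)))
  set Q : k[X] := Polynomial.X + C (-(d + 1 : k))
  let A : k[X] → M →ₗ[k] M := fun p => act M (aeval (z k) p)
  have hA : ∀ p q m, A (p * q) m = A p (A q m) := act_aeval_mul M
  have hAadd : ∀ p q m, A (p + q) m = A p m + A q m := fun p q m => by
    simp only [A]; rw [map_add, act_add]
  have hA1 : ∀ m, A (a * P) m + A (b * Q) m = m := fun m => by
    rw [← hAadd, hab]; simp only [A]; rw [map_one, act_one]
  have hQ : ∀ m, A Q m = mY M (mX M m) + (-(d + 1 : k)) • m := act_aeval_X_add_C M _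
  have hP : ∀ m, A P m = (mX M ^ d) ((mY M ^ d) m) := fun m => (mX_pow_mY_pow M d m).symm
  have hXq : A Q ((mX M ^ d) q) = A P m := by
    rw [hQ, hP, h, mX_mY, map_sub, mX_pow_z]; module
  have hXd : (mX M ^ d) q ∈ M.deg n := hn ▸ mX_pow_mem hq d
  have hw1 : A Q (A b m + A a ((mX M ^ d) q)) = m := by
    rw [map_add, ← hA, ← hA, mul_comm Q b, mul_comm Q a, hA a, hXq, ← hA, add_comm, hA1]
  refine ⟨A b m + A a ((mX M ^ d) q), Submodule.add_mem _ (act_aeval_mem hm b)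
    (act_aeval_mem hXd a), by rw [← hQ, hw1], ?_⟩
  set w := A b m + A a ((mX M ^ d) q)
  rw [← sub_eq_zero]
  -- Here the difference lies in the kernel of yx = z − 1, where z has eigenvalue 1; this is the
  -- source of `c = 1`.
  refine eq_zero_of_mX_pow (c := 1) ?_ d (fun i _ => by
    rw [add_comm]; exact_mod_cast i.succ_ne_zero) ?_
  · have h1 := mY_pow_z M d w
    have h2 : mY M (mX M w) = m + (d + 1 : k) • w := by
      rw [← hw1, hQ]; module
    rw [h2, map_add, map_smul, h, mX_mY] at h1
    rw [map_sub, map_sub, one_smul]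
    linear_combination (norm := module) (-1 : k) • h1
  · rw [map_sub, ← hP, map_add, ← hA, ← hA, mul_comm P b, mul_comm P a, hA b, ← hXq, ← hA,
      sub_eq_zero, add_comm, hA1]

end CharZero

theorem Seq.exists_lin (S : Seq k) {M : Gr k} (i n : ℤ) (φ : M →ₗ[k] S.U)
    (h : ∀ m ∈ M.deg i, φ m ∈ S.W n) :
    ∃ g : M →ₗ[k] S.toGr, ∀ m ∈ M.deg i, g m ∈ S.toGr.deg n ∧ S.val n (g m) = φ m := by
  refine ⟨(Finsupp.lsingle n ∘ₗ φ ∘ₗ M.proj i).codRestrict S.total fun m =>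
      (S.single n (φ (M.proj i m)) (h _ (M.proj_mem i m))).2, fun m hm => ⟨fun i hi =>
        Finsupp.single_eq_of_ne hi, Finsupp.single_eq_same.trans ?_⟩⟩
  exact congrArg φ (M.proj_same hm)

theorem exists_linToIota {L M : Gr k} {j : ℤ} (i n : ℤ) (φ ψ : L →ₗ[k] M)
    (h : ∀ m ∈ L.deg i, (φ m, ψ m) ∈ iotaW M j n) :
    ∃ g : L →ₗ[k] iotaObj j M, ∀ m ∈ L.deg i, g m ∈ (iotaObj j M).deg n ∧
      fstAt j M n (g m) = φ m ∧ sndAt j M n (g m) = ψ m := by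
  obtain ⟨g, hg⟩ := (iotaSeq j M).exists_lin i n (φ.prod ψ) h
  exact ⟨g, fun m hm => ⟨(hg m hm).1, congrArg Prod.fst (hg m hm).2, congrArg Prod.snd (hg m hm).2⟩⟩

section

variable {j : ℤ} {M : Gr k}

theorem fstAt_mX_pow (n : ℤ) (d : ℕ) (p : iotaObj j M) :
    fstAt j M (n + d) ((mX _ ^ d) p) = (mX M ^ d) (fstAt j M n p) := by
  induction d with
  | zero => simp
  | succ d ih =>
    rw [pow_succ', pow_succ', Module.End.mul_apply, Module.End.mul_apply, ← ih, ← fstAt_mX]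
    push_cast
    rw [add_assoc]

theorem fstAt_mY_pow (n : ℤ) (d : ℕ) (p : iotaObj j M) :
    fstAt j M (n - d) ((mY _ ^ d) p) = (mY M ^ d) (fstAt j M n p) := by
  induction d with
  | zero => simp
  | succ d ih =>
    rw [pow_succ', pow_succ', Module.End.mul_apply, Module.End.mul_apply, ← ih, fstAt_mY,
      sub_succ_add_one]

theorem sndAt_mX_pow (d : ℕ) (p : iotaObj j M) :
    sndAt j M j ((mX _ ^ d) p) = sndAt j M (j - d) p := by
  induction d generalizing p with
  | zero => simp
  | succ d ih =>
    rw [pow_succ, Module.End.mul_apply, ih, ← sub_succ_add_one, sndAt_mX, iotaX_lt _ _ (by omega)]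

theorem sndAt_mY_pow (d : ℕ) (p : iotaObj j M) :
    sndAt j M (j + 1) ((mY _ ^ d) p) = sndAt j M (j + 1 + d) p := by
  induction d generalizing p with
  | zero => simp
  | succ d ih =>
    rw [pow_succ, Module.End.mul_apply, ih, sndAt_mY, iotaY_gt _ _ (by omega), add_natCast_add_one]

end

/-- An element of the double modification is a pair of pairs, and this is its outer first
coordinate. Using m(z + d) in place of m makes it liftable: m(z + d) x^d = m x^d z = (m x^{d+1}) y,
so m x^{d+1} is a witness. Above the gap the factor is z − (d + 1), by the same computation with y.
-/
theorem exists_eta_fst (j n : ℤ) (M : Gr k) : ∃ f : M →ₗ[k] iotaObj j M,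
    (∀ d : ℕ, n = j - d → ∀ m ∈ M.deg n, f m ∈ (iotaObj j M).deg n ∧
      fstAt j M n (f m) = mY M (mX M m) + (d : k) • m ∧
      sndAt j M n (f m) = mX M ((mX M ^ d) m)) ∧
    ∀ d : ℕ, n = j + 1 + d → ∀ m ∈ M.deg n, f m ∈ (iotaObj j M).deg n ∧
      fstAt j M n (f m) = mY M (mX M m) - (d + 1 : k) • m ∧
      sndAt j M n (f m) = mY M ((mY M ^ d) m) := by
  rcases eq_sub_or_eq_add n j with ⟨d, rfl⟩ | ⟨d, rfl⟩
  · obtain ⟨g, hg⟩ := exists_linToIota (L := M) (M := M) (j := j) (j - d) (j - d)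
      (mY M ∘ₗ mX M + (d : k) • LinearMap.id) (mX M ∘ₗ mX M ^ d) fun m hm => by
        have h1 := mX_pow_mem hm d
        rw [sub_add_cancel] at h1
        refine mem_iotaW_left.2 ⟨Submodule.add_mem _ (mY_mem (mX_mem hm))
          (Submodule.smul_mem _ _ hm), mX_mem h1, ?_⟩
        change (mX M ^ d) (mY M (mX M m) + (d : k) • m) = mY M (mX M ((mX M ^ d) m))
        rw [map_add, map_smul, mX_pow_z, sub_add_cancel]
    refine ⟨g, fun d' hd' m hm => ?_, fun d' hd' => by omega⟩
    obtain rfl : d' = d := by omega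
    exact hg m hm
  · obtain ⟨g, hg⟩ := exists_linToIota (L := M) (M := M) (j := j) (j + 1 + d) (j + 1 + d)
      (mY M ∘ₗ mX M - (d + 1 : k) • LinearMap.id) (mY M ∘ₗ mY M ^ d) fun m hm => by
        have h1 := mY_pow_mem hm d
        rw [add_sub_cancel_right] at h1
        refine mem_iotaW_right.2 ⟨Submodule.sub_mem _ (mY_mem (mX_mem hm))
          (Submodule.smul_mem _ _ hm), mY_mem h1, ?_⟩
        change (mY M ^ d) (mY M (mX M m) - (d + 1 : k) • m) = mX M (mY M ((mY M ^ d) m))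
        rw [map_sub, map_smul, mY_pow_z, mX_mY]
        module
    refine ⟨g, fun d' hd' => by omega, fun d' hd' m hm => ?_⟩
    obtain rfl : d' = d := by omega
    exact hg m hm

theorem exists_eta_snd (j n : ℤ) (M : Gr k) : ∃ f : M →ₗ[k] iotaObj j M,
    (∀ d : ℕ, n = j - d → ∀ m ∈ M.deg n, f m ∈ (iotaObj j M).deg (j + 1) ∧
      fstAt j M (j + 1) (f m) = mX M ((mX M ^ d) m) ∧ sndAt j M (j + 1) (f m) = (mX M ^ d) m) ∧
    ∀ d : ℕ, n = j + 1 + d → ∀ m ∈ M.deg n, f m ∈ (iotaObj j M).deg j ∧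
      fstAt j M j (f m) = mY M ((mY M ^ d) m) ∧ sndAt j M j (f m) = (mY M ^ d) m := by
  rcases eq_sub_or_eq_add n j with ⟨d, rfl⟩ | ⟨d, rfl⟩
  · obtain ⟨g, hg⟩ := exists_linToIota (L := M) (M := M) (j := j) (j - d) (j + 1)
      (mX M ∘ₗ mX M ^ d) (mX M ^ d) fun m hm => by
        have h1 := mX_pow_mem hm d
        rw [sub_add_cancel] at h1
        exact mem_iotaW_succ.2 ⟨mX_mem h1, h1, rfl⟩
    refine ⟨g, fun d' hd' m hm => ?_, fun d' hd' => by omega⟩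
    obtain rfl : d' = d := by omega
    exact hg m hm
  · obtain ⟨g, hg⟩ := exists_linToIota (L := M) (M := M) (j := j) (j + 1 + d) j
      (mY M ∘ₗ mY M ^ d) (mY M ^ d) fun m hm => by
        have h1 := mY_pow_mem hm d
        rw [add_sub_cancel_right] at h1
        exact mem_iotaW_self.2 ⟨mY_mem h1, h1, rfl⟩
    refine ⟨g, fun d' hd' => by omega, fun d' hd' m hm => ?_⟩
    obtain rfl : d' = d := by omega
    exact hg m hm

end Weyl

/-! ### The modification is an involution -/

namespace Weyl

open MulOpposite Polynomial

variable {k : Type u} [Field k]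

/-- The natural morphism from a module to its double modification. -/
theorem exists_eta (j : ℤ) (M : Gr k) : ∃ F : M ⟶ iotaObj j (iotaObj j M),
    (∀ d : ℕ, ∀ m ∈ M.deg (j - d),
      fstAt j M (j - d) (fstAt j _ (j - d) (F.1 m)) = mY M (mX M m) + (d : k) • m ∧
      sndAt j M (j - d) (fstAt j _ (j - d) (F.1 m)) = mX M ((mX M ^ d) m) ∧
      fstAt j M (j + 1) (sndAt j _ (j - d) (F.1 m)) = mX M ((mX M ^ d) m) ∧
      sndAt j M (j + 1) (sndAt j _ (j - d) (F.1 m)) = (mX M ^ d) m) ∧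
    ∀ d : ℕ, ∀ m ∈ M.deg (j + 1 + d),
      fstAt j M (j + 1 + d) (fstAt j _ (j + 1 + d) (F.1 m)) = mY M (mX M m) - (d + 1 : k) • m ∧
      sndAt j M (j + 1 + d) (fstAt j _ (j + 1 + d) (F.1 m)) = mY M ((mY M ^ d) m) ∧
      fstAt j M j (sndAt j _ (j + 1 + d) (F.1 m)) = mY M ((mY M ^ d) m) ∧
      sndAt j M j (sndAt j _ (j + 1 + d) (F.1 m)) = (mY M ^ d) m := by
  choose f hfl hfr using fun n => exists_eta_fst j n M
  choose g hgl hgr using fun n => exists_eta_snd j n M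
  have hfdeg : ∀ n, ∀ m ∈ M.deg n, f n m ∈ (iotaObj j M).deg n := fun n m hm => by
    rcases eq_sub_or_eq_add n j with ⟨d, hd⟩ | ⟨d, hd⟩
    exacts [(hfl n d hd m hm).1, (hfr n d hd m hm).1]
  suffices h : ∃ F : M ⟶ iotaObj j (iotaObj j M), ∀ n, ∀ m ∈ M.deg n,
      fstAt j _ n (F.1 m) = f n m ∧ sndAt j _ n (F.1 m) = g n m by
    obtain ⟨F, hF⟩ := h
    refine ⟨F, fun d m hm => ?_, fun d m hm => ?_⟩
    · obtain ⟨-, h1, h2⟩ := hfl _ d rfl m hm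
      obtain ⟨-, h3, h4⟩ := hgl _ d rfl m hm
      rw [(hF _ m hm).1, (hF _ m hm).2]
      exact ⟨h1, h2, h3, h4⟩
    · obtain ⟨-, h1, h2⟩ := hfr _ d rfl m hm
      obtain ⟨-, h3, h4⟩ := hgr _ d rfl m hm
      rw [(hF _ m hm).1, (hF _ m hm).2]
      exact ⟨h1, h2, h3, h4⟩
  refine exists_homToIota f g ?_ ?_ ?_ ?_ ?_
  · intro n m hm
    rcases eq_sub_or_eq_add n j with ⟨d, rfl⟩ | ⟨d, rfl⟩
    · obtain ⟨h0, h1, h2⟩ := hfl _ d rfl m hm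
      obtain ⟨h0', h3, h4⟩ := hgl _ d rfl m hm
      refine mem_iotaW_left.2 ⟨h0, h0', ?_⟩
      have h5 := mX_pow_mem h0 d
      have h6 := fstAt_mX_pow (j - d) d (f (j - d) m)
      rw [sub_add_cancel] at h5 h6
      refine iota_ext h5 (mY_mem h0') ?_ ?_
      · rw [h6, h1, fstAt_mY, h3, map_add, map_smul, mX_pow_z, sub_add_cancel]
      · rw [sndAt_mX_pow, h2, sndAt_mY, iotaY_self, h4]
    · obtain ⟨h0, h1, h2⟩ := hfr _ d rfl m hm
      obtain ⟨h0', h3, h4⟩ := hgr _ d rfl m hm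
      refine mem_iotaW_right.2 ⟨h0, h0', ?_⟩
      have h5 := mY_pow_mem h0 d
      have h6 := fstAt_mY_pow (j + 1 + d) d (f (j + 1 + d) m)
      rw [add_sub_cancel_right] at h5 h6
      refine iota_ext h5 (mX_mem h0') ?_ ?_
      · rw [h6, h1, fstAt_mX, h3, map_sub, map_smul, mY_pow_z, mX_mY]
        module
      · rw [sndAt_mY_pow, h2, sndAt_mX, iotaX_self, h4]
  · intro n m hm
    have hm' := mX_mem hm
    -- Away from n = j one family of formulas is compared with itself for neighbouring exponents; at
    -- n = j the two families meet, both with d = 0.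
    refine iota_ext (hfdeg _ _ hm') (mX_mem (hfdeg _ _ hm)) ?_ ?_ <;>
    rcases eq_sub_or_eq_or_eq_add n j with ⟨d, hd⟩ | hd | ⟨d, hd⟩
    · rw [(hfl _ d (by omega) _ hm').2.1, fstAt_mX, (hfl _ (d + 1) (by omega) _ hm).2.1, map_add,
        map_smul, mX_z]
      push_cast
      module
    · rw [(hfr _ 0 (by omega) _ hm').2.1, fstAt_mX, (hfl _ 0 (by omega) _ hm).2.1, map_add,
        map_smul, mX_z]
      push_cast
      module
    · rw [(hfr _ (d + 1) (by omega) _ hm').2.1, fstAt_mX, (hfr _ d (by omega) _ hm).2.1, map_sub,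
        map_smul, mX_z]
      push_cast
      module
    · rw [(hfl _ d (by omega) _ hm').2.2, sndAt_mX, (hfl _ (d + 1) (by omega) _ hm).2.2,
        iotaX_lt _ _ (by omega), pow_succ, Module.End.mul_apply]
    · rw [(hfr _ 0 (by omega) _ hm').2.2, sndAt_mX, (hfl _ 0 (by omega) _ hm).2.2, hd, iotaX_self]
      simp
    · rw [(hfr _ (d + 1) (by omega) _ hm').2.2, sndAt_mX, (hfr _ d (by omega) _ hm).2.2,
        iotaX_gt _ _ (by omega), ← Module.End.mul_apply (mY M) (mY M ^ d), ← pow_succ',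
        ← Module.End.mul_apply (mY M), ← pow_succ', pow_succ, Module.End.mul_apply, mY_pow_z, hd]
      push_cast
      module
  · intro n m hm
    have hm' := mY_mem hm
    refine iota_ext (hfdeg _ _ hm') (mY_mem (hfdeg _ _ hm)) ?_ ?_ <;>
    rcases eq_sub_or_eq_or_eq_add n j with ⟨d, hd⟩ | hd | ⟨d, hd⟩
    · rw [(hfl _ (d + 1) (by omega) _ hm').2.1, fstAt_mY, (hfl _ d (by omega) _ hm).2.1, map_add,
        map_smul, mY_z]
      push_cast
      module
    · rw [(hfl _ 0 (by omega) _ hm').2.1, fstAt_mY, (hfr _ 0 (by omega) _ hm).2.1, map_sub,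
        map_smul, mY_z]
      push_cast
      module
    · rw [(hfr _ d (by omega) _ hm').2.1, fstAt_mY, (hfr _ (d + 1) (by omega) _ hm).2.1, map_sub,
        map_smul, mY_z]
      push_cast
      module
    · rw [(hfl _ (d + 1) (by omega) _ hm').2.2, sndAt_mY, (hfl _ d (by omega) _ hm).2.2,
        iotaY_lt _ _ (by omega), ← Module.End.mul_apply (mX M) (mX M ^ d), ← pow_succ',
        ← Module.End.mul_apply (mX M), ← pow_succ', pow_succ, Module.End.mul_apply, mX_mY, map_sub,
        mX_pow_z, hd]
      push_cast
      module
    · rw [(hfl _ 0 (by omega) _ hm').2.2, sndAt_mY, (hfr _ 0 (by omega) _ hm).2.2, hd, iotaY_self]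
      simp
    · rw [(hfr _ d (by omega) _ hm').2.2, sndAt_mY, (hfr _ (d + 1) (by omega) _ hm).2.2,
        iotaY_gt _ _ (by omega), pow_succ, Module.End.mul_apply]
  · intro n m hm
    have hm' := mX_mem hm
    rcases eq_sub_or_eq_or_eq_add n j with ⟨d, hd⟩ | hd | ⟨d, hd⟩
    · obtain ⟨h0, h1, h2⟩ := hgl _ d (by omega) _ hm'
      obtain ⟨h0', h3, h4⟩ := hgl _ (d + 1) (by omega) _ hm
      rw [iotaX_lt _ _ (by omega)]
      refine iota_ext h0 h0' ?_ ?_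
      · rw [h1, h3, pow_succ, Module.End.mul_apply]
      · rw [h2, h4, pow_succ, Module.End.mul_apply]
    · obtain ⟨h0, h1, h2⟩ := hgr _ 0 (by omega) _ hm'
      obtain ⟨h0', h3, h4⟩ := hgl _ 0 (by omega) _ hm
      rw [hd] at *
      rw [iotaX_self]
      refine iota_ext h0 (mY_mem h0') ?_ ?_
      · rw [h1, fstAt_mY, h3]; simp
      · rw [h2, sndAt_mY, iotaY_self, h4]; simp
    · obtain ⟨h0, h1, h2⟩ := hgr _ (d + 1) (by omega) _ hm'
      obtain ⟨h0', h3, h4⟩ := hgr _ d (by omega) _ hm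
      rw [iotaX_gt _ _ (by omega)]
      refine iota_ext h0 (Submodule.add_mem _ (mY_mem (mX_mem h0')) (Submodule.smul_mem _ _ h0'))
        ?_ ?_
      · rw [h1, map_add, map_smul, fstAt_mY, fstAt_mX, h3,
          ← Module.End.mul_apply (mY M) (mY M ^ d), ← pow_succ',
          ← Module.End.mul_apply (mY M), ← pow_succ', pow_succ, Module.End.mul_apply, mY_pow_z, hd]
        push_cast
        module
      · rw [h2, map_add, map_smul, sndAt_mY, sndAt_mX, iotaY_self, iotaX_self, h4, pow_succ,
          Module.End.mul_apply, mY_pow_z, mX_mY, hd]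
        push_cast
        module
  · intro n m hm
    have hm' := mY_mem hm
    rcases eq_sub_or_eq_or_eq_add n j with ⟨d, hd⟩ | hd | ⟨d, hd⟩
    · obtain ⟨h0, h1, h2⟩ := hgl _ (d + 1) (by omega) _ hm'
      obtain ⟨h0', h3, h4⟩ := hgl _ d (by omega) _ hm
      rw [iotaY_lt _ _ (by omega)]
      refine iota_ext h0 (Submodule.add_mem _ (mY_mem (mX_mem h0')) (Submodule.smul_mem _ _ h0'))
        ?_ ?_
      · rw [h1, map_add, map_smul, fstAt_mY, fstAt_mX, h3,
          ← Module.End.mul_apply (mX M) (mX M ^ d), ← pow_succ',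
          ← Module.End.mul_apply (mX M), ← pow_succ', pow_succ, Module.End.mul_apply, mX_mY,
          map_sub, mX_pow_z, hd]
        push_cast
        module
      · rw [h2, map_add, map_smul, sndAt_mY, sndAt_mX, iotaY_gt _ _ (by omega),
          iotaX_gt _ _ (by omega), h4, pow_succ, Module.End.mul_apply, mX_mY, map_sub, mX_pow_z, hd]
        push_cast
        module
    · obtain ⟨h0, h1, h2⟩ := hgl _ 0 (by omega) _ hm'
      obtain ⟨h0', h3, h4⟩ := hgr _ 0 (by omega) _ hm
      rw [hd] at *
      rw [iotaY_self]
      refine iota_ext h0 (mX_mem h0') ?_ ?_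
      · rw [h1, fstAt_mX, h3]; simp
      · rw [h2, sndAt_mX, iotaX_self, h4]; simp
    · obtain ⟨h0, h1, h2⟩ := hgr _ d (by omega) _ hm'
      obtain ⟨h0', h3, h4⟩ := hgr _ (d + 1) (by omega) _ hm
      rw [iotaY_gt _ _ (by omega)]
      refine iota_ext h0 h0' ?_ ?_
      · rw [h1, h3, pow_succ, Module.End.mul_apply]
      · rw [h2, h4, pow_succ, Module.End.mul_apply]

/-- The natural morphism from a module to its double modification. -/
noncomputable def eta (j : ℤ) (M : Gr k) : M ⟶ iotaObj j (iotaObj j M) := (exists_eta j M).choose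

theorem eta_left {j : ℤ} {M : Gr k} {d : ℕ} {m : M} (hm : m ∈ M.deg (j - d)) :
    fstAt j M (j - d) (fstAt j _ (j - d) ((eta j M).1 m)) = mY M (mX M m) + (d : k) • m ∧
      sndAt j M (j - d) (fstAt j _ (j - d) ((eta j M).1 m)) = mX M ((mX M ^ d) m) ∧
      fstAt j M (j + 1) (sndAt j _ (j - d) ((eta j M).1 m)) = mX M ((mX M ^ d) m) ∧
      sndAt j M (j + 1) (sndAt j _ (j - d) ((eta j M).1 m)) = (mX M ^ d) m :=
  (exists_eta j M).choose_spec.1 d m hm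

theorem eta_right {j : ℤ} {M : Gr k} {d : ℕ} {m : M} (hm : m ∈ M.deg (j + 1 + d)) :
    fstAt j M (j + 1 + d) (fstAt j _ (j + 1 + d) ((eta j M).1 m)) =
        mY M (mX M m) - (d + 1 : k) • m ∧
      sndAt j M (j + 1 + d) (fstAt j _ (j + 1 + d) ((eta j M).1 m)) = mY M ((mY M ^ d) m) ∧
      fstAt j M j (sndAt j _ (j + 1 + d) ((eta j M).1 m)) = mY M ((mY M ^ d) m) ∧
      sndAt j M j (sndAt j _ (j + 1 + d) ((eta j M).1 m)) = (mY M ^ d) m :=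
  (exists_eta j M).choose_spec.2 d m hm

theorem iota_iota_ext_left {j : ℤ} {M : Gr k} {d : ℕ} {p q : iotaObj j (iotaObj j M)}
    (hp : p ∈ (iotaObj j (iotaObj j M)).deg (j - d))
    (hq : q ∈ (iotaObj j (iotaObj j M)).deg (j - d))
    (h1 : fstAt j M (j - d) (fstAt j _ (j - d) p) = fstAt j M (j - d) (fstAt j _ (j - d) q))
    (h2 : sndAt j M (j - d) (fstAt j _ (j - d) p) = sndAt j M (j - d) (fstAt j _ (j - d) q))
    (h3 : fstAt j M (j + 1) (sndAt j _ (j - d) p) = fstAt j M (j + 1) (sndAt j _ (j - d) q))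
    (h4 : sndAt j M (j + 1) (sndAt j _ (j - d) p) = sndAt j M (j + 1) (sndAt j _ (j - d) q)) :
    p = q :=
  have hp' := mem_iotaW_left.1 (mem_iotaW (j - d) p)
  have hq' := mem_iotaW_left.1 (mem_iotaW (j - d) q)
  iota_ext hp hq (iota_ext hp'.1 hq'.1 h1 h2) (iota_ext hp'.2.1 hq'.2.1 h3 h4)

theorem iota_iota_ext_right {j : ℤ} {M : Gr k} {d : ℕ} {p q : iotaObj j (iotaObj j M)}
    (hp : p ∈ (iotaObj j (iotaObj j M)).deg (j + 1 + d))
    (hq : q ∈ (iotaObj j (iotaObj j M)).deg (j + 1 + d))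
    (h1 : fstAt j M (j + 1 + d) (fstAt j _ (j + 1 + d) p) =
      fstAt j M (j + 1 + d) (fstAt j _ (j + 1 + d) q))
    (h2 : sndAt j M (j + 1 + d) (fstAt j _ (j + 1 + d) p) =
      sndAt j M (j + 1 + d) (fstAt j _ (j + 1 + d) q))
    (h3 : fstAt j M j (sndAt j _ (j + 1 + d) p) = fstAt j M j (sndAt j _ (j + 1 + d) q))
    (h4 : sndAt j M j (sndAt j _ (j + 1 + d) p) = sndAt j M j (sndAt j _ (j + 1 + d) q)) :
    p = q :=
  have hp' := mem_iotaW_right.1 (mem_iotaW (j + 1 + d) p)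
  have hq' := mem_iotaW_right.1 (mem_iotaW (j + 1 + d) q)
  iota_ext hp hq (iota_ext hp'.1 hq'.1 h1 h2) (iota_ext hp'.2.1 hq'.2.1 h3 h4)

theorem eta_naturality (j : ℤ) {M N : Gr k} (f : M ⟶ N) :
    f ≫ eta j N = eta j M ≫ iotaMap j (iotaMap j f) := by
  refine GrMod.hom_ext_homog fun n m hm => ?_
  have hfm := f.2 _ _ hm
  have hem := (eta j M).2 _ _ hm
  rw [GrMod.comp_apply, GrMod.comp_apply]
  rcases eq_sub_or_eq_add n j with ⟨d, rfl⟩ | ⟨d, rfl⟩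
  · obtain ⟨h1, h2, h3, h4⟩ := eta_left hm
    obtain ⟨g1, g2, g3, g4⟩ := eta_left hfm
    have hw := mem_iotaW_left.1 (mem_iotaW (j - d) ((eta j M).1 m))
    refine iota_iota_ext_left ((eta j N).2 _ _ hfm) ((iotaMap j (iotaMap j f)).2 _ _ hem)
      ?_ ?_ ?_ ?_
    · rw [g1, fstAt_iotaMap _ hem, fstAt_iotaMap _ hw.1, h1, map_add, hom_mY, hom_mX,
        GrMod.hom_smul]
    · rw [g2, fstAt_iotaMap _ hem, sndAt_iotaMap _ hw.1, h2, hom_mX, hom_mX_pow]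
    · rw [g3, sndAt_iotaMap _ hem, fstAt_iotaMap _ hw.2.1, h3, hom_mX, hom_mX_pow]
    · rw [g4, sndAt_iotaMap _ hem, sndAt_iotaMap _ hw.2.1, h4, hom_mX_pow]
  · obtain ⟨h1, h2, h3, h4⟩ := eta_right hm
    obtain ⟨g1, g2, g3, g4⟩ := eta_right hfm
    have hw := mem_iotaW_right.1 (mem_iotaW (j + 1 + d) ((eta j M).1 m))
    refine iota_iota_ext_right ((eta j N).2 _ _ hfm) ((iotaMap j (iotaMap j f)).2 _ _ hem)
      ?_ ?_ ?_ ?_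
    · rw [g1, fstAt_iotaMap _ hem, fstAt_iotaMap _ hw.1, h1, map_sub, hom_mY, hom_mX,
        GrMod.hom_smul]
    · rw [g2, fstAt_iotaMap _ hem, sndAt_iotaMap _ hw.1, h2, hom_mY, hom_mY_pow]
    · rw [g3, sndAt_iotaMap _ hem, fstAt_iotaMap _ hw.2.1, h3, hom_mY, hom_mY_pow]
    · rw [g4, sndAt_iotaMap _ hem, sndAt_iotaMap _ hw.2.1, h4, hom_mY_pow]

section CharZero

variable [CharZero k]

/-- If the image of m vanishes, its extreme coordinates give m(z + d) = 0 and m x^d = 0 below the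
gap; with z = −d on m, the eigenvalues −d, …, −1 met along the powers of x are all nonzero. Above
the gap the argument is symmetric. -/
theorem eta_injective (j : ℤ) (M : Gr k) : Function.Injective (eta j M).1 := by
  refine GrMod.injective_of_homog _ fun n m hm h0 => ?_
  rcases eq_sub_or_eq_add n j with ⟨d, rfl⟩ | ⟨d, rfl⟩
  · obtain ⟨h1, -, -, h4⟩ := eta_left hm
    rw [h0, map_zero, map_zero] at h1 h4
    refine eq_zero_of_mX_pow (c := -(d : k)) ?_ d (fun i hi => ?_) h4.symm
    · rw [neg_smul, eq_neg_iff_add_eq_zero, ← h1]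
    · rw [neg_add_eq_sub, sub_ne_zero]; exact_mod_cast hi.ne
  · obtain ⟨h1, -, -, h4⟩ := eta_right hm
    rw [h0, map_zero, map_zero] at h1 h4
    refine eq_zero_of_mY_pow (c := (d : k) + 1) (sub_eq_zero.1 h1.symm) d (fun i hi => ?_) h4.symm
    rw [sub_ne_zero]; exact_mod_cast (by omega : d + 1 ≠ i + 1)

theorem eta_surjective (j : ℤ) (M : Gr k) : Function.Surjective (eta j M).1 := by
  refine GrMod.surjective_of_homog _ fun n p hp => ?_
  rcases eq_sub_or_eq_add n j with ⟨d, rfl⟩ | ⟨d, rfl⟩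
  · obtain ⟨h1, h2, h3⟩ := mem_iotaW_left.1 (mem_iotaW (j - d) p)
    obtain ⟨a1, a2, a3⟩ := mem_iotaW_left.1 (mem_iotaW (j - d) (fstAt j _ (j - d) p))
    obtain ⟨b1, b2, b3⟩ := mem_iotaW_succ.1 (mem_iotaW (j + 1) (sndAt j _ (j - d) p))
    simp only at h3 a3 b3
    have c1 := congrArg (fstAt j M j) h3
    have c2 := congrArg (sndAt j M j) h3
    have c3 := fstAt_mX_pow (j - d) d (fstAt j _ (j - d) p)
    rw [sub_add_cancel] at c3
    rw [c3, fstAt_mY, b3] at c1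
    rw [sndAt_mX_pow, sndAt_mY, iotaY_self] at c2
    -- Of the four coordinates only the two extreme ones are free: `b3` and `c2` express the middle
    -- ones through the innermost, and `c1` is the remaining equation, which is the hypothesis of
    -- `exists_left`.
    obtain ⟨w, hw, hw1, hw2⟩ := exists_left rfl a1 b2 c1
    obtain ⟨e1, e2, e3, e4⟩ := eta_left hw
    refine ⟨w, iota_iota_ext_left ((eta j M).2 _ _ hw) hp ?_ ?_ ?_ ?_⟩
    · rw [e1, hw1]
    · rw [e2, hw2, c2]
    · rw [e3, hw2, b3]
    · rw [e4, hw2]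
  · obtain ⟨h1, h2, h3⟩ := mem_iotaW_right.1 (mem_iotaW (j + 1 + d) p)
    obtain ⟨a1, a2, a3⟩ := mem_iotaW_right.1 (mem_iotaW (j + 1 + d) (fstAt j _ (j + 1 + d) p))
    obtain ⟨b1, b2, b3⟩ := mem_iotaW_self.1 (mem_iotaW j (sndAt j _ (j + 1 + d) p))
    simp only at h3 a3 b3
    have c1 := congrArg (fstAt j M (j + 1)) h3
    have c2 := congrArg (sndAt j M (j + 1)) h3
    have c3 := fstAt_mY_pow (j + 1 + d) d (fstAt j _ (j + 1 + d) p)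
    rw [add_sub_cancel_right] at c3
    rw [c3, fstAt_mX, b3] at c1
    rw [sndAt_mY_pow, sndAt_mX, iotaX_self] at c2
    have b2' : sndAt j M j (sndAt j _ (j + 1 + d) p) ∈ M.deg (j + 1) := b2
    obtain ⟨w, hw, hw1, hw2⟩ := exists_right rfl a1 b2' c1
    obtain ⟨e1, e2, e3, e4⟩ := eta_right hw
    refine ⟨w, iota_iota_ext_right ((eta j M).2 _ _ hw) hp ?_ ?_ ?_ ?_⟩
    · rw [e1, sub_eq_add_neg, ← neg_smul]; exact hw1
    · rw [e2, hw2, c2]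
    · rw [e3, hw2, b3]
    · rw [e4, hw2]

variable (k) in
/-- The modification is an involution. -/
noncomputable def etaIso (j : ℤ) : 𝟭 (Gr k) ≅ iotaFunctor k j ⋙ iotaFunctor k j :=
  NatIso.ofComponents
    (fun M => GrMod.isoOfBijective (eta j M) (eta_injective j M) (eta_surjective j M))
    (fun f => eta_naturality j f)

variable (k) in
/-- The modification as an autoequivalence. -/
noncomputable def iotaEquiv (j : ℤ) : LinAutoequiv k (Gr k) :=
  let e := CategoryTheory.Equivalence.mk (iotaFunctor k j) (iotaFunctor k j) (etaIso k j)
    (etaIso k j).symm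
  haveI : e.functor.Additive := inferInstanceAs (iotaFunctor k j).Additive
  haveI : e.functor.Linear k := inferInstanceAs ((iotaFunctor k j).Linear k)
  ⟨e⟩

end CharZero

end Weyl

/-! ### The effect of the modification on simple modules -/

namespace Weyl

open MulOpposite

variable {k : Type u} [Field k]

theorem exists_fstMap (j : ℤ) (M : Gr k) : ∃ F : iotaObj j M ⟶ M,
    ∀ n, ∀ p ∈ (iotaObj j M).deg n, F.1 p = fstAt j M n p :=
  exists_hom (fstAt j M) (fun n p _ => (mem_iotaW n p).1) (fun n p _ => fstAt_mX n p)
    (fun n p _ => fstAt_mY n p)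

/-- The natural morphism from the modification to the module. -/
noncomputable def fstMap (j : ℤ) (M : Gr k) : iotaObj j M ⟶ M := (exists_fstMap j M).choose

theorem fstMap_apply {j : ℤ} {M : Gr k} {n : ℤ} {p : iotaObj j M} (hp : p ∈ (iotaObj j M).deg n) :
    (fstMap j M).1 p = fstAt j M n p := (exists_fstMap j M).choose_spec n p hp

theorem fstMap_naturality (j : ℤ) {M N : Gr k} (f : M ⟶ N) :
    iotaMap j f ≫ fstMap j N = fstMap j M ≫ f :=
  GrMod.hom_ext_homog fun n m hm => by
    rw [GrMod.comp_apply, GrMod.comp_apply, fstMap_apply ((iotaMap j f).2 _ _ hm),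
      fstAt_iotaMap _ hm, fstMap_apply hm]

/-- When x and y are injective across the gap, the witness is determined by the first coordinate. -/
theorem fstMap_injective {j : ℤ} {M : Gr k} (hx : ∀ m ∈ M.deg j, mX M m = 0 → m = 0)
    (hy : ∀ m ∈ M.deg (j + 1), mY M m = 0 → m = 0) : Function.Injective (fstMap j M).1 := by
  refine GrMod.injective_of_homog _ fun n p hp h0 => ?_
  rw [fstMap_apply hp] at h0
  refine iota_ext hp (Submodule.zero_mem _) (by rw [h0, map_zero]) ?_
  rw [map_zero]
  rcases eq_sub_or_eq_add n j with ⟨d, rfl⟩ | ⟨d, rfl⟩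
  · obtain ⟨-, h2, h3⟩ := mem_iotaW_left.1 (mem_iotaW (j - d) p)
    simp only [h0, map_zero] at h3
    exact hy _ h2 h3.symm
  · obtain ⟨-, h2, h3⟩ := mem_iotaW_right.1 (mem_iotaW (j + 1 + d) p)
    simp only [h0, map_zero] at h3
    exact hx _ h2 h3.symm

/-- The constants in `iotaX` and `iotaY` account for the difference between the degree of the
witness and that of the pair, so z has the same scalar on both coordinates. -/
theorem ScalarZ.iotaObj {M : Gr k} {c : k} (h : ScalarZ M c) (j : ℤ) :
    ScalarZ (iotaObj j M) c := by
  intro n p hp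
  refine iota_ext (mY_mem (mX_mem hp)) (Submodule.smul_mem _ _ hp) ?_ ?_
  · rw [fstAt_mY, fstAt_mX, h n _ (mem_iotaW n p).1, map_smul]
  · rw [sndAt_mY, sndAt_mX, map_smul]
    rcases eq_sub_or_eq_or_eq_add n j with ⟨d, rfl⟩ | rfl | ⟨d, rfl⟩
    · have h2 := (mem_iotaW_left.1 (mem_iotaW (j - ((d + 1 : ℕ) : ℤ)) p)).2.1
      rw [iotaX_lt _ _ (by omega), iotaY_lt _ _ (by omega), h _ _ h2]
      push_cast
      module
    · have h2 := (mem_iotaW_self.1 (mem_iotaW n p)).2.1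
      rw [iotaX_self, iotaY_self, h.mX_mY h2]
      push_cast
      module
    · have h2 := (mem_iotaW_right.1 (mem_iotaW (j + 1 + d) p)).2.1
      rw [iotaX_gt _ _ (by omega), iotaY_gt _ _ (by omega), h _ _ h2]
      push_cast
      module

/-- Crossing the gap and returning multiplies by j + c on either side. If this is invertible, every
element has exactly one witness, obtained by dividing by j + c. -/
theorem ScalarZ.nonempty_iotaObj_iso {M : Gr k} {c : k} (h : ScalarZ M c) {j : ℤ}
    (hj : (j : k) + c ≠ 0) : Nonempty (Weyl.iotaObj j M ≅ M) := by
  have hj' : ((j + 1 : ℤ) : k) - 1 + c ≠ 0 := by push_cast; rwa [add_sub_cancel_right]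
  refine ⟨GrMod.isoOfBijective (fstMap j M)
    (fstMap_injective (fun m hm => h.eq_zero_of_mX hm hj) (fun m hm => h.eq_zero_of_mY hm hj'))
    (GrMod.surjective_of_homog _ fun n m hm => ?_)⟩
  rcases eq_sub_or_eq_add n j with ⟨d, rfl⟩ | ⟨d, rfl⟩
  · have h1 := mX_pow_mem hm d
    rw [sub_add_cancel] at h1
    refine ⟨iotaElt (j - d) m (((j : k) + c)⁻¹ • mX M ((mX M ^ d) m)) (mem_iotaW_left.2
      ⟨hm, Submodule.smul_mem _ _ (mX_mem h1), ?_⟩), ?_⟩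
    · rw [map_smul, h _ _ h1, inv_smul_smul₀ hj]
    · rw [fstMap_apply (iotaElt_mem _ _ _ _), fstAt_iotaElt]
  · have h1 := mY_pow_mem hm d
    rw [add_sub_cancel_right] at h1
    refine ⟨iotaElt (j + 1 + d) m (((j : k) + c)⁻¹ • mY M ((mY M ^ d) m)) (mem_iotaW_right.2
      ⟨hm, Submodule.smul_mem _ _ (mY_mem h1), ?_⟩), ?_⟩
    · rw [map_smul, h.mX_mY h1, show ((j + 1 : ℤ) : k) - 1 + c = j + c by push_cast; ring,
        inv_smul_smul₀ hj]
    · rw [fstMap_apply (iotaElt_mem _ _ _ _), fstAt_iotaElt]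

section CharZero

variable [CharZero k]

/-- Reflection at the gap: in degree j the modification is X⟨j⟩ in degree j+1, which is zero, and in
degree j+1 it is X⟨j⟩ in degree j, which is a line. This data and the scalars of z characterise
Y⟨j⟩. -/
theorem nonempty_iota_xMod (j : ℤ) : Nonempty (iotaObj j (xMod k j) ≅ yMod k j) := by
  have hW := xSeq_W (k := k) (le_refl j) 1
  set v : xMod k j := (xSeq k j).elt j 1 hW with hv
  have hvd : v ∈ (xMod k j).deg j := Seq.elt_mem _ _ _ _
  have hxv : mX _ v = 0 := xMod_eq_zero (lt_add_one j) (mX_mem hvd)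
  have hv0 : v ≠ 0 := fun h0 => by
    have := (xSeq k j).val_elt j 1 hW
    rw [← hv, h0, map_zero] at this
    exact zero_ne_one this
  have hmem : ((0 : xMod k j), v) ∈ iotaW (xMod k j) j (j + 1) :=
    mem_iotaW_succ.2 ⟨Submodule.zero_mem _, hvd, hxv.symm⟩
  refine nonempty_iso_yMod ((xMod_scalarZ j).iotaObj j) ?_ (v := iotaElt (j + 1) 0 v hmem)
    (iotaElt_mem _ _ _ _) ?_ ?_
  · intro p hp
    obtain ⟨-, h2, h3⟩ := mem_iotaW_self.1 (mem_iotaW j p)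
    have h4 := xMod_eq_zero (lt_add_one j) h2
    simp only at h3 h4
    refine iota_ext hp (Submodule.zero_mem _) ?_ ?_
    · rw [h3, h4, map_zero, map_zero]
    · rw [h4, map_zero]
  · intro h0
    have := sndAt_iotaElt (j + 1) 0 v hmem
    rw [h0, map_zero] at this
    exact hv0 this.symm
  · intro p hp
    obtain ⟨h1, h2, h3⟩ := mem_iotaW_succ.1 (mem_iotaW (j + 1) p)
    have h4 := xMod_eq_zero (lt_add_one j) h1
    refine ⟨(xSeq k j).val j (sndAt j _ (j + 1) p), iota_ext hp
      (Submodule.smul_mem _ _ (iotaElt_mem _ _ _ _)) ?_ ?_⟩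
    · rw [map_smul, fstAt_iotaElt, smul_zero]; exact h4
    · rw [map_smul, sndAt_iotaElt]
      refine Seq.ext_deg _ h2 (Submodule.smul_mem _ _ hvd) ?_
      rw [map_smul, hv, Seq.val_elt, smul_eq_mul, mul_one]

theorem nonempty_iota_X (j : ℤ) :
    Nonempty ((iotaFunctor k j).obj ((X k).shift j) ≅ (Y k).shift j) := by
  obtain ⟨e⟩ := nonempty_iota_xMod (k := k) j
  exact ⟨(iotaFunctor k j).mapIso (isoX k j) ≪≫ e ≪≫ (isoY k j).symm⟩

theorem nonempty_iota_Y (j : ℤ) :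
    Nonempty ((iotaFunctor k j).obj ((Y k).shift j) ≅ (X k).shift j) := by
  obtain ⟨e⟩ := nonempty_iota_X (k := k) j
  exact ⟨(iotaFunctor k j).mapIso e.symm ≪≫ ((etaIso k j).app _).symm⟩

theorem nonempty_iota_X_of_ne {i j : ℤ} (h : i ≠ j) :
    Nonempty ((iotaFunctor k j).obj ((X k).shift i) ≅ (X k).shift i) :=
  (scalarZ_X i).nonempty_iotaObj_iso (cast_sub_ne h.symm)

theorem nonempty_iota_Y_of_ne {i j : ℤ} (h : i ≠ j) :
    Nonempty ((iotaFunctor k j).obj ((Y k).shift i) ≅ (Y k).shift i) :=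
  (scalarZ_Y i).nonempty_iotaObj_iso (cast_sub_ne h.symm)

theorem numericallyTrivial_iota (j : ℤ) : NumericallyTrivial (iotaFunctor k j) := by
  refine (numericallyTrivial_iff _).2 ⟨fun n => ?_, fun c hc => ?_⟩
  · by_cases h : n = j
    · subst h
      exact Or.inr ⟨nonempty_iota_X n, nonempty_iota_Y n⟩
    · exact Or.inl ⟨nonempty_iota_X_of_ne h, nonempty_iota_Y_of_ne h⟩
  · refine (scalarZ_M c).nonempty_iotaObj_iso fun h => hc ⟨j, ?_⟩
    rwa [← sub_eq_add_neg, sub_eq_zero] at h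

/-! ### Comparison with the reject functor -/

theorem fstMap_mem_reject (j : ℤ) (M : Gr k) (p : iotaObj j M) :
    (fstMap j M).1 p ∈ GrMod.reject (simplePair k j) M := by
  refine GrMod.induction_homog (p := fun p => (fstMap j M).1 p ∈ _) ?_ (fun a b ha hb => ?_)
    (fun n p hp => ?_) p
  · rw [map_zero]; exact Submodule.zero_mem _
  · rw [map_add]; exact Submodule.add_mem _ ha hb
  · rw [fstMap_apply hp]
    rcases eq_sub_or_eq_add n j with ⟨d, rfl⟩ | ⟨d, rfl⟩
    · obtain ⟨h1, h2, h3⟩ := mem_iotaW_left.1 (mem_iotaW (j - d) p)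
      exact (mem_reject_iff_left h1).2 ⟨_, h2, h3⟩
    · obtain ⟨h1, h2, h3⟩ := mem_iotaW_right.1 (mem_iotaW (j + 1 + d) p)
      exact (mem_reject_iff_right h1).2 ⟨_, h2, h3⟩

/-- The natural morphism from the modification to the reject. -/
noncomputable def toReject (j : ℤ) (M : Gr k) :
    iotaObj j M ⟶ (GrMod.rejectFunctor (simplePair k j)).obj M :=
  GrMod.subLift _ (GrMod.isHomog_reject _ M) (fstMap j M) (fstMap_mem_reject j M)

theorem toReject_naturality (j : ℤ) {M N : Gr k} (f : M ⟶ N) :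
    iotaMap j f ≫ toReject j N =
      toReject j M ≫ (GrMod.rejectFunctor (simplePair k j)).map f :=
  GrMod.hom_ext fun m => Subtype.ext (congrArg (fun g => g.1 m) (fstMap_naturality j f))

theorem toReject_injective {j : ℤ} {M : Gr k} (hx : ∀ m ∈ M.deg j, mX M m = 0 → m = 0)
    (hy : ∀ m ∈ M.deg (j + 1), mY M m = 0 → m = 0) : Function.Injective (toReject j M).1 :=
  fun _ _ h => fstMap_injective hx hy (congrArg Subtype.val h)

/-- The descriptions `mem_reject_iff_left` and `mem_reject_iff_right` supply the witness that
completes an element of the reject to a pair. -/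
theorem toReject_surjective (j : ℤ) (M : Gr k) : Function.Surjective (toReject j M).1 := by
  refine GrMod.surjective_of_homog _ fun n m hm => ?_
  have hm' : m.1 ∈ M.deg n := hm
  rcases eq_sub_or_eq_add n j with ⟨d, rfl⟩ | ⟨d, rfl⟩
  · obtain ⟨q, hq, h⟩ := (mem_reject_iff_left hm').1 m.2
    have hp : (m.1, q) ∈ iotaW M j (j - d) := mem_iotaW_left.2 ⟨hm', hq, h⟩
    exact ⟨iotaElt _ _ _ hp, Subtype.ext
      ((fstMap_apply (iotaElt_mem _ _ _ hp)).trans (fstAt_iotaElt _ _ _ hp))⟩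
  · obtain ⟨q, hq, h⟩ := (mem_reject_iff_right hm').1 m.2
    have hp : (m.1, q) ∈ iotaW M j (j + 1 + d) := mem_iotaW_right.2 ⟨hm', hq, h⟩
    exact ⟨iotaElt _ _ _ hp, Subtype.ext
      ((fstMap_apply (iotaElt_mem _ _ _ hp)).trans (fstAt_iotaElt _ _ _ hp))⟩

end CharZero

end Weyl

/-! ### Products, retracts, and generation by shifts of the ring -/

namespace GrMod

section Prod

variable {k R : Type u} [Field k] [Ring R] [Algebra k R] {𝒜 : ℤ → Submodule k R}

/-- The product of two graded modules. -/
noncomputable def prod (M N : GrMod 𝒜) : GrMod 𝒜 where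
  carrier := M × N
  deg i := (M.deg i).prod (N.deg i)
  isInternal := by
    classical
    refine isInternal_of_proj _ (fun i => (M.proj i).prodMap (N.proj i)) ?_ ?_ ?_
    · rintro i ⟨a, b⟩ ⟨ha, hb⟩
      exact Prod.ext (M.proj_same ha) (N.proj_same hb)
    · rintro i j ⟨a, b⟩ ⟨ha, hb⟩ hij
      exact Prod.ext (M.proj_ne ha hij) (N.proj_ne hb hij)
    · rintro ⟨a, b⟩
      obtain ⟨s, hs⟩ := M.sum_proj a
      obtain ⟨t, ht⟩ := N.sum_proj b
      refine ⟨s ∪ t, fun i => (if i ∈ s then M.proj i a else 0, if i ∈ t then N.proj i b else 0),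
        fun i => ⟨?_, ?_⟩, Prod.ext ?_ ?_⟩
      · dsimp only; split_ifs
        exacts [M.proj_mem i a, Submodule.zero_mem _]
      · dsimp only; split_ifs
        exacts [N.proj_mem i b, Submodule.zero_mem _]
      · rw [Prod.fst_sum, Finset.sum_ite_mem, Finset.union_inter_cancel_left, hs]
      · rw [Prod.snd_sum, Finset.sum_ite_mem, Finset.union_inter_cancel_right, ht]
  smul_mem := fun hm ha => ⟨M.smul_mem hm.1 ha, N.smul_mem hm.2 ha⟩

variable {M N L : GrMod 𝒜}

/-- The first projection. -/
noncomputable def fst (M N : GrMod 𝒜) : M.prod N ⟶ M := ⟨LinearMap.fst Rᵐᵒᵖ M N, fun _ _ h => h.1⟩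

/-- The second projection. -/
noncomputable def snd (M N : GrMod 𝒜) : M.prod N ⟶ N := ⟨LinearMap.snd Rᵐᵒᵖ M N, fun _ _ h => h.2⟩

/-- The morphism into a product. -/
noncomputable def lift (f : L ⟶ M) (g : L ⟶ N) : L ⟶ M.prod N :=
  ⟨LinearMap.prod f.1 g.1, fun i m h => ⟨f.2 i m h, g.2 i m h⟩⟩

/-- The morphism out of a product. -/
noncomputable def desc (f : M ⟶ L) (g : N ⟶ L) : M.prod N ⟶ L := fst M N ≫ f + snd M N ≫ g

@[simp] theorem desc_apply (f : M ⟶ L) (g : N ⟶ L) (m : M.prod N) :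
    (desc f g).1 m = f.1 m.1 + g.1 m.2 := rfl

theorem prod_total (M N : GrMod 𝒜) :
    fst M N ≫ lift (𝟙 M) 0 + snd M N ≫ lift 0 (𝟙 N) = 𝟙 (M.prod N) :=
  hom_ext fun m => Prod.ext (show m.1 + 0 = m.1 from add_zero _) (show 0 + m.2 = m.2 from zero_add _)

/-- The product as a biproduct. -/
noncomputable def prodBicone (M N : GrMod 𝒜) : BinaryBicone M N where
  pt := M.prod N
  fst := fst M N
  snd := snd M N
  inl := lift (𝟙 M) 0
  inr := lift 0 (𝟙 N)

/-- The product is a biproduct. -/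
noncomputable def prodBiconeIsBilimit (M N : GrMod 𝒜) : (prodBicone M N).IsBilimit :=
  isBinaryBilimitOfTotal _ (prod_total M N)

theorem projective_prod (hM : Projective M) (hN : Projective N) : Projective (M.prod N) := by
  constructor
  intro E X f e he
  obtain ⟨a, ha⟩ := hM.factors (lift (𝟙 M) 0 ≫ f) e
  obtain ⟨b, hb⟩ := hN.factors (lift 0 (𝟙 N) ≫ f) e
  refine ⟨desc a b, ?_⟩
  rw [desc, Preadditive.add_comp, Category.assoc, Category.assoc, ha, hb, ← Category.assoc,
    ← Category.assoc, ← Preadditive.add_comp, prod_total, Category.id_comp]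

theorem IsFGProj.prod (hM : IsFGProj M) (hN : IsFGProj N) : IsFGProj (M.prod N) := by
  have := hM.1
  have := hN.1
  exact ⟨inferInstanceAs (Module.Finite Rᵐᵒᵖ (M × N)), projective_prod hM.2 hN.2⟩

/-- A retract of a finitely generated graded projective module. -/
theorem IsFGProj.of_retract {P : GrMod 𝒜} (hP : IsFGProj P) (i : M ⟶ P) (r : P ⟶ M)
    (h : i ≫ r = 𝟙 M) : IsFGProj M := by
  have := hP.1
  refine ⟨Module.Finite.of_surjective r.1 fun m => ⟨i.1 m, ?_⟩, ?_⟩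
  · exact congrArg (fun g => g.1 m) h
  · have := hP.2
    exact Retract.projective ⟨i, r, h⟩ 

theorem IsFGProj.of_iso {P : GrMod 𝒜} (hP : IsFGProj P) (e : P ≅ M) : IsFGProj M :=
  hP.of_retract e.inv e.hom e.inv_hom_id

variable [GradedAlgebra 𝒜]

/-- An induction principle: every finitely generated graded module is a quotient of a module
obtained from the shifts of the ring by taking finite products. -/
theorem exists_surjective {C : GrMod 𝒜 → Prop} (hC : ∀ n, C ((regular 𝒜).shift n))
    (hprod : ∀ M N, C M → C N → C (M.prod N)) (hM : Module.Finite Rᵐᵒᵖ M) :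
    ∃ (L : GrMod 𝒜) (f : L ⟶ M), C L ∧ Function.Surjective f.1 := by
  classical
  obtain ⟨s, hs⟩ := hM.1
  have key : ∀ t : Finset (Σ i, M.deg i), ∃ (L : GrMod 𝒜) (f : L ⟶ M), C L ∧
      ∀ q ∈ t, (q.2 : M) ∈ LinearMap.range f.1 := by
    intro t
    induction t using Finset.induction_on with
    | empty => exact ⟨_, 0, hC 0, by simp⟩
    | insert q t _ ih =>
      obtain ⟨L, f, hL, hf⟩ := ih
      refine ⟨L.prod ((regular 𝒜).shift q.1), desc f (M.ofElem q.1 q.2 q.2.2),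
        hprod _ _ hL (hC _), fun q' hq' => ?_⟩
      rcases Finset.mem_insert.1 hq' with rfl | hq'
      · refine ⟨(0, unit 𝒜 q'.1), ?_⟩
        change f.1 0 + (M.ofElem q'.1 q'.2 q'.2.2).1 (unit 𝒜 q'.1) = _
        rw [map_zero, zero_add, ofElem_unit]
      · obtain ⟨l, hl⟩ := hf q' hq'
        refine ⟨(l, 0), ?_⟩
        change f.1 l + (M.ofElem q.1 q.2 q.2.2).1 0 = _
        rw [map_zero, add_zero, hl]
  -- The generators need not be homogeneous; they are replaced by the finitely many homogeneous
  -- components that they need.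
  choose S hS using M.sum_proj
  obtain ⟨L, f, hL, hf⟩ := key (s.biUnion fun m => (S m).image fun i => ⟨i, M.proj i m, M.proj_mem i m⟩)
  refine ⟨L, f, hL, LinearMap.range_eq_top.1 (eq_top_iff.2 ?_)⟩
  rw [← hs, Submodule.span_le]
  intro m hm
  rw [SetLike.mem_coe, ← hS m]
  refine Submodule.sum_mem _ fun i hi => ?_
  exact hf ⟨i, M.proj i m, M.proj_mem i m⟩ (Finset.mem_biUnion.2 ⟨m, hm, Finset.mem_image_of_mem _ hi⟩)

end Prod

end GrMod

/-! ### Finitely generated projective modules over `k[z]` and their components -/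

namespace Weyl

open MulOpposite Polynomial

variable {k : Type u} [Field k]

theorem exists_mul_aeval {d : ℤ} {a : Weyl k} (ha : a ∈ grading k d) (p : k[X]) :
    ∃ q : k[X], a * aeval (z k) p = aeval (z k) q * a := by
  induction p using Polynomial.induction_on with
  | C c => exact ⟨C c, by rw [aeval_C, Algebra.commutes]⟩
  | add p q hp hq =>
    obtain ⟨p', hp⟩ := hp
    obtain ⟨q', hq⟩ := hq
    exact ⟨p' + q', by rw [map_add, mul_add, hp, hq, map_add, add_mul]⟩
  | monomial n c ih =>
    obtain ⟨q, hq⟩ := ih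
    refine ⟨q * (Polynomial.X + C (d : k)), ?_⟩
    rw [pow_succ, ← mul_assoc (C c), map_mul, aeval_X, ← mul_assoc, hq, mul_assoc, mul_z_of_mem ha,
      ← mul_assoc, map_mul, map_add, aeval_X, aeval_C]

theorem exists_act_aeval_comm (M : Gr k) {d : ℤ} {a : Weyl k} (ha : a ∈ grading k d) (p : k[X]) :
    ∃ q : k[X], ∀ m : M, act M (aeval (z k) p) (act M a m) = act M a (act M (aeval (z k) q) m) := by
  obtain ⟨q, hq⟩ := exists_mul_aeval ha p
  exact ⟨q, fun m => by rw [← act_mul, hq, act_mul]⟩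

theorem hom_act_sum {M N : Gr k} (f : M ⟶ N) {ι : Type*} (s : Finset ι) (a : ι → Weyl k)
    (u : ι → M) : f.1 (∑ i ∈ s, act M (a i) (u i)) = ∑ i ∈ s, act N (a i) (f.1 (u i)) := by
  rw [map_sum]
  exact Finset.sum_congr rfl fun i _ => hom_act f _ _

/-! ### Finiteness conditions -/

/-- Right multiplication by `x` is surjective onto the components of degree greater than `n`. -/
def SurjXFrom (M : Gr k) (n : ℤ) : Prop :=
  ∀ i, n ≤ i → ∀ m ∈ M.deg (i + 1), ∃ m' ∈ M.deg i, mX M m' = m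

/-- Right multiplication by `y` is surjective onto the components of degree less than `n`. -/
def SurjYBelow (M : Gr k) (n : ℤ) : Prop :=
  ∀ i, i < n → ∀ m ∈ M.deg i, ∃ m' ∈ M.deg (i + 1), mY M m' = m

/-- The right multiplications by `x` are eventually surjective. -/
def SurjX (M : Gr k) : Prop :=
  ∃ b : ℤ, SurjXFrom M b

/-- The right multiplications by `y` are eventually surjective. -/
def SurjY (M : Gr k) : Prop :=
  ∃ b : ℤ, SurjYBelow M b

/-- The components are finitely generated over `k[z]`. -/
def FinDeg (M : Gr k) : Prop :=
  ∀ n, ∃ (ι : Type) (_ : Fintype ι) (u : ι → M), (∀ i, u i ∈ M.deg n) ∧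
    ∀ m ∈ M.deg n, ∃ p : ι → k[X], m = ∑ i, act M (aeval (z k) (p i)) (u i)

/-- Nonzero polynomials in `z` act injectively. -/
def TorsionFree (M : Gr k) : Prop :=
  ∀ p : k[X], p ≠ 0 → ∀ n, ∀ m ∈ M.deg n, act M (aeval (z k) p) m = 0 → m = 0

theorem SurjX.of_surjective {M N : Gr k} (h : SurjX M) (f : M ⟶ N)
    (hf : Function.Surjective f.1) : SurjX N := by
  obtain ⟨b, hb⟩ := h
  refine ⟨b, fun n hn m hm => ?_⟩
  obtain ⟨l, hl, rfl⟩ := GrMod.exists_homog_preimage f hf hm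
  obtain ⟨l', hl', rfl⟩ := hb n hn l hl
  exact ⟨f.1 l', f.2 _ _ hl', (hom_mX f _).symm⟩

theorem SurjY.of_surjective {M N : Gr k} (h : SurjY M) (f : M ⟶ N)
    (hf : Function.Surjective f.1) : SurjY N := by
  obtain ⟨b, hb⟩ := h
  refine ⟨b, fun n hn m hm => ?_⟩
  obtain ⟨l, hl, rfl⟩ := GrMod.exists_homog_preimage f hf hm
  obtain ⟨l', hl', rfl⟩ := hb n hn l hl
  exact ⟨f.1 l', f.2 _ _ hl', (hom_mY f _).symm⟩

theorem FinDeg.of_surjective {M N : Gr k} (h : FinDeg M) (f : M ⟶ N)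
    (hf : Function.Surjective f.1) : FinDeg N := by
  intro n
  obtain ⟨ι, _, u, hu, hs⟩ := h n
  refine ⟨ι, inferInstance, fun i => f.1 (u i), fun i => f.2 _ _ (hu i), fun m hm => ?_⟩
  obtain ⟨l, hl, rfl⟩ := GrMod.exists_homog_preimage f hf hm
  obtain ⟨p, rfl⟩ := hs l hl
  exact ⟨p, hom_act_sum f _ _ _⟩

theorem TorsionFree.of_injective {M N : Gr k} (h : TorsionFree N) (f : M ⟶ N)
    (hf : Function.Injective f.1) : TorsionFree M := by
  intro p hp n m hm h0
  apply hf
  rw [map_zero]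
  refine h p hp n _ (f.2 _ _ hm) ?_
  rw [← hom_act, h0, map_zero]

theorem SurjX.prod {M N : Gr k} (hM : SurjX M) (hN : SurjX N) : SurjX (M.prod N) := by
  obtain ⟨a, ha⟩ := hM
  obtain ⟨b, hb⟩ := hN
  refine ⟨max a b, fun n hn m hm => ?_⟩
  obtain ⟨m1, h1, h1'⟩ := ha n (le_of_max_le_left hn) _ hm.1
  obtain ⟨m2, h2, h2'⟩ := hb n (le_of_max_le_right hn) _ hm.2
  exact ⟨(m1, m2), ⟨h1, h2⟩, Prod.ext h1' h2'⟩

theorem SurjY.prod {M N : Gr k} (hM : SurjY M) (hN : SurjY N) : SurjY (M.prod N) := by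
  obtain ⟨a, ha⟩ := hM
  obtain ⟨b, hb⟩ := hN
  refine ⟨min a b, fun n hn m hm => ?_⟩
  obtain ⟨m1, h1, h1'⟩ := ha n (lt_of_lt_of_le hn (min_le_left _ _)) _ hm.1
  obtain ⟨m2, h2, h2'⟩ := hb n (lt_of_lt_of_le hn (min_le_right _ _)) _ hm.2
  exact ⟨(m1, m2), ⟨h1, h2⟩, Prod.ext h1' h2'⟩

theorem FinDeg.prod {M N : Gr k} (hM : FinDeg M) (hN : FinDeg N) : FinDeg (M.prod N) := by
  intro n
  obtain ⟨ι, _, u, hu, hs⟩ := hM n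
  obtain ⟨κ, _, v, hv, ht⟩ := hN n
  refine ⟨ι ⊕ κ, inferInstance, Sum.elim (fun i => (GrMod.lift (𝟙 M) 0).1 (u i))
    (fun i => (GrMod.lift 0 (𝟙 N)).1 (v i)), ?_, fun m hm => ?_⟩
  · rintro (i | i)
    · exact (GrMod.lift (𝟙 M) 0).2 _ _ (hu i)
    · exact (GrMod.lift 0 (𝟙 N)).2 _ _ (hv i)
  · obtain ⟨p, hp⟩ := hs _ hm.1
    obtain ⟨q, hq⟩ := ht _ hm.2
    refine ⟨Sum.elim p q, ?_⟩
    rw [Fintype.sum_sum_type]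
    simp only [Sum.elim_inl, Sum.elim_inr]
    rw [← hom_act_sum, ← hom_act_sum, ← hp, ← hq]
    exact (congrArg (fun g => g.1 m) (GrMod.prod_total M N)).symm

theorem TorsionFree.prod {M N : Gr k} (hM : TorsionFree M) (hN : TorsionFree N) :
    TorsionFree (M.prod N) := fun p hp n _ hm h0 =>
  Prod.ext (hM p hp n _ hm.1 (congrArg Prod.fst h0)) (hN p hp n _ hm.2 (congrArg Prod.snd h0))

theorem TorsionFree.eq_zero_of_mX {M : Gr k} (h : TorsionFree M) {n : ℤ} {m : M} (hm : m ∈ M.deg n)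
    (h0 : mX M m = 0) : m = 0 := by
  refine h Polynomial.X X_ne_zero n m hm ?_
  rw [aeval_X, act_z, h0, map_zero]

theorem TorsionFree.eq_zero_of_mY {M : Gr k} (h : TorsionFree M) {n : ℤ} {m : M} (hm : m ∈ M.deg n)
    (h0 : mY M m = 0) : m = 0 := by
  refine h (Polynomial.X + C (-1)) (X_add_C_ne_zero _) n m hm ?_
  rw [act_aeval_X_add_C, mY_mX, h0, map_zero, zero_add, neg_smul, one_smul, add_neg_cancel]

theorem TorsionFree.eq_zero_of_mX_pow {M : Gr k} (h : TorsionFree M) (d : ℕ) {n : ℤ} {m : M}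
    (hm : m ∈ M.deg n) (h0 : (mX M ^ d) m = 0) : m = 0 := by
  induction d with
  | zero => exact h0
  | succ d ih =>
    rw [pow_succ', Module.End.mul_apply] at h0
    exact ih (h.eq_zero_of_mX (mX_pow_mem hm d) h0)

theorem TorsionFree.eq_zero_of_mY_pow {M : Gr k} (h : TorsionFree M) (d : ℕ) {n : ℤ} {m : M}
    (hm : m ∈ M.deg n) (h0 : (mY M ^ d) m = 0) : m = 0 := by
  induction d with
  | zero => exact h0
  | succ d ih =>
    rw [pow_succ', Module.End.mul_apply] at h0
    exact ih (h.eq_zero_of_mY (mY_pow_mem hm d) h0)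

/-! ### The shifts of the Weyl algebra -/

variable (k) in
/-- The module `A⟨n⟩`. -/
noncomputable abbrev sh (n : ℤ) : Gr k := (reg k).shift n

/-- A homogeneous element of the Weyl algebra, as an element of `A⟨n⟩`. -/
theorem exists_act_unit {n i : ℤ} {m : sh k n} (hm : m ∈ (sh k n).deg i) :
    ∃ p : k[X], m = act _ (aeval (z k) p) (act _ (homogGen k (i - n)) (GrMod.unit _ n)) := by
  obtain ⟨p, hp⟩ := exists_eq_homogGen_mul (show (m : Weyl k) ∈ grading k (i - n) from hm)
  refine ⟨p, hp.trans ?_⟩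
  rw [← act_mul]
  exact (one_mul (M := Weyl k) _).symm

theorem act_unit_eq {n : ℤ} (a : Weyl k) : act (sh k n) a (GrMod.unit _ n) = (a : Weyl k) :=
  one_mul (M := Weyl k) a

theorem act_homogGen_unit_mem (n i : ℤ) :
    act (sh k n) (homogGen k (i - n)) (GrMod.unit _ n) ∈ (sh k n).deg i := by
  have := act_mem (GrMod.unit_mem (𝒜 := grading k) n) (homogGen_mem (i - n))
  rwa [add_sub_cancel] at this

theorem surjXFrom_sh (n : ℤ) : SurjXFrom (sh k n) n := by
  refine fun i hi m hm => ?_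
  obtain ⟨d, rfl⟩ : ∃ d : ℕ, i = n + d := ⟨(i - n).toNat, by omega⟩
  obtain ⟨p, rfl⟩ := exists_act_unit hm
  obtain ⟨q, hq⟩ := exists_act_aeval_comm (sh k n) (gen_mem k true) p
  refine ⟨act _ (aeval (z k) q) (act _ (homogGen k (n + d - n)) (GrMod.unit _ n)),
    act_aeval_mem (act_homogGen_unit_mem _ _) _, (hq _).symm.trans ?_⟩
  rw [show n + (d : ℤ) + 1 - n = ((d + 1 : ℕ) : ℤ) by push_cast; ring,
    show n + (d : ℤ) - n = (d : ℕ) by ring, homogGen_natCast, homogGen_natCast, pow_succ,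
    act_mul _ (x k ^ d) (x k)]

theorem surjYBelow_sh (n : ℤ) : SurjYBelow (sh k n) n := by
  refine fun i hi m hm => ?_
  obtain ⟨d, rfl⟩ : ∃ d : ℕ, i = n - (d + 1 : ℕ) := ⟨(n - i - 1).toNat, by omega⟩
  obtain ⟨p, rfl⟩ := exists_act_unit hm
  obtain ⟨q, hq⟩ := exists_act_aeval_comm (sh k n) (gen_mem k false) p
  refine ⟨act _ (aeval (z k) q) (act _ (homogGen k (n - (d + 1 : ℕ) + 1 - n)) (GrMod.unit _ n)),
    act_aeval_mem (act_homogGen_unit_mem _ _) _, (hq _).symm.trans ?_⟩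
  rw [show n - ((d + 1 : ℕ) : ℤ) - n = -((d + 1 : ℕ) : ℤ) by push_cast; ring,
    show n - ((d + 1 : ℕ) : ℤ) + 1 - n = -(d : ℕ) by push_cast; ring, homogGen_neg, homogGen_neg,
    pow_succ, act_mul _ (y k ^ d) (y k)]

theorem surjX_sh (n : ℤ) : SurjX (sh k n) := ⟨n, surjXFrom_sh n⟩

theorem surjY_sh (n : ℤ) : SurjY (sh k n) := ⟨n, surjYBelow_sh n⟩

theorem finDeg_sh (n : ℤ) : FinDeg (sh k n) := by
  intro i
  refine ⟨Unit, inferInstance, fun _ => act _ (homogGen k (i - n)) (GrMod.unit _ n),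
    fun _ => act_homogGen_unit_mem _ _, fun m hm => ?_⟩
  obtain ⟨p, hp⟩ := exists_act_unit hm
  exact ⟨fun _ => p, by rw [hp]; simp⟩

theorem torsionFree_sh [CharZero k] (n : ℤ) : TorsionFree (sh k n) := by
  intro p hp i m hm h0
  obtain ⟨q, rfl⟩ := exists_act_unit hm
  rw [← act_aeval_mul, ← act_mul, act_unit_eq] at h0
  have := eq_zero_of_homogGen_mul h0
  rw [(mul_eq_zero.1 this).resolve_left hp, map_zero]
  exact zero_smul _ _

theorem IsFGProj.surjX {P : Gr k} (hP : GrMod.IsFGProj P) : SurjX P := by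
  obtain ⟨L, f, hL, hf⟩ := GrMod.exists_surjective (C := SurjX) surjX_sh (fun _ _ => SurjX.prod) hP.1
  exact hL.of_surjective f hf

theorem IsFGProj.surjY {P : Gr k} (hP : GrMod.IsFGProj P) : SurjY P := by
  obtain ⟨L, f, hL, hf⟩ := GrMod.exists_surjective (C := SurjY) surjY_sh (fun _ _ => SurjY.prod) hP.1
  exact hL.of_surjective f hf

theorem IsFGProj.finDeg {P : Gr k} (hP : GrMod.IsFGProj P) : FinDeg P := by
  obtain ⟨L, f, hL, hf⟩ := GrMod.exists_surjective (C := FinDeg) finDeg_sh (fun _ _ => FinDeg.prod) hP.1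
  exact hL.of_surjective f hf

/-- Unlike the three preceding conditions, torsion-freeness does not pass to quotients; projectivity
splits the surjection and embeds P in a finite product of shifts. -/
theorem IsFGProj.torsionFree [CharZero k] {P : Gr k} (hP : GrMod.IsFGProj P) : TorsionFree P := by
  obtain ⟨L, f, hL, hf⟩ := GrMod.exists_surjective (C := TorsionFree) torsionFree_sh
    (fun _ _ => TorsionFree.prod) hP.1
  have := GrMod.epi_of_surjective f hf
  obtain ⟨s, hs⟩ := hP.2.factors (𝟙 P) f
  exact hL.of_injective s (Function.LeftInverse.injective (g := f.1) fun m =>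
    congrArg (fun g => g.1 m) hs)

/-- Spaces of morphisms to modules with finite-dimensional components are finite-dimensional. -/
theorem finite_hom {P S : Gr k} (hP : Module.Finite (Weyl k)ᵐᵒᵖ P)
    (hS : ∀ n, Module.Finite k (S.deg n)) : Module.Finite k (P ⟶ S) := by
  obtain ⟨L, f, hL, hf⟩ := GrMod.exists_surjective (C := fun L : Gr k => Module.Finite k (L ⟶ S))
    (fun n => Module.Finite.equiv (GrMod.homRegularEquiv S n).symm) (fun M N hM hN =>
      Module.Finite.of_injective ((Linear.leftComp k S (GrMod.lift (𝟙 M) 0)).prod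
        (Linear.leftComp k S (GrMod.lift 0 (𝟙 N)))) fun a b hab => by
          have h1 : GrMod.lift (𝟙 M) 0 ≫ a = GrMod.lift (𝟙 M) 0 ≫ b := congrArg Prod.fst hab
          have h2 : GrMod.lift 0 (𝟙 N) ≫ a = GrMod.lift 0 (𝟙 N) ≫ b := congrArg Prod.snd hab
          rw [← Category.id_comp a, ← Category.id_comp b, ← GrMod.prod_total, Preadditive.add_comp,
            Preadditive.add_comp, Category.assoc, Category.assoc, Category.assoc, Category.assoc,
            h1, h2]) hP
  have := GrMod.epi_of_surjective f hf
  exact Module.Finite.of_injective (Linear.leftComp k S f) fun a b hab => (cancel_epi f).1 hab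

end Weyl

/-! ### Modules controlled by a single degree -/

namespace Weyl

open MulOpposite Polynomial

variable {k : Type u} [Field k]

theorem SurjXFrom.exists_pow {M : Gr k} {n : ℤ} (h : SurjXFrom M n) (d : ℕ) {m : M}
    (hm : m ∈ M.deg (n + d)) : ∃ m' ∈ M.deg n, (mX M ^ d) m' = m := by
  induction d generalizing m with
  | zero => exact ⟨m, by simpa using hm, rfl⟩
  | succ d ih =>
    rw [Nat.cast_succ, ← add_assoc] at hm
    obtain ⟨m1, h1, rfl⟩ := h (n + d) (by omega) m hm
    obtain ⟨m2, h2, rfl⟩ := ih h1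
    exact ⟨m2, h2, by rw [pow_succ', Module.End.mul_apply]⟩

theorem SurjYBelow.exists_pow {M : Gr k} {n : ℤ} (h : SurjYBelow M n) (d : ℕ) {m : M}
    (hm : m ∈ M.deg (n - d)) : ∃ m' ∈ M.deg n, (mY M ^ d) m' = m := by
  induction d generalizing m with
  | zero => exact ⟨m, by simpa using hm, rfl⟩
  | succ d ih =>
    obtain ⟨m1, h1, rfl⟩ := h (n - (d + 1 : ℕ)) (by push_cast; omega) m hm
    rw [sub_succ_add_one] at h1
    obtain ⟨m2, h2, rfl⟩ := ih h1
    exact ⟨m2, h2, by rw [pow_succ', Module.End.mul_apply]⟩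

/-- In a torsion-free module x and y are injective, so any homogeneous element can be carried to
degree n without becoming zero. -/
theorem injective_of_deg {L P : Gr k} (hL : TorsionFree L) (f : L ⟶ P) (n : ℤ)
    (h : ∀ m ∈ L.deg n, f.1 m = 0 → m = 0) : Function.Injective f.1 := by
  refine GrMod.injective_of_homog f fun i m hm h0 => ?_
  rcases le_total n i with hi | hi
  · obtain ⟨d, rfl⟩ : ∃ d : ℕ, i = n + d := ⟨(i - n).toNat, by omega⟩
    have h1 := mY_pow_mem hm d
    rw [add_sub_cancel_right] at h1
    refine hL.eq_zero_of_mY_pow d hm (h _ h1 ?_)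
    rw [hom_mY_pow, h0, map_zero]
  · obtain ⟨d, rfl⟩ : ∃ d : ℕ, i = n - d := ⟨(n - i).toNat, by omega⟩
    have h1 := mX_pow_mem hm d
    rw [sub_add_cancel] at h1
    refine hL.eq_zero_of_mX_pow d hm (h _ h1 ?_)
    rw [hom_mX_pow, h0, map_zero]

theorem surjective_of_deg {L P : Gr k} (f : L ⟶ P) {n : ℤ} (hX : SurjXFrom P n)
    (hY : SurjYBelow P n) (h : ∀ m ∈ P.deg n, ∃ l, f.1 l = m) : Function.Surjective f.1 := by
  refine GrMod.surjective_of_homog f fun i m hm => ?_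
  rcases le_total n i with hi | hi
  · obtain ⟨d, rfl⟩ : ∃ d : ℕ, i = n + d := ⟨(i - n).toNat, by omega⟩
    obtain ⟨m', hm', rfl⟩ := hX.exists_pow d hm
    obtain ⟨l, rfl⟩ := h m' hm'
    exact ⟨_, hom_mX_pow f d l⟩
  · obtain ⟨d, rfl⟩ : ∃ d : ℕ, i = n - d := ⟨(n - i).toNat, by omega⟩
    obtain ⟨m', hm', rfl⟩ := hY.exists_pow d hm
    obtain ⟨l, rfl⟩ := h m' hm'
    exact ⟨_, hom_mY_pow f d l⟩

/-! ### Bases of components -/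

/-- The action of `z` on a component. -/
noncomputable def zEnd (M : Gr k) (n : ℤ) : M.deg n →ₗ[k] M.deg n :=
  (act M (z k)).restrict fun m hm => by rw [act_z]; exact mY_mem (mX_mem hm)

theorem aeval_zEnd (M : Gr k) (n : ℤ) (p : k[X]) (m : M.deg n) :
    (aeval (zEnd M n) p m : M) = act M (aeval (z k) p) m := by
  induction p using Polynomial.induction_on with
  | C c => rw [aeval_C, aeval_C, act_algebraMap]; rfl
  | add p q hp hq => rw [map_add, map_add, act_add, ← hp, ← hq]; rfl
  | monomial i c ih =>
    have h1 : aeval (zEnd M n) (C c * Polynomial.X ^ i * Polynomial.X) m =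
        zEnd M n (aeval (zEnd M n) (C c * Polynomial.X ^ i) m) := by
      rw [mul_comm, map_mul, aeval_X]; rfl
    have h2 : act M (aeval (z k) (C c * Polynomial.X ^ i * Polynomial.X)) m =
        act M (z k) (act M (aeval (z k) (C c * Polynomial.X ^ i)) m) := by
      rw [map_mul _ _ Polynomial.X, aeval_X, act_mul]
    rw [pow_succ, ← mul_assoc, h1, h2, ← ih]; rfl

/-- A family of elements of degree `n` which is a basis of the component over `k[z]`. -/
structure IsBasisAt (M : Gr k) (n : ℤ) {r : ℕ} (b : Fin r → M) : Prop where
  mem : ∀ i, b i ∈ M.deg n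
  eq_zero : ∀ p : Fin r → k[X], ∑ i, act M (aeval (z k) (p i)) (b i) = 0 → p = 0
  span : ∀ m ∈ M.deg n, ∃ p : Fin r → k[X], m = ∑ i, act M (aeval (z k) (p i)) (b i)

/-- A component is a finitely generated torsion-free module over the principal ideal domain k[z],
hence free of finite rank. -/
theorem exists_basis {M : Gr k} (hf : FinDeg M) (ht : TorsionFree M) (n : ℤ) :
    ∃ (r : ℕ) (b : Fin r → M), IsBasisAt M n b := by
  let V := Module.AEval' (zEnd M n)
  let e : M.deg n ≃ₗ[k] V := Module.AEval'.of (zEnd M n)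
  have he : ∀ (p : k[X]) (v : V), ((e.symm (p • v) : M.deg n) : M) =
      act M (aeval (z k) p) (e.symm v : M) := by
    intro p v
    rw [← aeval_zEnd]
    rfl
  obtain ⟨ι, _, u, hu, hs⟩ := hf n
  have hsum : ∀ {κ : Type} [Fintype κ] (p : κ → k[X]) (v : κ → V),
      ((e.symm (∑ i, p i • v i) : M.deg n) : M) =
        ∑ i, act M (aeval (z k) (p i)) (e.symm (v i) : M) := by
    intro κ _ p v
    rw [map_sum, AddSubmonoidClass.coe_finsetSum]
    exact Finset.sum_congr rfl fun i _ => he _ _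
  have hfin : Module.Finite k[X] V := by
    refine ⟨Submodule.fg_def.2 ⟨_, Set.finite_range fun i => e ⟨u i, hu i⟩, eq_top_iff.2 ?_⟩⟩
    rintro v -
    obtain ⟨p, hp⟩ := hs _ (e.symm v).2
    have hv : v = ∑ i, p i • e ⟨u i, hu i⟩ := e.symm.injective (Subtype.ext (by
      rw [hsum, hp]
      simp only [LinearEquiv.symm_apply_apply]))
    rw [hv]
    exact Submodule.sum_mem _ fun i _ => Submodule.smul_mem _ _ (Submodule.subset_span ⟨i, rfl⟩)
  have htf : Module.IsTorsionFree k[X] V := by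
    refine ⟨fun p hp v w hvw => ?_⟩
    rw [← sub_eq_zero]
    refine e.symm.injective (Subtype.ext ?_)
    rw [map_zero]
    refine ht p hp.ne_zero n _ (e.symm (v - w)).2 ?_
    rw [← he, smul_sub, sub_eq_zero.2 hvw, map_zero]
    rfl
  obtain ⟨r, b⟩ := Module.basisOfFiniteTypeTorsionFree' (R := k[X]) (M := V)
  refine ⟨r, fun i => (e.symm (b i) : M), fun i => (e.symm (b i)).2, fun p hp => ?_, fun m hm => ?_⟩
  · rw [← hsum] at hp
    have h1 : ∑ i, p i • b i = 0 := e.symm.injective (Subtype.ext (by rw [hp, map_zero]; rfl))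
    exact funext fun i => Fintype.linearIndependent_iff.1 b.linearIndependent p h1 i
  · refine ⟨fun i => b.repr (e ⟨m, hm⟩) i, ?_⟩
    rw [← hsum, b.sum_repr, LinearEquiv.symm_apply_apply]

theorem isHomog_bot : (reg k).IsHomog ⊥ := fun m hm i => by
  rw [(Submodule.mem_bot _).1 hm, map_zero]; exact Submodule.zero_mem _

variable (k) in
/-- The zero module. -/
noncomputable def zeroMod : Gr k := (reg k).sub ⊥ isHomog_bot

theorem zeroMod_eq_zero (m : zeroMod k) : m = 0 := Subtype.ext ((Submodule.mem_bot _).1 m.2)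

/-- A module generated by a component with a basis is a free module. -/
theorem exists_free {P : Gr k} {n : ℤ} {r : ℕ} (u : Fin r → P) (hu : ∀ i, u i ∈ P.deg n)
    {C : Gr k → Prop} (h0 : C (zeroMod k))
    (hprod : ∀ L, C L → C (L.prod (sh k n))) :
    ∃ (L : Gr k) (f : L ⟶ P), C L ∧ (∀ l ∈ L.deg n, ∃ p : Fin r → k[X],
      f.1 l = ∑ i, act P (aeval (z k) (p i)) (u i) ∧ (p = 0 → l = 0)) ∧
      ∀ i, u i ∈ LinearMap.range f.1 := by
  induction r with
  | zero =>
    refine ⟨_, 0, h0, fun l hl => ⟨0, by simp, fun _ => ?_⟩, fun i => i.elim0⟩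
    exact zeroMod_eq_zero l
  | succ r ih =>
    obtain ⟨L, f, hL, h2, h3⟩ := ih (fun i => u i.castSucc) fun i => hu _
    refine ⟨L.prod (sh k n), GrMod.desc f (P.ofElem n (u (Fin.last r)) (hu (Fin.last r))), hprod L hL,
      fun l hl => ?_, fun i => ?_⟩
    · obtain ⟨p, hp, hp0⟩ := h2 l.1 hl.1
      obtain ⟨q, hq⟩ := exists_act_unit hl.2
      rw [sub_self, show homogGen k 0 = 1 from pow_zero _, act_one] at hq
      refine ⟨Fin.snoc p q, ?_, fun h => Prod.ext (hp0 ?_) ?_⟩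
      · rw [Fin.sum_univ_castSucc]
        simp only [Fin.snoc_castSucc, Fin.snoc_last]
        rw [GrMod.desc_apply, hp, hq, hom_act, GrMod.ofElem_unit]
      · ext1 i
        have := congrFun h i.castSucc
        rwa [Fin.snoc_castSucc] at this
      · have := congrFun h (Fin.last r)
        rw [Fin.snoc_last] at this
        rw [hq, this]
        change act (sh k n) (aeval (z k) (0 : k[X])) _ = 0
        rw [map_zero]
        exact zero_smul _ _
    · induction i using Fin.lastCases with
      | last =>
        refine ⟨(0, GrMod.unit _ n), ?_⟩
        change f.1 0 + (P.ofElem n _ (hu (Fin.last r))).1 (GrMod.unit _ n) = _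
        rw [map_zero, zero_add, GrMod.ofElem_unit]
      | cast i =>
        obtain ⟨l, hl⟩ := h3 i
        refine ⟨(l, 0), ?_⟩
        change f.1 l + (P.ofElem n _ (hu (Fin.last r))).1 0 = _
        rw [map_zero, add_zero, hl]

/-! ### Submodules cut out by a morphism to a simple module -/

/-- The kernel of a morphism. -/
noncomputable def kerMod {P S : Gr k} (f : P ⟶ S) : Gr k := P.sub _ (GrMod.isHomog_ker f)

/-- The inclusion of the kernel. -/
noncomputable def kerι {P S : Gr k} (f : P ⟶ S) : kerMod f ⟶ P := P.subMap _ (GrMod.isHomog_ker f)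

theorem kerι_injective {P S : Gr k} (f : P ⟶ S) : Function.Injective (kerι f).1 :=
  Subtype.val_injective

theorem kerι_apply {P S : Gr k} (f : P ⟶ S) (m : kerMod f) : f.1 ((kerι f).1 m) = 0 := m.2

theorem exists_kerι {P S : Gr k} (f : P ⟶ S) {n : ℤ} {m : P} (hm : m ∈ P.deg n) (h : f.1 m = 0) :
    ∃ m' ∈ (kerMod f).deg n, (kerι f).1 m' = m := ⟨⟨m, h⟩, hm, rfl⟩

theorem finite_deg_yMod (j n : ℤ) : Module.Finite k ((yMod k j).deg n) :=
  Module.Finite.of_injective ((ySeq k j).val n ∘ₗ ((yMod k j).deg n).subtype : _ →ₗ[k] k)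
    fun a b h => Subtype.ext (Seq.ext_deg _ a.2 b.2 h)

theorem finite_deg_xMod (j n : ℤ) : Module.Finite k ((xMod k j).deg n) :=
  Module.Finite.of_injective ((xSeq k j).val n ∘ₗ ((xMod k j).deg n).subtype : _ →ₗ[k] k)
    fun a b h => Subtype.ext (Seq.ext_deg _ a.2 b.2 h)

variable {P : Gr k} {j : ℤ}

/-- Since Y⟨j⟩ vanishes in degrees ≤ j, the kernel contains everything there. -/
theorem SurjYBelow.kerMod {n : ℤ} (h : SurjYBelow P n) (hn : n ≤ j) (f : P ⟶ yMod k j) :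
    SurjYBelow (kerMod f) n := by
  intro i hi m hm
  obtain ⟨m', hm', h'⟩ := h i hi _ ((kerι f).2 _ _ hm)
  obtain ⟨m'', h1, h2⟩ := exists_kerι f hm' (yMod_eq_zero (by omega) (f.2 _ _ hm'))
  refine ⟨m'', h1, kerι_injective f ?_⟩
  rw [hom_mY, h2, h']

section CharZero

variable [CharZero k]

/-- Above the gap x is injective on Y⟨j⟩, so a preimage under x of an element of the kernel is again
in the kernel. -/
theorem SurjXFrom.kerMod (h : SurjXFrom P (j + 1)) (f : P ⟶ yMod k j) :
    SurjXFrom (kerMod f) (j + 1) := by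
  intro i hi m hm
  obtain ⟨m', hm', h'⟩ := h i hi _ ((kerι f).2 _ _ hm)
  obtain ⟨m'', h1, h2⟩ := exists_kerι f hm' ((yMod_scalarZ j).eq_zero_of_mX (f.2 _ _ hm')
    (cast_sub_ne (by omega)) (by rw [← hom_mX, h', kerι_apply]))
  refine ⟨m'', h1, kerι_injective f ?_⟩
  rw [hom_mX, h2, h']

theorem hom_yMod_ext {f g : P ⟶ yMod k j} (h : ∀ m ∈ P.deg (j + 1), f.1 m = g.1 m) : f = g := by
  rw [← sub_eq_zero]
  refine GrMod.hom_ext_homog fun n m hm => ?_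
  by_cases hn : n ≤ j
  · exact yMod_eq_zero hn ((f - g).2 _ _ hm)
  obtain ⟨d, rfl⟩ : ∃ d : ℕ, n = j + 1 + d := ⟨(n - j - 1).toNat, by omega⟩
  refine (yMod_scalarZ j).mY_pow_ne_zero d ((f - g).2 _ _ hm) ?_
  rw [← hom_mY_pow, GrMod.sub_apply, h _ (by simpa using mY_pow_mem hm d), sub_self]

theorem surjective_of_ne_zero {f : P ⟶ yMod k j} (hf : f ≠ 0) : Function.Surjective f.1 := by
  obtain ⟨m, hm, h0⟩ : ∃ m ∈ P.deg (j + 1), f.1 m ≠ 0 := by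
    by_contra! h
    exact hf (hom_yMod_ext h)
  refine GrMod.surjective_of_homog f fun n v hv => ?_
  by_cases hn : n ≤ j
  · exact ⟨0, by rw [map_zero, yMod_eq_zero hn hv]⟩
  obtain ⟨d, rfl⟩ : ∃ d : ℕ, n = j + 1 + d := ⟨(n - j - 1).toNat, by omega⟩
  have hmd := f.2 _ _ (mX_pow_mem hm d)
  have h1 : f.1 ((mX P ^ d) m) ≠ 0 := fun h => by
    rw [hom_mX_pow] at h
    exact h0 ((yMod_scalarZ j).mX_pow_ne_zero' d (f.2 _ _ hm) h)
  have h2 : (ySeq k j).val (j + 1 + d) (f.1 ((mX P ^ d) m)) ≠ 0 := fun h =>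
    h1 (Seq.ext_deg _ hmd (Submodule.zero_mem _) (by rw [h, map_zero]))
  refine ⟨((ySeq k j).val (j + 1 + d) v / (ySeq k j).val (j + 1 + d) (f.1 ((mX P ^ d) m))) •
    (mX P ^ d) m, Seq.ext_deg _ (f.2 _ _ (Submodule.smul_mem _ _ (mX_pow_mem hm d))) hv ?_⟩
  rw [GrMod.hom_smul, map_smul, smul_eq_mul, div_mul_cancel₀ _ h2]

/-- A morphism from the kernel of a morphism to `Y⟨j⟩` extends. -/
theorem exists_extend (f : P ⟶ yMod k j) (g : kerMod f ⟶ yMod k j) :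
    ∃ F : P ⟶ yMod k j, kerι f ≫ F = g := by
  -- Any linear retraction onto the kernel will do. A functional on degree j+1 gives a morphism to
  -- Y⟨j⟩ if it vanishes on the products with x from degree j, and in degree j the kernel is the
  -- whole module, so an arbitrary linear extension still satisfies the condition.
  obtain ⟨φ, hφ⟩ := LinearMap.exists_leftInverse_of_injective (GrMod.lin (kerι f))
    (LinearMap.ker_eq_bot.2 (kerι_injective f))
  have hφ' : ∀ m, φ ((kerι f).1 m) = m := fun m => congrArg (fun l => l m) hφ
  let ψ : P →ₗ[k] k := (ySeq k j).val (j + 1) ∘ₗ GrMod.lin g ∘ₗ φ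
  have hψ : ∀ m, ψ ((kerι f).1 m) = (ySeq k j).val (j + 1) (g.1 m) := fun m => by
    change (ySeq k j).val (j + 1) (g.1 (φ ((kerι f).1 m))) = _
    rw [hφ']
  obtain ⟨F, hF⟩ := exists_hom_yMod j ψ fun m hm => by
    obtain ⟨m', hm', rfl⟩ := exists_kerι f hm (yMod_eq_zero le_rfl (f.2 _ _ hm))
    rw [← hom_mX, hψ, hom_yMod_mX g hm', map_zero]
  refine ⟨F, hom_yMod_ext fun m hm => Seq.ext_deg _ ((kerι f ≫ F).2 _ _ hm) (g.2 _ _ hm) ?_⟩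
  have h1 := hF 0 ((kerι f).1 m) (by simpa using (kerι f).2 _ _ hm)
  rw [Nat.cast_zero, add_zero, pow_zero, Module.End.one_apply, hψ] at h1
  exact h1

/-- Restriction to the kernel of f is onto by `exists_extend`, and it kills the nonzero morphism f
itself. -/
theorem finrank_kerMod_lt (hP : Module.Finite (Weyl k)ᵐᵒᵖ P) {f : P ⟶ yMod k j} (hf : f ≠ 0) :
    Module.finrank k (kerMod f ⟶ yMod k j) < Module.finrank k (P ⟶ yMod k j) := by
  have := finite_hom hP (finite_deg_yMod (k := k) j)
  let r := Linear.leftComp k (yMod k j) (kerι f)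
  have h1 := r.finrank_range_add_finrank_ker
  rw [LinearMap.range_eq_top.2 (fun g => exists_extend f g), finrank_top] at h1
  have h2 : 0 < Module.finrank k (LinearMap.ker r) := by
    rw [Module.finrank_pos_iff_exists_ne_zero]
    refine ⟨⟨f, ?_⟩, fun h => hf (congrArg Subtype.val h)⟩
    exact GrMod.hom_ext (kerι_apply f)
  omega

/-- Morphisms to Y⟨i⟩ are the functionals on P_{i+1} / P_i x; if there are none but zero, the
quotient is zero. -/
theorem surjXFrom_of_hom {n : ℤ} (h : ∀ i, n ≤ i → ∀ F : P ⟶ yMod k i, F = 0) : SurjXFrom P n := by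
  intro i hi m hm
  obtain ⟨m', hm', h'⟩ := (forall_hom_yMod_iff (d := 0) (by simpa using hm)).1
    fun F => by rw [h i hi F, GrMod.zero_apply]
  exact ⟨m', hm', h'.symm⟩

theorem surjYBelow_of_hom {n : ℤ} (h : ∀ i, i < n → ∀ F : P ⟶ xMod k i, F = 0) :
    SurjYBelow P n := by
  intro i hi m hm
  obtain ⟨m', hm', h'⟩ := (forall_hom_xMod_iff (d := 0) (by simpa using hm)).1
    fun F => by rw [h i hi F, GrMod.zero_apply]
  exact ⟨m', hm', h'.symm⟩

theorem SurjXFrom.pred (h : SurjXFrom P (j + 1)) (h' : ∀ F : P ⟶ yMod k j, F = 0) :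
    SurjXFrom P j := by
  intro i hi m hm
  rcases hi.eq_or_lt with rfl | hi
  · obtain ⟨m', hm', h'⟩ := (forall_hom_yMod_iff (d := 0) (by simpa using hm)).1
      fun F => by rw [h' F, GrMod.zero_apply]
    exact ⟨m', hm', h'.symm⟩
  · exact h i hi m hm

end CharZero

end Weyl

/-! ### Classes in the Grothendieck group -/

namespace GrMod

section Classes

variable {k R : Type u} [Field k] [Ring R] [Algebra k R] {𝒜 : ℤ → Submodule k R}

@[simp] theorem lift_fst {L M N : GrMod 𝒜} (f : L ⟶ M) (g : L ⟶ N) : lift f g ≫ fst M N = f := rfl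

@[simp] theorem lift_snd {L M N : GrMod 𝒜} (f : L ⟶ M) (g : L ⟶ N) : lift f g ≫ snd M N = g := rfl

@[simp] theorem lift_fst_assoc {L M N Q : GrMod 𝒜} (f : L ⟶ M) (g : L ⟶ N) (h : M ⟶ Q) :
    lift f g ≫ fst M N ≫ h = f ≫ h := rfl

@[simp] theorem lift_snd_assoc {L M N Q : GrMod 𝒜} (f : L ⟶ M) (g : L ⟶ N) (h : N ⟶ Q) :
    lift f g ≫ snd M N ≫ h = g ≫ h := rfl

theorem prod_hom_ext {L M N : GrMod 𝒜} {f g : L ⟶ M.prod N} (h1 : f ≫ fst M N = g ≫ fst M N)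
    (h2 : f ≫ snd M N = g ≫ snd M N) : f = g :=
  hom_ext fun m => Prod.ext (congrArg (fun h => h.1 m) h1) (congrArg (fun h => h.1 m) h2)

/-- The class of a finitely generated graded projective module. -/
def cls (P : GrMod 𝒜) (hP : IsFGProj P) : GrK0 𝒜 := GrK0.of 𝒜 (FGProjClass.mk P hP)

theorem FGProjClass_mk_eq {P Q : GrMod 𝒜} (hP : IsFGProj P) (hQ : IsFGProj Q) (e : P ≅ Q) :
    FGProjClass.mk P hP = FGProjClass.mk Q hQ :=
  Quotient.sound ⟨ObjectProperty.isoMk _ e⟩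

theorem cls_eq {P Q : GrMod 𝒜} (hP : IsFGProj P) (hQ : IsFGProj Q) (e : P ≅ Q) :
    cls P hP = cls Q hQ := congrArg _ (FGProjClass_mk_eq hP hQ e)

theorem cls_add {P Q : GrMod 𝒜} (hP : IsFGProj P) (hQ : IsFGProj Q) (b : BinaryBicone P Q)
    (hb : b.IsBilimit) (hS : IsFGProj b.pt) : cls b.pt hS = cls P hP + cls Q hQ :=
  QuotientAddGroup.eq_iff_sub_mem.2
    (AddSubgroup.subset_closure ⟨P, Q, b.pt, hP, hQ, hS, b, ⟨hb⟩, ⟨Iso.refl _⟩, rfl⟩)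

theorem cls_prod {P Q : GrMod 𝒜} (hP : IsFGProj P) (hQ : IsFGProj Q) :
    cls (P.prod Q) (hP.prod hQ) = cls P hP + cls Q hQ :=
  cls_add hP hQ (prodBicone P Q) (prodBiconeIsBilimit P Q) _

theorem K0_induction {p : GrK0 𝒜 → Prop} (h : ∀ P hP, p (cls P hP)) (hadd : ∀ a b, p a → p b → p (a + b))
    (hneg : ∀ a, p a → p (-a)) (h0 : p 0) (a : GrK0 𝒜) : p a := by
  obtain ⟨a, rfl⟩ := QuotientAddGroup.mk_surjective a
  induction a using FreeAbelianGroup.induction_on with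
  | zero => exact h0
  | of c =>
    obtain ⟨⟨P, hP⟩, rfl⟩ := Quotient.exists_rep c
    exact h P hP
  | neg c ih => exact hneg _ ih
  | add a b ha hb => exact hadd _ _ ha hb

end Classes

end GrMod

namespace Weyl

open MulOpposite Polynomial

variable {k : Type u} [Field k]

/-! ### Schanuel's lemma -/

section Schanuel

variable {P Q S : Gr k} (f : P ⟶ S) (g : Q ⟶ S)

instance : Mono (kerι f) := ⟨fun _ _ h => GrMod.hom_ext fun m =>
  kerι_injective f (congrArg (fun l => l.1 m) h)⟩

@[simp] theorem kerι_comp : kerι f ≫ f = 0 := GrMod.hom_ext (kerι_apply f)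

@[simp] theorem kerι_comp_assoc {L : Gr k} (h : S ⟶ L) : kerι f ≫ f ≫ h = 0 := by
  rw [← Category.assoc, kerι_comp, Limits.zero_comp]

/-- The morphism to a kernel. -/
noncomputable def kerLift {L : Gr k} (h : L ⟶ P) (hh : h ≫ f = 0) : L ⟶ kerMod f :=
  GrMod.subLift _ _ h fun m => congrArg (fun l : L ⟶ S => l.1 m) hh

@[simp] theorem kerLift_kerι {L : Gr k} (h : L ⟶ P) (hh : h ≫ f = 0) :
    kerLift f h hh ≫ kerι f = h := rfl

@[simp] theorem kerLift_kerι_assoc {L L' : Gr k} (h : L ⟶ P) (hh : h ≫ f = 0) (h' : P ⟶ L') :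
    kerLift f h hh ≫ kerι f ≫ h' = h ≫ h' := rfl

/-- The direct sum decomposition in Schanuel's lemma. -/
noncomputable def schanuelBicone (a : Q ⟶ P) (b : P ⟶ Q) (ha : a ≫ f = g) (hb : b ≫ g = f) :
    BinaryBicone (kerMod g) P where
  -- Both sums are the fibre product of P and Q over S: a pair (κ, q) corresponds to (κ + a q, q),
  -- whose first entry is the projection to P, while q − b(κ + a q) is the projection to ker g.
  pt := (kerMod f).prod Q
  fst := kerLift g (GrMod.snd _ _ - GrMod.desc (kerι f) a ≫ b) (by
    simp [GrMod.desc, ha, hb])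
  snd := GrMod.desc (kerι f) a
  inl := GrMod.lift (kerLift f (-(kerι g ≫ a)) (by simp [ha])) (kerι g)
  inr := GrMod.lift (kerLift f (𝟙 _ - b ≫ a) (by simp [ha, hb])) b
  inl_fst := by
    rw [← cancel_mono (kerι g)]
    simp [GrMod.desc]
  inl_snd := by simp [GrMod.desc]
  inr_fst := by
    rw [← cancel_mono (kerι g)]
    simp [GrMod.desc]
  inr_snd := by simp [GrMod.desc]

theorem schanuelBicone_total (a : Q ⟶ P) (b : P ⟶ Q) (ha : a ≫ f = g) (hb : b ≫ g = f) :
    (schanuelBicone f g a b ha hb).fst ≫ (schanuelBicone f g a b ha hb).inl +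
      (schanuelBicone f g a b ha hb).snd ≫ (schanuelBicone f g a b ha hb).inr =
      𝟙 (schanuelBicone f g a b ha hb).pt := by
  have h1 : kerLift g (GrMod.snd _ _ - GrMod.desc (kerι f) a ≫ b) (by simp [GrMod.desc, ha, hb]) ≫
      GrMod.lift (kerLift f (-(kerι g ≫ a)) (by simp [ha])) (kerι g) + GrMod.desc (kerι f) a ≫
      GrMod.lift (kerLift f (𝟙 _ - b ≫ a) (by simp [ha, hb])) b = 𝟙 ((kerMod f).prod Q) := by
    refine GrMod.prod_hom_ext ?_ ?_
    · rw [← cancel_mono (kerι f)]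
      simp [GrMod.desc]
      abel
    · simp [GrMod.desc]
  exact h1

variable {f g}

/-- The decomposition ker f ⊕ Q ≅ ker g ⊕ P gives the relation between classes, and it also shows
that ker f is finitely generated projective, as a retract of the right-hand side. -/
theorem exists_schanuel (hP : GrMod.IsFGProj P) (hQ : GrMod.IsFGProj Q)
    (hf : Function.Surjective f.1) (hg : Function.Surjective g.1) (hK : GrMod.IsFGProj (kerMod g)) :
    ∃ hK' : GrMod.IsFGProj (kerMod f),
      GrMod.cls _ hK' + GrMod.cls Q hQ = GrMod.cls _ hK + GrMod.cls P hP := by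
  have := GrMod.epi_of_surjective f hf
  have := GrMod.epi_of_surjective g hg
  obtain ⟨a, ha⟩ := hQ.2.factors g f
  obtain ⟨b, hb⟩ := hP.2.factors f g
  let B := schanuelBicone f g a b ha hb
  have hB : B.fst ≫ B.inl + B.snd ≫ B.inr = 𝟙 B.pt := schanuelBicone_total f g a b ha hb
  have hT : GrMod.IsFGProj B.pt := (hK.prod hP).of_retract (GrMod.lift B.fst B.snd)
    (GrMod.desc B.inl B.inr) hB
  have hK' : GrMod.IsFGProj (kerMod f) :=
    hT.of_retract (GrMod.lift (𝟙 _) 0) (GrMod.fst _ _) rfl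
  refine ⟨hK', ?_⟩
  rw [← GrMod.cls_prod hK' hQ, ← GrMod.cls_add hK hP B (isBinaryBilimitOfTotal B hB) hT]
  rfl

end Schanuel

/-! ### Dimensions of spaces of morphisms -/

theorem finrank_deg_xMod (j n : ℤ) :
    Module.finrank k ((xMod k j).deg n) = if n ≤ j then 1 else 0 := by
  split_ifs with h
  · rw [← Module.finrank_self k]
    refine (LinearEquiv.ofBijective ((xSeq k j).val n ∘ₗ ((xMod k j).deg n).subtype : _ →ₗ[k] k)
      ⟨fun a b h => Subtype.ext (Seq.ext_deg _ a.2 b.2 h), fun c => ?_⟩).finrank_eq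
    exact ⟨⟨(xSeq k j).elt n c (xSeq_W h c), Seq.elt_mem _ _ _ _⟩, (xSeq k j).val_elt n c (xSeq_W h c)⟩
  · have : Subsingleton ((xMod k j).deg n) := ⟨fun a b => Subtype.ext (by
      rw [xMod_eq_zero (by omega) a.2, xMod_eq_zero (by omega) b.2])⟩
    exact Module.finrank_zero_of_subsingleton

theorem finrank_deg_yMod (j n : ℤ) :
    Module.finrank k ((yMod k j).deg n) = if j < n then 1 else 0 := by
  split_ifs with h
  · rw [← Module.finrank_self k]
    refine (LinearEquiv.ofBijective ((ySeq k j).val n ∘ₗ ((yMod k j).deg n).subtype : _ →ₗ[k] k)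
      ⟨fun a b h => Subtype.ext (Seq.ext_deg _ a.2 b.2 h), fun c => ?_⟩).finrank_eq
    exact ⟨⟨(ySeq k j).elt n c (ySeq_W h c), Seq.elt_mem _ _ _ _⟩, (ySeq k j).val_elt n c (ySeq_W h c)⟩
  · have : Subsingleton ((yMod k j).deg n) := ⟨fun a b => Subtype.ext (by
      rw [yMod_eq_zero (by omega) a.2, yMod_eq_zero (by omega) b.2])⟩
    exact Module.finrank_zero_of_subsingleton

theorem finrank_sh_xMod (n j : ℤ) :
    Module.finrank k (sh k n ⟶ xMod k j) = if n ≤ j then 1 else 0 := by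
  rw [(GrMod.homRegularEquiv (xMod k j) n).finrank_eq, finrank_deg_xMod]

theorem finrank_sh_yMod (n j : ℤ) :
    Module.finrank k (sh k n ⟶ yMod k j) = if j < n then 1 else 0 := by
  rw [(GrMod.homRegularEquiv (yMod k j) n).finrank_eq, finrank_deg_yMod]

variable (k) in
/-- The subgroup generated by the classes of the `A⟨n⟩`. -/
def shSubgroup : AddSubgroup (GrK0 (grading k)) :=
  AddSubgroup.closure (Set.range fun n => GrMod.cls (sh k n) (GrMod.isFGProj_shift_regular n))

theorem sh_mem (n : ℤ) :
    GrMod.cls (sh k n) (GrMod.isFGProj_shift_regular n) ∈ shSubgroup k :=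
  AddSubgroup.subset_closure ⟨n, rfl⟩

theorem isFGProj_zeroMod : GrMod.IsFGProj (zeroMod k) :=
  (GrMod.isFGProj_regular (𝒜 := grading k)).of_retract 0 0
    (GrMod.hom_ext fun m => (zeroMod_eq_zero _).trans (zeroMod_eq_zero m).symm)

section CharZero

variable [CharZero k]

theorem unit_ne_zero (n : ℤ) : GrMod.unit (grading k) n ≠ 0 := by
  intro h
  have h1 : (1 : Weyl k) = 0 := h
  refine one_ne_zero (eq_zero_of_homogGen_mul (k := k) (d := 0) (p := 1) ?_)
  rw [map_one, mul_one]
  exact (pow_zero (x k)).trans h1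

/-- This is the sequence 0 → A⟨j⟩ → A⟨j+1⟩ → Y⟨j⟩ → 0, with y as the first map. As Hom(A⟨j+1⟩, Y⟨j⟩)
is a line, the kernel has no nonzero morphism to Y⟨j⟩. So x is surjective from degree j on, and the
kernel is generated by its component of degree j, which is k[z]·y. -/
theorem nonempty_kerMod_iso {j : ℤ} {g : sh k (j + 1) ⟶ yMod k j} (hg : g ≠ 0) :
    Nonempty (sh k j ≅ kerMod g) := by
  have hY : SurjYBelow (kerMod g) j :=
    SurjYBelow.kerMod (fun i hi => surjYBelow_sh (j + 1) i (by omega)) le_rfl g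
  have hX : SurjXFrom (kerMod g) j := by
    refine ((surjXFrom_sh (j + 1)).kerMod g).pred fun F => ?_
    have h1 := finrank_kerMod_lt (GrMod.isFGProj_shift_regular (𝒜 := grading k) (j + 1)).1 hg
    rw [finrank_sh_yMod, if_pos (lt_add_one j), Nat.lt_one_iff] at h1
    have := finite_hom (GrMod.isFGProj_shift_regular (𝒜 := grading k) (j + 1)).1
      (finite_deg_yMod (k := k) j)
    have := Module.Finite.of_surjective (Linear.leftComp k (yMod k j) (kerι g))
      fun F => exists_extend g F
    have := Module.finrank_zero_iff.1 h1
    exact Subsingleton.elim _ _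
  obtain ⟨m, hm, hmy⟩ := exists_kerι g (mY_mem (GrMod.unit_mem (𝒜 := grading k) (j + 1)))
    (yMod_eq_zero le_rfl (g.2 _ _ (mY_mem (GrMod.unit_mem (𝒜 := grading k) (j + 1)))))
  let h : sh k j ⟶ kerMod g := (kerMod g).ofElem j m hm
  have hact : ∀ p : k[X], (kerι g).1 (h.1 (act _ (aeval (z k) p) (GrMod.unit _ j))) =
      act _ (aeval (z k) p) (mY _ (GrMod.unit _ (j + 1))) := fun p => by
    rw [hom_act, GrMod.ofElem_unit, hom_act, hmy]
  refine ⟨GrMod.isoOfBijective h (injective_of_deg (torsionFree_sh j) h j fun l hl h0 => ?_)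
    (surjective_of_deg h hX hY fun l hl => ?_)⟩
  · obtain ⟨p, hp⟩ := exists_act_unit hl
    rw [sub_self, show homogGen k 0 = 1 from pow_zero _, act_one] at hp
    have h1 := hact p
    rw [← hp, h0, map_zero] at h1
    by_cases hp0 : p = 0
    · rw [hp, hp0, map_zero]; exact zero_smul _ _
    · have h2 := torsionFree_sh (j + 1) p hp0 _ _ (mY_mem (GrMod.unit_mem (𝒜 := grading k) (j + 1)))
        h1.symm
      exact absurd ((torsionFree_sh (j + 1)).eq_zero_of_mY (GrMod.unit_mem (𝒜 := grading k) (j + 1)) h2)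
        (unit_ne_zero _)
  · obtain ⟨p, hp⟩ := exists_act_unit ((kerι g).2 _ _ hl)
    rw [show j - (j + 1) = -((1 : ℕ) : ℤ) by simp, homogGen_neg, pow_one] at hp
    exact ⟨_, kerι_injective g ((hact p).trans hp.symm)⟩

/-- The kernel of a nonzero morphism to `Y⟨j⟩`. -/
theorem exists_cls_kerMod {P : Gr k} (hP : GrMod.IsFGProj P) {j : ℤ} {f : P ⟶ yMod k j}
    (hf : f ≠ 0) : ∃ hK : GrMod.IsFGProj (kerMod f), GrMod.cls P hP =
      GrMod.cls _ hK + GrMod.cls (sh k (j + 1)) (GrMod.isFGProj_shift_regular _) -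
        GrMod.cls (sh k j) (GrMod.isFGProj_shift_regular _) := by
  obtain ⟨g, hg⟩ : ∃ g : sh k (j + 1) ⟶ yMod k j, g ≠ 0 := by
    by_contra! h
    have : Subsingleton (sh k (j + 1) ⟶ yMod k j) := ⟨fun a b => by rw [h a, h b]⟩
    have h1 := finrank_sh_yMod (k := k) (j + 1) j
    rw [Module.finrank_zero_of_subsingleton, if_pos (lt_add_one j)] at h1
    exact zero_ne_one h1
  obtain ⟨e⟩ := nonempty_kerMod_iso hg
  have hj := GrMod.isFGProj_shift_regular (𝒜 := grading k) j
  obtain ⟨hK, h⟩ := exists_schanuel hP (GrMod.isFGProj_shift_regular (𝒜 := grading k) (j + 1))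
    (surjective_of_ne_zero hf) (surjective_of_ne_zero hg) (hj.of_iso e)
  refine ⟨hK, ?_⟩
  rw [h, GrMod.cls_eq _ hj e.symm, add_sub_cancel_left]

/-- Such a module is generated by its component of degree n. A k[z]-basis of that component
identifies it with a finite sum of copies of A⟨n⟩. -/
theorem cls_mem_of_surj {P : Gr k} (hP : GrMod.IsFGProj P) {n : ℤ} (hX : SurjXFrom P n)
    (hY : SurjYBelow P n) : GrMod.cls P hP ∈ shSubgroup k := by
  obtain ⟨r, b, hb⟩ := exists_basis (IsFGProj.finDeg hP) (IsFGProj.torsionFree hP) n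
  obtain ⟨L, f, ⟨hL, hLG⟩, h1, h2⟩ := exists_free b hb.mem
    (C := fun L : Gr k => ∃ hL : GrMod.IsFGProj L, GrMod.cls L hL ∈ shSubgroup k)
    ⟨isFGProj_zeroMod, by
      -- The zero module is its own double, so its class satisfies c = c + c.
      have h := GrMod.cls_add isFGProj_zeroMod isFGProj_zeroMod
        (⟨zeroMod k, 0, 0, 0, 0, GrMod.hom_ext fun m => (zeroMod_eq_zero _).trans (zeroMod_eq_zero m).symm,
          GrMod.hom_ext fun m => (zeroMod_eq_zero _).trans (zeroMod_eq_zero _).symm,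
          GrMod.hom_ext fun m => (zeroMod_eq_zero _).trans (zeroMod_eq_zero _).symm,
          GrMod.hom_ext fun m => (zeroMod_eq_zero _).trans (zeroMod_eq_zero _).symm⟩ :
          BinaryBicone (zeroMod k) (zeroMod k))
        (isBinaryBilimitOfTotal _
          (GrMod.hom_ext fun m => (zeroMod_eq_zero _).trans (zeroMod_eq_zero _).symm)) isFGProj_zeroMod
      have h0 : GrMod.cls (zeroMod k) isFGProj_zeroMod = 0 := by simpa using h
      rw [h0]; exact AddSubgroup.zero_mem _⟩
    (fun L ⟨hL, hLG⟩ => ⟨hL.prod (GrMod.isFGProj_shift_regular n), by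
      rw [GrMod.cls_prod hL (GrMod.isFGProj_shift_regular n)]; exact AddSubgroup.add_mem _ hLG (sh_mem n)⟩)
  have e : L ≅ P := GrMod.isoOfBijective f
    (injective_of_deg (IsFGProj.torsionFree hL) f n fun l hl h0 => by
      obtain ⟨p, hp, hp0⟩ := h1 l hl
      exact hp0 (hb.eq_zero p (hp.symm.trans h0)))
    (surjective_of_deg f hX hY fun m hm => by
      obtain ⟨p, rfl⟩ := hb.span m hm
      choose l hl using h2
      exact ⟨∑ i, act L (aeval (z k) (p i)) (l i), by rw [hom_act_sum]; simp only [hl]⟩)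
  rw [GrMod.cls_eq hP hL e.symm]
  exact hLG

/-- The interval from n to n + d contains the degrees where surjectivity may fail. To shorten it,
nonzero morphisms to Y⟨j⟩ at its upper end are replaced by their kernels. This changes the class
only by [A⟨j+1⟩] − [A⟨j⟩], and it stops because the dimension of the space of such morphisms drops
each time. -/
theorem cls_mem_of_surj_add (d : ℕ) : ∀ {P : Gr k} (hP : GrMod.IsFGProj P) {n : ℤ},
    SurjXFrom P (n + d) → SurjYBelow P n → GrMod.cls P hP ∈ shSubgroup k := by
  induction d with
  | zero =>
    intro P hP n hX hY
    rw [Nat.cast_zero, add_zero] at hX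
    exact cls_mem_of_surj hP hX hY
  | succ d ih =>
    suffices h : ∀ c : ℕ, ∀ {P : Gr k} (hP : GrMod.IsFGProj P) {n : ℤ},
        Module.finrank k (P ⟶ yMod k (n + d)) ≤ c → SurjXFrom P (n + d + 1) → SurjYBelow P n →
        GrMod.cls P hP ∈ shSubgroup k by
      intro P hP n hX hY
      rw [Nat.cast_succ, ← add_assoc] at hX
      exact h _ hP le_rfl hX hY
    intro c
    induction c with
    | zero =>
      intro P hP n hc hX hY
      refine ih hP (hX.pred fun F => ?_) hY
      have := finite_hom hP.1 (finite_deg_yMod (k := k) (n + d))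
      have := Module.finrank_zero_iff.1 (Nat.le_zero.1 hc)
      exact Subsingleton.elim _ _
    | succ c ihc =>
      intro P hP n hc hX hY
      by_cases h : ∀ F : P ⟶ yMod k (n + d), F = 0
      · exact ih hP (hX.pred h) hY
      · push Not at h
        obtain ⟨f, hf⟩ := h
        obtain ⟨hK, hcls⟩ := exists_cls_kerMod hP hf
        rw [hcls]
        refine AddSubgroup.sub_mem _ (AddSubgroup.add_mem _ ?_ (sh_mem _)) (sh_mem _)
        exact ihc hK (by have := finrank_kerMod_lt hP.1 hf; omega) (hX.kerMod f)
          (hY.kerMod (by omega) f)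

theorem cls_mem {P : Gr k} (hP : GrMod.IsFGProj P) : GrMod.cls P hP ∈ shSubgroup k := by
  obtain ⟨b, hb⟩ := IsFGProj.surjX hP
  obtain ⟨a, ha⟩ := IsFGProj.surjY hP
  have hX : SurjXFrom P (min a b + (b - min a b).toNat) := fun i hi => hb i (by omega)
  exact cls_mem_of_surj_add _ hP hX fun i hi => ha i (by omega)

theorem shSubgroup_eq_top : shSubgroup k = ⊤ := by
  refine eq_top_iff.2 fun a _ => ?_
  exact GrMod.K0_induction (p := fun a => a ∈ shSubgroup k) (fun P hP => cls_mem hP)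
    (fun _ _ => AddSubgroup.add_mem _) (fun _ => AddSubgroup.neg_mem _) (AddSubgroup.zero_mem _) a

/-! ### Recognition of the shifts of the Weyl algebra -/

/-- The vanishing of morphisms makes P a sum of r copies of A⟨n⟩, where r is the rank of P_n over
k[z]. Distinct basis elements are separated by morphisms to X⟨n⟩, so a one-dimensional space of
these leaves only r = 1. -/
theorem nonempty_iso_sh {P : Gr k} (hP : GrMod.IsFGProj P) {n : ℤ}
    (hx : ∀ i, i < n → ∀ F : P ⟶ xMod k i, F = 0) (hy : ∀ i, n ≤ i → ∀ F : P ⟶ yMod k i, F = 0)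
    (h1 : Module.finrank k (P ⟶ xMod k n) = 1) : Nonempty (sh k n ≅ P) := by
  have hX := surjXFrom_of_hom hy
  have hY := surjYBelow_of_hom hx
  obtain ⟨r, b, hb⟩ := exists_basis (IsFGProj.finDeg hP) (IsFGProj.torsionFree hP) n
  have key : ∀ i i' : Fin r, i ≠ i' → ∃ F : P ⟶ xMod k n, F.1 (b i) ≠ 0 ∧ F.1 (b i') = 0 := by
    intro i i' hii
    -- By surjectivity of x onto degree n+1, the image of y in degree n is P_n z. An element of P_n
    -- z plus a multiple of `b i'` has a coefficient at `b i` that vanishes at z = 0, whereas `b i`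
    -- itself has coefficient 1.
    have hnot : b i ∉ (P.deg (n + 1)).map (mY P) ⊔ Submodule.span k {b i'} := by
      intro hmem
      obtain ⟨_, ⟨m', hm', rfl⟩, _, hw, h⟩ := Submodule.mem_sup.1 hmem
      obtain ⟨c, rfl⟩ := Submodule.mem_span_singleton.1 hw
      obtain ⟨m, hm, rfl⟩ := hX n le_rfl m' hm'
      obtain ⟨p, rfl⟩ := hb.span m hm
      have h2 := hb.eq_zero (fun l => Polynomial.X * p l + (if l = i' then C c else 0) - if l = i then 1 else 0) (by
        have e1 : ∑ l, act P (aeval (z k) (Polynomial.X * p l)) (b l) =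
            mY P (mX P (∑ l, act P (aeval (z k) (p l)) (b l))) := by
          rw [map_sum, map_sum]
          exact Finset.sum_congr rfl fun l _ => by rw [act_aeval_mul, aeval_X, act_z]
        have e2 : ∀ (l' : Fin r) (q : k[X]),
            ∑ l, act P (aeval (z k) (if l = l' then q else 0)) (b l) =
              act P (aeval (z k) q) (b l') := fun l' q => by
          rw [Finset.sum_eq_single l' (fun l _ hl => ?_) (by simp), if_pos rfl]
          rw [if_neg hl, map_zero, act_apply, MulOpposite.op_zero, zero_smul]
        simp only [map_sub, map_add, act_sub, act_add, Finset.sum_sub_distrib,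
          Finset.sum_add_distrib, e1, e2]
        rw [aeval_C, act_algebraMap, h, map_one, act_one, sub_self])
      have h3 := congrArg (eval 0) (congrFun h2 i)
      simp [hii] at h3
    obtain ⟨φ, hφ, hle⟩ := Submodule.exists_le_ker_of_notMem hnot
    obtain ⟨F, hF⟩ := exists_hom_xMod n φ fun m' hm' => hle (Submodule.mem_sup_left ⟨m', hm', rfl⟩)
    have hF' : ∀ m ∈ P.deg n, (xSeq k n).val n (F.1 m) = φ m := fun m hm => by
      have := hF 0 m (by simpa using hm)
      rwa [Nat.cast_zero, sub_zero, pow_zero, Module.End.one_apply] at this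
    refine ⟨F, fun h0 => hφ ?_, Seq.ext_deg _ (F.2 _ _ (hb.mem i')) (Submodule.zero_mem _) ?_⟩
    · rw [← hF' _ (hb.mem i), h0, map_zero]
    · rw [hF' _ (hb.mem i'), map_zero]
      exact hle (Submodule.mem_sup_right (Submodule.mem_span_singleton_self _))
  have hr : r ≤ 1 := by
    by_contra! hr
    obtain ⟨F, hF, hF0⟩ := key ⟨0, by omega⟩ ⟨1, by omega⟩ (by simp)
    obtain ⟨F', hF', -⟩ := key ⟨1, by omega⟩ ⟨0, by omega⟩ (by simp)
    obtain ⟨c, rfl⟩ := (finrank_eq_one_iff_of_nonzero' F (by rintro rfl; exact hF rfl)).1 h1 F'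
    exact hF' (by rw [GrMod.smul_apply, hF0, smul_zero])
  obtain ⟨F, hF⟩ : ∃ F : P ⟶ xMod k n, F ≠ 0 := by
    have : 0 < Module.finrank k (P ⟶ xMod k n) := by omega
    have := Module.finite_of_finrank_pos this
    exact Module.finrank_pos_iff_exists_ne_zero.1 ‹_›
  have hr0 : r ≠ 0 := by
    rintro rfl
    refine hF (GrMod.hom_ext_homog fun i m hm => ?_)
    by_cases hi : n < i
    · exact xMod_eq_zero hi (F.2 _ _ hm)
    obtain ⟨d, rfl⟩ : ∃ d : ℕ, i = n - d := ⟨(n - i).toNat, by omega⟩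
    obtain ⟨m', hm', rfl⟩ := hY.exists_pow d hm
    obtain ⟨p, hp⟩ := hb.span m' hm'
    rw [hp]
    simp
  obtain rfl : r = 1 := by omega
  refine ⟨GrMod.isoOfBijective (P.ofElem n (b 0) (hb.mem 0))
    (injective_of_deg (torsionFree_sh n) _ n fun l hl h0 => ?_)
    (surjective_of_deg _ hX hY fun m hm => ?_)⟩
  · obtain ⟨p, hp⟩ := exists_act_unit hl
    rw [sub_self, show homogGen k 0 = 1 from pow_zero _, act_one] at hp
    rw [hp, hom_act, GrMod.ofElem_unit] at h0
    have := hb.eq_zero (fun _ => p) (by simpa using h0)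
    rw [hp, show p = 0 from congrFun this 0, map_zero]
    exact zero_smul _ _
  · obtain ⟨p, rfl⟩ := hb.span m hm
    exact ⟨act _ (aeval (z k) (p 0)) (GrMod.unit _ n), by
      rw [hom_act, GrMod.ofElem_unit]; simp⟩

end CharZero

end Weyl

namespace Weyl

open MulOpposite Polynomial

variable {k : Type u} [Field k]

/-! ### The rank of the Weyl algebra -/

theorem aeval_act (M : Gr k) (p : k[X]) (m : M) :
    aeval (act M (z k)) p m = act M (aeval (z k) p) m := by
  induction p using Polynomial.induction_on with
  | C c => rw [aeval_C, aeval_C, act_algebraMap]; rfl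
  | add p q hp hq => rw [map_add, map_add, act_add, ← hp, ← hq]; rfl
  | monomial i c ih =>
    have h1 : aeval (act M (z k)) (C c * Polynomial.X ^ i * Polynomial.X) m =
        act M (z k) (aeval (act M (z k)) (C c * Polynomial.X ^ i) m) := by
      rw [mul_comm, map_mul, aeval_X]; rfl
    have h2 : act M (aeval (z k) (C c * Polynomial.X ^ i * Polynomial.X)) m =
        act M (z k) (act M (aeval (z k) (C c * Polynomial.X ^ i)) m) := by
      rw [map_mul _ _ Polynomial.X, aeval_X, act_mul]
    rw [pow_succ, ← mul_assoc, h1, h2, ← ih]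

variable (k) in
/-- The Weyl algebra as a right module over `k[z]`. -/
abbrev ZMod' : Type u := Module.AEval' (act (reg k) (z k))

variable (k) in
/-- An element of the Weyl algebra as an element of a module over `k[z]`. -/
noncomputable def toZ : Weyl k ≃ₗ[k] ZMod' k := Module.AEval'.of (act (reg k) (z k))

theorem toZ_mul_aeval (a : Weyl k) (p : k[X]) : toZ k (a * aeval (z k) p) = p • toZ k a := by
  have h := aeval_act (reg k) p a
  have h2 : p • toZ k a = toZ k (aeval (act (reg k) (z k)) p a) := rfl
  rw [h2, h]
  rfl

theorem exists_bound (M : Gr k) (u : M) : ∃ (c : ℕ) (f : ℤ → M), (∀ d, f d ∈ M.deg d) ∧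
    ∑ d ∈ Finset.Icc (-(c : ℤ)) c, f d = u := by
  obtain ⟨s, hs⟩ := M.sum_proj u
  refine ⟨s.sup Int.natAbs, fun d => if d ∈ s then M.proj d u else 0, fun d => ?_, ?_⟩
  · dsimp only
    split_ifs
    exacts [M.proj_mem d u, Submodule.zero_mem _]
  · rw [Finset.sum_ite_mem, Finset.inter_eq_right.2 fun d hd => ?_]
    · exact hs
    · have : d.natAbs ≤ s.sup Int.natAbs := Finset.le_sup (f := Int.natAbs) hd
      rw [Finset.mem_Icc]
      omega

open Classical in
theorem toZ_mul_mem {c N : ℕ} {f : ℤ → Weyl k} (hf : ∀ d, f d ∈ grading k d) {i : ℕ} (hi : i ≤ N) :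
    toZ k ((∑ d ∈ Finset.Icc (-(c : ℤ)) c, f d) * x k ^ i) ∈ Submodule.span k[X]
      (((Finset.Icc (-(c : ℤ)) (N + c)).image fun d => toZ k (homogGen k d) : Finset (ZMod' k)) :
        Set (ZMod' k)) := by
  rw [Finset.sum_mul, map_sum]
  refine Submodule.sum_mem _ fun d hd => ?_
  rw [Finset.mem_Icc] at hd
  obtain ⟨p, hp⟩ := exists_eq_homogGen_mul (SetLike.mul_mem_graded (hf d) (x_pow_mem k i))
  rw [hp, toZ_mul_aeval]
  refine Submodule.smul_mem _ _ (Submodule.subset_span ?_)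
  exact Finset.mem_coe.2 (Finset.mem_image_of_mem _ (Finset.mem_Icc.2 (by omega)))

section CharZero

variable [CharZero k]

theorem sum_x_pow_mul_eq_zero {N : ℕ} {p : Fin N → k[X]}
    (h : ∑ i : Fin N, x k ^ (i : ℕ) * aeval (z k) (p i) = 0) : p = 0 := by
  funext i
  have h1 := (congrArg ((reg k).proj (i : ℕ)) h).trans (map_zero ((reg k).proj (i : ℕ)))
  have h2 : ∀ l : Fin N, x k ^ (l : ℕ) * aeval (z k) (p l) ∈ (reg k).deg (l : ℕ) := fun l => by
    have := SetLike.mul_mem_graded (x_pow_mem k l) (aeval_z_mem (p l))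
    rwa [add_zero] at this
  have h3 : (reg k).proj (i : ℕ) (∑ i : Fin N, x k ^ (i : ℕ) * aeval (z k) (p i) : Weyl k) =
      (x k ^ (i : ℕ) * aeval (z k) (p i) : Weyl k) := by
    refine (map_sum ((reg k).proj (i : ℕ)) _ _).trans ?_
    rw [Finset.sum_eq_single i (fun l _ hl => (reg k).proj_ne (h2 l) fun h => hl ?_) (by simp),
      (reg k).proj_same (h2 i)]
    exact Fin.ext (by exact_mod_cast h)
  exact eq_zero_of_homogGen_mul (d := (i : ℕ)) (h3.symm.trans h1)

/-- The Weyl algebra satisfies the right Ore condition. -/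
theorem exists_mul_add_mul_eq_zero (u w : Weyl k) :
    ∃ a b : Weyl k, ¬ (a = 0 ∧ b = 0) ∧ u * a + w * b = 0 := by
  classical
  obtain ⟨c, f, hf, hu⟩ : ∃ (c : ℕ) (f : ℤ → Weyl k), (∀ d, f d ∈ grading k d) ∧
    ∑ d ∈ Finset.Icc (-(c : ℤ)) c, f d = u := exists_bound (reg k) u
  obtain ⟨c', f', hf', hw⟩ : ∃ (c : ℕ) (f : ℤ → Weyl k), (∀ d, f d ∈ grading k d) ∧
    ∑ d ∈ Finset.Icc (-(c : ℤ)) c, f d = w := exists_bound (reg k) w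
  -- The 2(N + 1) elements u x^i and w x^i with i ≤ N lie in the k[z]-span of the generators of
  -- degrees −(c + c') to N + c + c'. There are N + 2(c + c') + 1 = 2N + 1 of these, one too few for
  -- independence.
  let N := 2 * (c + c')
  let v : Fin (N + 1) ⊕ Fin (N + 1) → ZMod' k :=
    Sum.elim (fun i => toZ k (u * x k ^ (i : ℕ))) fun i => toZ k (w * x k ^ (i : ℕ))
  have hdep : ¬ LinearIndependent k[X] v := by
    intro hv
    have hle : ∀ {c₁ : ℕ}, c₁ ≤ c + c' → Submodule.span k[X]
        (((Finset.Icc (-(c₁ : ℤ)) (N + c₁)).image fun d => toZ k (homogGen k d) :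
          Finset (ZMod' k)) : Set (ZMod' k)) ≤ Submodule.span k[X]
        (((Finset.Icc (-((c + c' : ℕ) : ℤ)) (N + (c + c' : ℕ))).image fun d => toZ k (homogGen k d) :
          Finset (ZMod' k)) : Set (ZMod' k)) := fun h =>
      Submodule.span_mono (Finset.coe_subset.2 (Finset.image_subset_image
        (Finset.Icc_subset_Icc (by push_cast; omega) (by push_cast; omega))))
    have h1 := linearIndependent_le_span' v hv
      (((Finset.Icc (-((c + c' : ℕ) : ℤ)) (N + (c + c' : ℕ))).image fun d => toZ k (homogGen k d) :
          Finset (ZMod' k)) : Set (ZMod' k)) (by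
      rintro _ ⟨i | i, rfl⟩
      · refine hle (c₁ := c) (by omega) ?_
        simp only [v, Sum.elim_inl, ← hu]
        exact toZ_mul_mem hf (by omega)
      · refine hle (c₁ := c') (by omega) ?_
        simp only [v, Sum.elim_inr, ← hw]
        exact toZ_mul_mem hf' (by omega))
    rw [Cardinal.mk_fintype, Nat.cast_le, Fintype.card_sum, Fintype.card_fin] at h1
    simp only [Finset.coe_sort_coe, Fintype.card_coe] at h1
    have h2 := h1.trans Finset.card_image_le
    rw [Int.card_Icc] at h2
    omega
  rw [Fintype.linearIndependent_iff] at hdep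
  push Not at hdep
  obtain ⟨p, hp, i, hi⟩ := hdep
  refine ⟨∑ i : Fin (N + 1), x k ^ (i : ℕ) * aeval (z k) (p (.inl i)),
    ∑ i : Fin (N + 1), x k ^ (i : ℕ) * aeval (z k) (p (.inr i)), fun h => hi ?_, (toZ k).injective ?_⟩
  · rcases i with i | i
    · exact congrFun (sum_x_pow_mul_eq_zero h.1) i
    · exact congrFun (sum_x_pow_mul_eq_zero h.2) i
  · rw [Fintype.sum_sum_type] at hp
    simp only [v, Sum.elim_inl, Sum.elim_inr, ← toZ_mul_aeval] at hp
    rw [map_zero, ← hp, map_add, Finset.mul_sum, Finset.mul_sum, map_sum, map_sum]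
    simp only [mul_assoc]

theorem rank_weyl : Module.rank (Weyl k)ᵐᵒᵖ (Weyl k) = 1 := by
  have : Nontrivial (Weyl k) := ⟨⟨1, 0, unit_ne_zero (k := k) 0⟩⟩
  refine le_antisymm ?_ ?_
  · rw [← Nat.cast_one]
    refine rank_le fun s hs => ?_
    by_contra! hcard
    obtain ⟨u, hu, w, hw, hne⟩ := Finset.one_lt_card.1 hcard
    obtain ⟨a, b, hab, h⟩ := exists_mul_add_mul_eq_zero u w
    have h1 := hs.comp ![⟨u, hu⟩, ⟨w, hw⟩] (by
      intro i j hij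
      fin_cases i <;> fin_cases j <;> simp_all)
    have h2 : LinearIndependent (Weyl k)ᵐᵒᵖ ![u, w] := by
      convert h1 using 1
      ext i
      fin_cases i <;> rfl
    have h3 := LinearIndependent.pair_iff.1 h2 (op a) (op b) h
    exact hab ⟨congrArg unop h3.1, congrArg unop h3.2⟩
  · have h1 : LinearIndependent (Weyl k)ᵐᵒᵖ (fun _ : PUnit.{u + 1} => (1 : Weyl k)) := by
      rw [Fintype.linearIndependent_iff]
      intro g hg _
      have h2 : (g PUnit.unit) • (1 : Weyl k) = 0 := by simpa using hg
      exact unop_injective ((one_mul (unop (g PUnit.unit))).symm.trans h2)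
    simpa using h1.cardinal_le_rank

theorem isRankOneProj_sh (n : ℤ) : GrMod.IsRankOneProj (sh k n) :=
  ⟨GrMod.isFGProj_shift_regular n, rank_weyl⟩

end CharZero

end Weyl

namespace Weyl

open MulOpposite Polynomial

variable {k : Type u} [Field k]

/-! ### Functors determined by the shifts of the Weyl algebra -/

variable (k) in
/-- Left multiplication by `x`. -/
noncomputable def shX (n : ℤ) : sh k (n + 1) ⟶ sh k n :=
  (sh k n).ofElem (n + 1) (mX _ (GrMod.unit _ n)) (mX_mem (GrMod.unit_mem n))

variable (k) in
/-- Left multiplication by `y`. -/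
noncomputable def shY (n : ℤ) : sh k n ⟶ sh k (n + 1) :=
  (sh k (n + 1)).ofElem n (mY _ (GrMod.unit _ (n + 1))) (mY_mem (GrMod.unit_mem (n + 1)))

@[simp] theorem shX_unit (n : ℤ) : (shX k n).1 (GrMod.unit _ (n + 1)) = mX _ (GrMod.unit _ n) :=
  GrMod.ofElem_unit _ _ _ _

@[simp] theorem shY_unit (n : ℤ) : (shY k n).1 (GrMod.unit _ n) = mY _ (GrMod.unit _ (n + 1)) :=
  GrMod.ofElem_unit _ _ _ _

theorem shX_ofElem {M : Gr k} {n : ℤ} {m : M} (hm : m ∈ M.deg n) :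
    shX k n ≫ M.ofElem n m hm = M.ofElem (n + 1) (mX M m) (mX_mem hm) :=
  GrMod.hom_regular_ext (by
    rw [GrMod.comp_apply, shX_unit, hom_mX, GrMod.ofElem_unit, GrMod.ofElem_unit])

theorem shY_ofElem {M : Gr k} {n : ℤ} {m : M} (hm : m ∈ M.deg (n + 1)) :
    shY k n ≫ M.ofElem (n + 1) m hm = M.ofElem n (mY M m) (mY_mem hm) :=
  GrMod.hom_regular_ext (by
    rw [GrMod.comp_apply, shY_unit, hom_mY, GrMod.ofElem_unit, GrMod.ofElem_unit])

section Compare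

variable {E : Gr k ⥤ Gr k} [E.Additive] [E.Linear k] (φ : ∀ n, sh k n ≅ E.obj (sh k n))

/-- The comparison of the components of a module and of its image under a functor. -/
noncomputable def compareAt (n : ℤ) (M : Gr k) : M →ₗ[k] E.obj M :=
  ((E.obj M).deg n).subtype ∘ₗ (GrMod.homRegularEquiv (E.obj M) n).toLinearMap ∘ₗ
    Linear.leftComp k (E.obj M) (φ n).hom ∘ₗ E.mapLinearMap k ∘ₗ
    (GrMod.homRegularEquiv M n).symm.toLinearMap ∘ₗ
    (M.proj n).codRestrict (M.deg n) (M.proj_mem n)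

theorem compareAt_apply {n : ℤ} {M : Gr k} {m : M} (hm : m ∈ M.deg n) :
    compareAt φ n M m = ((φ n).hom ≫ E.map (M.ofElem n m hm)).1 (GrMod.unit _ n) := by
  have h : (M.proj n).codRestrict (M.deg n) (M.proj_mem n) m = ⟨m, hm⟩ :=
    Subtype.ext (M.proj_same hm)
  simp only [compareAt, LinearMap.comp_apply]
  rw [h]
  rfl

variable (hx : ∀ n, shX k n ≫ (φ n).hom = (φ (n + 1)).hom ≫ E.map (shX k n))
  (hy : ∀ n, shY k n ≫ (φ (n + 1)).hom = (φ n).hom ≫ E.map (shY k n))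

include hx hy

/-- An element of M_n is a morphism A⟨n⟩ → M. Applying E and composing with φ n turns it into an
element of (E M)_n, and `hx`, `hy` say exactly that this respects x and y. -/
theorem exists_compare (M : Gr k) :
    ∃ F : M ⟶ E.obj M, ∀ n m (hm : m ∈ M.deg n), M.ofElem n m hm ≫ F =
      (φ n).hom ≫ E.map (M.ofElem n m hm) := by
  obtain ⟨F, hF⟩ := exists_hom (fun n => compareAt φ n M)
    (fun n m hm => by
      rw [compareAt_apply φ hm]
      exact ((φ n).hom ≫ E.map (M.ofElem n m hm)).2 _ _ (GrMod.unit_mem n))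
    (fun n m hm => by
      rw [compareAt_apply φ hm, compareAt_apply φ (mX_mem hm), ← shX_ofElem, E.map_comp,
        ← Category.assoc, ← hx, Category.assoc, GrMod.comp_apply, shX_unit, hom_mX])
    (fun n m hm => by
      rw [compareAt_apply φ hm, compareAt_apply φ (mY_mem hm), ← shY_ofElem, E.map_comp,
        ← Category.assoc, ← hy, Category.assoc, GrMod.comp_apply, shY_unit, hom_mY])
  refine ⟨F, fun n m hm => GrMod.hom_regular_ext ?_⟩
  rw [GrMod.comp_apply, GrMod.ofElem_unit, hF n m hm, compareAt_apply φ hm]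

/-- A fully faithful functor which fixes the modules `A⟨n⟩`, compatibly with the multiplications
by the generators, is isomorphic to the identity. -/
theorem nonempty_id_iso [E.Full] [E.Faithful] : Nonempty (𝟭 (Gr k) ≅ E) := by
  choose F hF using exists_compare φ hx hy
  have hval : ∀ M n m (hm : m ∈ M.deg n), (F M).1 m =
      ((φ n).hom ≫ E.map (M.ofElem n m hm)).1 (GrMod.unit _ n) := fun M n m hm => by
    rw [← hF, GrMod.comp_apply, GrMod.ofElem_unit]
  have hinj : ∀ M, Function.Injective (F M).1 := fun M =>
    GrMod.injective_of_homog _ fun n m hm h0 => by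
      rw [hval M n m hm] at h0
      have h1 : (φ n).hom ≫ E.map (M.ofElem n m hm) = (φ n).hom ≫ E.map 0 := by
        refine GrMod.hom_regular_ext ?_
        rw [h0, E.map_zero, Limits.comp_zero, GrMod.zero_apply]
      have h2 := E.map_injective ((cancel_epi _).1 h1)
      rw [← GrMod.ofElem_unit M n m hm, h2, GrMod.zero_apply]
  -- By fullness, an element of (E M)_n, seen as a morphism from E A⟨n⟩, is the image of a morphism
  -- A⟨n⟩ → M; injectivity came from faithfulness in the same way.
  have hsurj : ∀ M, Function.Surjective (F M).1 := fun M =>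
    GrMod.surjective_of_homog _ fun n m' hm' => by
      obtain ⟨g, hg⟩ := E.map_surjective ((φ n).inv ≫ (E.obj M).ofElem n m' hm')
      have hm := g.2 n _ (GrMod.unit_mem n)
      have hg' : g = M.ofElem n (g.1 (GrMod.unit _ n)) hm :=
        GrMod.hom_regular_ext (GrMod.ofElem_unit _ _ _ _).symm
      refine ⟨g.1 (GrMod.unit _ n), ?_⟩
      rw [hval M n _ hm, ← hg', hg, Iso.hom_inv_id_assoc, GrMod.ofElem_unit]
  refine ⟨NatIso.ofComponents (fun M => GrMod.isoOfBijective (F M) (hinj M) (hsurj M))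
    fun {M N} f => GrMod.hom_ext_homog fun n m hm => ?_⟩
  have h1 : M.ofElem n m hm ≫ f ≫ F N = M.ofElem n m hm ≫ F M ≫ E.map f := by
    rw [← Category.assoc, GrMod.ofElem_comp, hF, ← GrMod.ofElem_comp, E.map_comp, ← Category.assoc,
      ← hF, Category.assoc]
  have h2 := congrArg (fun g => g.1 (GrMod.unit _ n)) h1
  simp only [GrMod.comp_apply, GrMod.ofElem_unit] at h2
  exact h2

end Compare

/-- Autoequivalences which agree on the modules `A⟨n⟩` are isomorphic. -/
theorem nonempty_iso_of_sh (F G : LinAutoequiv k (Gr k))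
    (θ : ∀ n, F.toEquiv.functor.obj (sh k n) ≅ G.toEquiv.functor.obj (sh k n))
    (hx : ∀ n, F.toEquiv.functor.map (shX k n) ≫ (θ n).hom =
      (θ (n + 1)).hom ≫ G.toEquiv.functor.map (shX k n))
    (hy : ∀ n, F.toEquiv.functor.map (shY k n) ≫ (θ (n + 1)).hom =
      (θ n).hom ≫ G.toEquiv.functor.map (shY k n)) :
    Nonempty (F.toEquiv.functor ≅ G.toEquiv.functor) := by
  -- This functor fixes the modules A⟨n⟩ compatibly with x and y, so the comparison with the
  -- identity applies to it.
  let E := G.toEquiv.functor ⋙ F.toEquiv.inverse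
  have hcomp : ∀ {M N : Gr k} (f : M ⟶ N) (u : F.toEquiv.functor.obj M ⟶ G.toEquiv.functor.obj M)
      (v : F.toEquiv.functor.obj N ⟶ G.toEquiv.functor.obj N),
      F.toEquiv.functor.map f ≫ v = u ≫ G.toEquiv.functor.map f →
      f ≫ F.toEquiv.unit.app N ≫ F.toEquiv.inverse.map v =
        (F.toEquiv.unit.app M ≫ F.toEquiv.inverse.map u) ≫ E.map f := by
    intro M N f u v h
    have h1 : f ≫ F.toEquiv.unit.app N =
        F.toEquiv.unit.app M ≫ F.toEquiv.inverse.map (F.toEquiv.functor.map f) :=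
      F.toEquiv.unit.naturality f
    rw [← Category.assoc, h1, Category.assoc, Category.assoc, ← F.toEquiv.inverse.map_comp, h,
      F.toEquiv.inverse.map_comp]
    rfl
  have hE : Nonempty (𝟭 (Gr k) ≅ E) := by
    refine nonempty_id_iso (E := E) (fun n => F.toEquiv.unitIso.app _ ≪≫
      F.toEquiv.inverse.mapIso (θ n)) (fun n => ?_) fun n => ?_
    · exact hcomp _ _ _ (hx n)
    · exact hcomp _ _ _ (hy n)
  obtain ⟨i⟩ := hE
  exact ⟨(F.toEquiv.functor.leftUnitor.symm ≪≫ Functor.isoWhiskerRight i F.toEquiv.functor) ≪≫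
    Functor.associator _ _ _ ≪≫ Functor.isoWhiskerLeft G.toEquiv.functor F.toEquiv.counitIso ≪≫
    G.toEquiv.functor.rightUnitor⟩

/-- Spaces of morphisms and fully faithful functors. -/
theorem finrank_map (F : Gr k ⥤ Gr k) [F.Additive] [F.Linear k] [F.Full] [F.Faithful]
    {P S S' : Gr k} (i : F.obj S ≅ S') :
    Module.finrank k (F.obj P ⟶ S') = Module.finrank k (P ⟶ S) :=
  ((LinearEquiv.ofBijective (F.mapLinearMap k (X := P) (Y := S))
    ⟨F.map_injective, F.map_surjective⟩).trans
      (Linear.homCongr k (Iso.refl _) i)).finrank_eq.symm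

theorem eq_zero_of_finrank {P S : Gr k} (hP : Module.Finite (Weyl k)ᵐᵒᵖ P)
    (hS : ∀ n, Module.Finite k (S.deg n)) (h : Module.finrank k (P ⟶ S) = 0) (F : P ⟶ S) : F = 0 := by
  have := finite_hom hP hS
  have := Module.finrank_zero_iff.1 h
  exact Subsingleton.elim _ _

theorem mY_act_aeval (M : Gr k) (p : k[X]) (m : M) :
    mY M (act M (aeval (z k) p) m) = act M (aeval (z k) (p.comp (Polynomial.X + C 1))) (mY M m) := by
  have h : aeval (z k) p * y k = y k * aeval (z k) (p.comp (Polynomial.X + C 1)) := by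
    induction p using Polynomial.induction_on with
    | C c => rw [C_comp, aeval_C, Algebra.commutes]
    | add p q hp hq => rw [map_add, add_mul, hp, hq, add_comp, map_add, mul_add]
    | monomial i c ih =>
      have h1 := z_mul_y_pow (k := k) 1
      rw [pow_one, Nat.cast_one] at h1
      rw [pow_succ, ← mul_assoc (C c), mul_comm _ Polynomial.X, map_mul, aeval_X, mul_assoc, ih,
        ← mul_assoc, h1, mul_assoc, mul_comp Polynomial.X, X_comp, map_mul (aeval (z k)) (_ + _), map_add, aeval_X,
        aeval_C]
  change act M (y k) _ = _
  rw [← act_mul, h, act_mul]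
  rfl

/-- The recursion is solved from l 0 = 1 in both directions. It provides the factors by which
isomorphisms at the A⟨n⟩ are rescaled to become compatible. -/
theorem exists_units_seq (d : ℤ → kˣ) : ∃ l : ℤ → kˣ, ∀ n, l (n + 1) = l n * d n := by
  let f : ℕ → kˣ := fun n => ∏ i ∈ Finset.range n, d i
  let g : ℕ → kˣ := fun n => ∏ i ∈ Finset.range n, (d (-(i + 1 : ℕ)))⁻¹
  refine ⟨fun n => if 0 ≤ n then f n.toNat else g (-n).toNat, fun n => ?_⟩
  obtain ⟨m, rfl | rfl⟩ := n.eq_nat_or_neg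
  · have h1 : ((m : ℤ) + 1).toNat = m + 1 := by omega
    beta_reduce
    rw [if_pos (by omega), if_pos (by omega), h1, Int.toNat_natCast]
    exact Finset.prod_range_succ _ _
  · rcases m with _ | m
    · simp [f]
    · have hg : g (m + 1) * d (-(m + 1 : ℕ)) = g m := by
        simp only [g]
        rw [Finset.prod_range_succ, inv_mul_cancel_right]
      have h1 : (- -((m + 1 : ℕ) : ℤ)).toNat = m + 1 := by omega
      beta_reduce
      rw [if_neg (show ¬ 0 ≤ -((m + 1 : ℕ) : ℤ) by omega), h1, hg]
      split_ifs with h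
      · obtain rfl : m = 0 := by omega
        simp [f, g]
      · congr 1; omega

section CharZero

variable [CharZero k]

/-- The modules A⟨n⟩ have rank one, so the functor on rank one projectives already contains all that
determines an autoequivalence. -/
theorem isIota_unique {j : ℤ} {c c' : Pic k} (h : IsIota k j c) (h' : IsIota k j c') : c = c' := by
  obtain ⟨e, rfl, ⟨α⟩⟩ := h
  obtain ⟨e', rfl, ⟨α'⟩⟩ := h'
  let β := α ≪≫ α'.symm
  refine Quotient.sound (nonempty_iso_of_sh e e' (fun n => β.app ⟨sh k n, isRankOneProj_sh n⟩)
    (fun n => ?_) fun n => ?_)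
  · exact β.hom.naturality (X := ⟨sh k (n + 1), isRankOneProj_sh (n + 1)⟩)
      (Y := ⟨sh k n, isRankOneProj_sh n⟩) (ObjectProperty.homMk (shX k n))
  · exact β.hom.naturality (X := ⟨sh k n, isRankOneProj_sh n⟩)
      (Y := ⟨sh k (n + 1), isRankOneProj_sh (n + 1)⟩) (ObjectProperty.homMk (shY k n))

theorem nonempty_iso_sh_of_finrank {P : Gr k} (hP : GrMod.IsFGProj P) {n : ℤ}
    (hx : ∀ i, Module.finrank k (P ⟶ xMod k i) = if n ≤ i then 1 else 0)
    (hy : ∀ i, Module.finrank k (P ⟶ yMod k i) = if i < n then 1 else 0) :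
    Nonempty (sh k n ≅ P) :=
  nonempty_iso_sh hP
    (fun i hi => eq_zero_of_finrank hP.1 (finite_deg_xMod i) (by rw [hx, if_neg (by omega)]))
    (fun i hi => eq_zero_of_finrank hP.1 (finite_deg_yMod i) (by rw [hy, if_neg (by omega)]))
    (by rw [hx, if_pos le_rfl])

theorem aeval_eq_of_eval {P : k[X]} {n : ℤ} (h : ∀ j : ℤ, n ≤ j → P.eval ((n : k) + -(j : k)) =
    (n : k) + -(j : k)) : P = Polynomial.X := by
  rw [← sub_eq_zero]
  refine Polynomial.eq_zero_of_infinite_isRoot _ ?_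
  have hinj : Function.Injective fun i : ℕ => (n : k) + -(((n + i : ℤ) : k)) :=
    fun a b hab => by simpa using hab
  refine (Set.infinite_range_of_injective hinj).mono ?_
  rintro _ ⟨i, rfl⟩
  have h1 : (P - Polynomial.X).eval ((n : k) + -(((n + i : ℤ) : k))) = 0 := by
    rw [eval_sub, eval_X, h _ (by omega), sub_self]
  exact h1

/-- An autoequivalence which fixes the simple modules `X⟨j⟩`, `Y⟨j⟩` is isomorphic to the identity. -/
theorem nonempty_id_iso_of_fix (F : Gr k ⥤ Gr k) [F.IsEquivalence] [F.Additive] [F.Linear k]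
    (hF : ∀ n, GrMod.IsFGProj (F.obj (sh k n)))
    (hX : ∀ j, Nonempty (F.obj (xMod k j) ≅ xMod k j))
    (hY : ∀ j, Nonempty (F.obj (yMod k j) ≅ yMod k j)) : Nonempty (𝟭 (Gr k) ≅ F) := by
  have hψ : ∀ n, Nonempty (sh k n ≅ F.obj (sh k n)) := fun n =>
    nonempty_iso_sh_of_finrank (hF n)
      (fun i => by rw [finrank_map F (hX i).some, finrank_sh_xMod])
      (fun i => by rw [finrank_map F (hY i).some, finrank_sh_yMod])
  let ψ : ∀ n, sh k n ≅ F.obj (sh k n) := fun n => (hψ n).some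
  -- Left multiplication by z on A⟨n⟩ acts on Hom(A⟨n⟩, X⟨j⟩) by the scalar n − j. The functor is
  -- linear and fixes X⟨j⟩, so the transported endomorphism, a polynomial in z, has value n − j at n
  -- − j for every j ≥ n; hence it is z.
  have hz : ∀ n, (ψ n).hom ≫ F.map (shY k n ≫ shX k n) ≫ (ψ n).inv = shY k n ≫ shX k n := by
    intro n
    set e := (ψ n).hom ≫ F.map (shY k n ≫ shX k n) ≫ (ψ n).inv
    obtain ⟨P, hP⟩ := exists_act_unit (e.2 n _ (GrMod.unit_mem n))
    rw [sub_self, show homogGen k 0 = 1 from pow_zero _, act_one] at hP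
    have hPX : P = Polynomial.X := by
      refine aeval_eq_of_eval (n := n) fun j hj => ?_
      obtain ⟨h, hh⟩ : ∃ h : sh k n ⟶ xMod k j, h ≠ 0 := by
        by_contra! h
        have : Subsingleton (sh k n ⟶ xMod k j) := ⟨fun a b => by rw [h a, h b]⟩
        have h1 := finrank_sh_xMod (k := k) n j
        rw [Module.finrank_zero_of_subsingleton, if_pos hj] at h1
        exact zero_ne_one h1
      let i := (hX j).some
      let h' := (ψ n).hom ≫ F.map h ≫ i.hom
      have hh' : h' ≠ 0 := fun h0 => hh <| by
        apply F.map_injective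
        rw [← cancel_epi (ψ n).hom, ← cancel_mono i.hom, Category.assoc, F.map_zero,
          Limits.comp_zero, Limits.zero_comp]
        exact h0
      have h1 : (shY k n ≫ shX k n) ≫ h = ((n : k) + -(j : k)) • h := by
        refine GrMod.hom_regular_ext ?_
        rw [GrMod.comp_apply, GrMod.comp_apply, shY_unit, hom_mY, shX_unit, hom_mY, hom_mX,
          GrMod.smul_apply, xMod_scalarZ j n _ (h.2 _ _ (GrMod.unit_mem n))]
      have h2 : e ≫ h' = ((n : k) + -(j : k)) • h' := by
        simp only [e, h', Category.assoc, Iso.inv_hom_id_assoc]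
        rw [← Category.assoc (F.map _) (F.map h), ← F.map_comp, h1, F.map_smul, Linear.smul_comp,
          Linear.comp_smul]
      have h3 := congrArg (fun g => g.1 (GrMod.unit _ n)) h2
      simp only [GrMod.comp_apply, GrMod.smul_apply] at h3
      rw [hP, hom_act, (xMod_scalarZ j).act_aeval P (h'.2 _ _ (GrMod.unit_mem n)), ← sub_eq_zero,
        ← sub_smul, smul_eq_zero, sub_eq_zero] at h3
      refine h3.resolve_right fun h0 => hh' (GrMod.hom_regular_ext ?_)
      rw [h0, GrMod.zero_apply]
    refine GrMod.hom_regular_ext ?_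
    rw [hP, hPX, aeval_X, act_z, GrMod.comp_apply, shY_unit, hom_mY, shX_unit]
  -- The transported multiplications by x and y are x and y times polynomials. Their composite is
  -- still z, so the product of these polynomials (one of them translated by 1) is 1, and both are
  -- constants inverse to each other.
  have hUV : ∀ n, ∃ d : kˣ,
      (ψ (n + 1)).hom ≫ F.map (shX k n) ≫ (ψ n).inv = ((d⁻¹ : kˣ) : k) • shX k n ∧
      (ψ n).hom ≫ F.map (shY k n) ≫ (ψ (n + 1)).inv = (d : k) • shY k n := by
    intro n
    set U := (ψ (n + 1)).hom ≫ F.map (shX k n) ≫ (ψ n).inv with hU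
    set V := (ψ n).hom ≫ F.map (shY k n) ≫ (ψ (n + 1)).inv with hV
    have hVU : V ≫ U = shY k n ≫ shX k n := by
      rw [← hz n]
      simp [U, V]
    obtain ⟨p, hp⟩ := exists_act_unit (U.2 (n + 1) _ (GrMod.unit_mem (n + 1)))
    rw [add_sub_cancel_left, show homogGen k 1 = x k from pow_one _] at hp
    obtain ⟨q, hq⟩ := exists_act_unit (V.2 n _ (GrMod.unit_mem n))
    rw [show n - (n + 1) = -((1 : ℕ) : ℤ) by simp, homogGen_neg, pow_one] at hq
    have h1 : act _ (aeval (z k) (q * p.comp (Polynomial.X + C 1) * Polynomial.X - Polynomial.X))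
        (GrMod.unit (grading k) n) = 0 := by
      have h2 := congrArg (fun g => g.1 (GrMod.unit _ n)) hVU
      simp only [GrMod.comp_apply] at h2
      rw [hq, hom_act, hom_act, hp, shY_unit, hom_mY, shX_unit] at h2
      change act _ _ (mY _ (act _ _ (mX _ _))) = _ at h2
      rw [mY_act_aeval] at h2
      rw [map_sub, act_sub, act_aeval_mul, act_aeval_mul, aeval_X, act_z, h2, sub_self]
    have h3 : q * p.comp (Polynomial.X + C 1) * Polynomial.X - Polynomial.X = 0 := by
      by_contra h3
      exact unit_ne_zero n (torsionFree_sh n _ h3 n _ (GrMod.unit_mem n) h1)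
    have h4 : q * p.comp (Polynomial.X + C 1) = 1 := by
      rw [sub_eq_zero] at h3
      exact mul_right_cancel₀ Polynomial.X_ne_zero (h3.trans (one_mul _).symm)
    have hq1 : IsUnit q := .of_mul_eq_one _ h4
    have hp1 : IsUnit (p.comp (Polynomial.X + C 1)) := .of_mul_eq_one _ ((mul_comm _ _).trans h4)
    obtain ⟨d, hd, rfl⟩ := Polynomial.isUnit_iff.1 hq1
    have hp2 : p.natDegree = 0 := by
      have := natDegree_eq_zero_of_isUnit hp1
      rwa [natDegree_comp, natDegree_X_add_C, mul_one] at this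
    obtain ⟨c, rfl⟩ := natDegree_eq_zero.1 hp2
    rw [C_comp, ← C_mul, ← C_1, C_inj] at h4
    refine ⟨hd.unit, GrMod.hom_regular_ext ?_, GrMod.hom_regular_ext ?_⟩
    · rw [hp, aeval_C, act_algebraMap, GrMod.smul_apply, shX_unit]
      have : c = ((hd.unit⁻¹ : kˣ) : k) := by
        rw [Units.val_inv_eq_inv_val, IsUnit.unit_spec]
        exact eq_inv_of_mul_eq_one_right h4
      rw [this]; rfl
    · rw [hq, aeval_C, act_algebraMap, GrMod.smul_apply, shY_unit]; rfl
  choose d hd using hUV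
  -- One sequence of factors corrects x and y at once, because their constants are reciprocal.
  obtain ⟨l, hl⟩ := exists_units_seq d
  refine nonempty_id_iso (E := F) (fun n => ⟨(l n : k) • (ψ n).hom, ((l n)⁻¹ : kˣ).1 • (ψ n).inv,
    by simp [smul_smul], by simp [smul_smul]⟩) (fun n => ?_) fun n => ?_
  · have h1 := (hd n).1
    rw [← Category.assoc, Iso.comp_inv_eq] at h1
    rw [Linear.comp_smul, Linear.smul_comp, h1, Linear.smul_comp, smul_smul, ← Units.val_mul, hl,
      mul_inv_cancel_right]
  · have h1 := (hd n).2
    rw [← Category.assoc, Iso.comp_inv_eq] at h1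
    rw [Linear.comp_smul, Linear.smul_comp, h1, Linear.smul_comp, smul_smul, ← Units.val_mul, hl]

end CharZero

end Weyl

namespace Weyl

open MulOpposite Polynomial

variable {k : Type u} [Field k]

/-! ### The simple modules interchanged by an autoequivalence -/

variable (k) in
/-- The simple modules `X⟨j⟩` (for `a = 0`) and `Y⟨j⟩` (for `a = 1`). -/
noncomputable def simple (j : ℤ) (a : ZMod 2) : Gr k := if a = 0 then xMod k j else yMod k j

theorem simple_zero (j : ℤ) : simple k j 0 = xMod k j := if_pos rfl

theorem simple_one (j : ℤ) : simple k j 1 = yMod k j := if_neg one_ne_zero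

theorem zmod_two_cases (a : ZMod 2) : a = 0 ∨ a = 1 := by
  revert a; decide

theorem finite_deg_simple (j : ℤ) (a : ZMod 2) (n : ℤ) : Module.Finite k ((simple k j a).deg n) := by
  obtain rfl | rfl := zmod_two_cases a
  · rw [simple_zero]; exact finite_deg_xMod j n
  · rw [simple_one]; exact finite_deg_yMod j n

/-- The type of the simple modules with parameter `j` that are not quotients of `A⟨n⟩`. -/
def coType (n j : ℤ) : ZMod 2 := if n ≤ j then 1 else 0

theorem finrank_sh_simple (n j : ℤ) (a : ZMod 2) :
    Module.finrank k (sh k n ⟶ simple k j a) = if a = coType n j then 0 else 1 := by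
  obtain rfl | rfl := zmod_two_cases a
  · rw [simple_zero, finrank_sh_xMod]
    by_cases h : n ≤ j <;> simp [coType, h]
  · rw [simple_one, finrank_sh_yMod]
    by_cases h : n ≤ j
    · rw [if_neg (by omega), if_pos (by simp [coType, h])]
    · rw [if_pos (by omega), if_neg (by simp [coType, h])]

/-- Modulo two the dimension is an affine function of the type `a`, so exchanging the two simples
adds one to it. -/
theorem finrank_sh_simple_cast (n j : ℤ) (a : ZMod 2) :
    (Module.finrank k (sh k n ⟶ simple k j a) : ZMod 2) = a + coType n j := by
  rw [finrank_sh_simple]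
  generalize coType n j = b
  revert a b
  decide

/-- The functor `F` fixes `X⟨j⟩` and `Y⟨j⟩` if `ε = 0`, and interchanges them if `ε = 1`. -/
def IsSwap (F : Gr k ⥤ Gr k) (j : ℤ) (ε : ZMod 2) : Prop :=
  ∀ a, Nonempty (F.obj (simple k j a) ≅ simple k j (a + ε))

theorem IsSwap.comp {F G : Gr k ⥤ Gr k} {j : ℤ} {ε δ : ZMod 2} (hF : IsSwap F j ε)
    (hG : IsSwap G j δ) : IsSwap (F ⋙ G) j (ε + δ) := fun a => by
  obtain ⟨i⟩ := hF a
  obtain ⟨i'⟩ := hG (a + ε)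
  rw [← add_assoc]
  exact ⟨G.mapIso i ≪≫ i'⟩

theorem IsSwap.of_iso {F G : Gr k ⥤ Gr k} {j : ℤ} {ε : ZMod 2} (hF : IsSwap F j ε) (e : F ≅ G) :
    IsSwap G j ε := fun a => by
  obtain ⟨i⟩ := hF a
  exact ⟨(e.app _).symm ≪≫ i⟩

theorem isSwap_id (j : ℤ) : IsSwap (𝟭 (Gr k)) j 0 := fun a => by
  rw [add_zero]; exact ⟨Iso.refl _⟩

/-- Exactly one of X⟨j⟩ and Y⟨j⟩ receives a nonzero morphism from A⟨0⟩, and this tells them apart.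
-/
theorem eq_of_nonempty_iso_simple {j : ℤ} {a b : ZMod 2}
    (h : Nonempty (simple k j a ≅ simple k j b)) : a = b := by
  obtain ⟨i⟩ := h
  have h1 := (Linear.homCongr k (Iso.refl (sh k 0)) i).finrank_eq
  have h2 := congrArg (Nat.cast (R := ZMod 2)) h1
  rw [finrank_sh_simple_cast, finrank_sh_simple_cast] at h2
  exact add_right_cancel h2

theorem IsSwap.unique {F : Gr k ⥤ Gr k} {j : ℤ} {ε δ : ZMod 2} (h : IsSwap F j ε)
    (h' : IsSwap F j δ) : ε = δ := by
  obtain ⟨i⟩ := h 0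
  obtain ⟨i'⟩ := h' 0
  have := eq_of_nonempty_iso_simple ⟨i.symm ≪≫ i'⟩
  rwa [zero_add, zero_add] at this

/-- Counting the morphisms from the image of `A⟨n⟩` to a simple module. -/
theorem IsSwap.finrank_map_sh {F : Gr k ⥤ Gr k} [F.Additive] [F.Linear k] [F.Full] [F.Faithful]
    {j : ℤ} {ε : ZMod 2} (h : IsSwap F j ε) (n : ℤ) (a : ZMod 2) :
    Module.finrank k (F.obj (sh k n) ⟶ simple k j a) =
      Module.finrank k (sh k n ⟶ simple k j (a + ε)) := by
  obtain ⟨i⟩ := h (a + ε)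
  have h1 : a + ε + ε = a := by rw [add_assoc, CharTwo.add_self_eq_zero, add_zero]
  rw [h1] at i
  exact finrank_map F i

theorem nonempty_regular_iso_sh : Nonempty (sh k 0 ≅ reg k) := by
  let u : Weyl k := 1
  refine ⟨GrMod.isoOfBijective ((reg k).ofElem 0 u (SetLike.one_mem_graded (grading k))) ?_ ?_⟩
  · intro a b h
    exact (one_mul (M := Weyl k) a).symm.trans (h.trans (one_mul (M := Weyl k) b))
  · exact fun a => ⟨a, one_mul (M := Weyl k) a⟩

theorem isFGProj_map_sh (e : LinAutoequiv k (Gr k)) (n : ℤ) :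
    GrMod.IsFGProj (e.toEquiv.functor.obj (sh k n)) :=
  GrMod.isFGProj_of_equivalence e.toEquiv (GrMod.isFGProj_shift_regular n)

section CharZero

variable [CharZero k]

variable (k) in
/-- The class of the reject functor. -/
theorem isIota_iotaEquiv (j : ℤ) : IsIota k j (Quotient.mk _ (iotaEquiv k j)) := by
  refine ⟨_, rfl, ⟨NatIso.ofComponents (fun P => GrMod.isoOfBijective (toReject j P.1)
    (toReject_injective (fun m hm => (IsFGProj.torsionFree P.2.1).eq_zero_of_mX hm)
      (fun m hm => (IsFGProj.torsionFree P.2.1).eq_zero_of_mY hm))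
    (toReject_surjective j P.1)) fun {P Q} f => ?_⟩⟩
  exact toReject_naturality j f.hom

theorem isSwap_zero {F : Gr k ⥤ Gr k} {j : ℤ}
    (hx : Nonempty (F.obj ((X k).shift j) ≅ (X k).shift j))
    (hy : Nonempty (F.obj ((Y k).shift j) ≅ (Y k).shift j)) : IsSwap F j 0 := fun a => by
  rw [add_zero]
  obtain ⟨i⟩ := hx
  obtain ⟨i'⟩ := hy
  obtain rfl | rfl := zmod_two_cases a
  · rw [simple_zero]; exact ⟨F.mapIso (isoX k j).symm ≪≫ i ≪≫ isoX k j⟩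
  · rw [simple_one]; exact ⟨F.mapIso (isoY k j).symm ≪≫ i' ≪≫ isoY k j⟩

theorem isSwap_one {F : Gr k ⥤ Gr k} {j : ℤ}
    (hx : Nonempty (F.obj ((X k).shift j) ≅ (Y k).shift j))
    (hy : Nonempty (F.obj ((Y k).shift j) ≅ (X k).shift j)) : IsSwap F j 1 := fun a => by
  obtain ⟨i⟩ := hx
  obtain ⟨i'⟩ := hy
  obtain rfl | rfl := zmod_two_cases a
  · rw [zero_add, simple_zero, simple_one]
    exact ⟨F.mapIso (isoX k j).symm ≪≫ i ≪≫ isoY k j⟩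
  · rw [CharTwo.add_self_eq_zero, simple_zero, simple_one]
    exact ⟨F.mapIso (isoY k j).symm ≪≫ i' ≪≫ isoX k j⟩

theorem NumericallyTrivial.exists_isSwap {F : Gr k ⥤ Gr k} (hF : NumericallyTrivial F) (j : ℤ) :
    ∃ ε, IsSwap F j ε := by
  rw [numericallyTrivial_iff] at hF
  rcases hF.1 j with ⟨hx, hy⟩ | ⟨hx, hy⟩
  · exact ⟨0, isSwap_zero hx hy⟩
  · exact ⟨1, isSwap_one hx hy⟩

theorem exists_swap (c : Pic₀ k) : ∃ s : ℤ → ZMod 2, ∃ e : LinAutoequiv k (Gr k),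
    Quotient.mk _ e = c.1 ∧ ∀ j, IsSwap e.toEquiv.functor j (s j) := by
  obtain ⟨e, he, hF⟩ := c.2
  choose s hs using hF.exists_isSwap
  exact ⟨s, e, he, hs⟩

/-- The set of `j` for which `X⟨j⟩` and `Y⟨j⟩` are interchanged. -/
noncomputable def swap (c : Pic₀ k) : ℤ → ZMod 2 := (exists_swap c).choose

theorem swap_eq {c : Pic₀ k} {e : LinAutoequiv k (Gr k)} (he : Quotient.mk _ e = c.1) {j : ℤ}
    {ε : ZMod 2} (h : IsSwap e.toEquiv.functor j ε) : swap c j = ε := by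
  obtain ⟨e', he', h'⟩ := (exists_swap c).choose_spec
  obtain ⟨i⟩ := Quotient.exact (he'.trans he.symm)
  exact ((h' j).of_iso i).unique h

variable (k) in
/-- The homomorphism which records the interchanged pairs of simple modules. -/
noncomputable def swapHom : Additive (Pic₀ k) →+ ℤ → ZMod 2 where
  toFun c := swap c.toMul
  map_zero' := funext fun j => swap_eq (e := LinAutoequiv.one) rfl (isSwap_id j)
  map_add' := fun a b => funext fun j => by
    obtain ⟨e, he, h⟩ := (exists_swap a.toMul).choose_spec
    obtain ⟨e', he', h'⟩ := (exists_swap b.toMul).choose_spec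
    refine swap_eq (e := LinAutoequiv.mul e e') ?_ ?_
    · change _ = a.toMul.1 * b.toMul.1
      rw [← he, ← he']
      rfl
    · have := (h' j).comp (h j)
      rw [add_comm] at this
      exact this

theorem exists_isSwap_swapHom (c : Additive (Pic₀ k)) : ∃ e : LinAutoequiv k (Gr k),
    Quotient.mk _ e = c.toMul.1 ∧ ∀ j, IsSwap e.toEquiv.functor j (swapHom k c j) :=
  (exists_swap c.toMul).choose_spec

/-- An autoequivalence with trivial swap pattern fixes every X⟨j⟩ and Y⟨j⟩, so
`nonempty_id_iso_of_fix` applies. -/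
theorem swapHom_injective : Function.Injective (swapHom k) := by
  rw [injective_iff_map_eq_zero]
  intro c hc
  obtain ⟨e, he, h⟩ := exists_isSwap_swapHom c
  have h0 : ∀ j a, Nonempty (e.toEquiv.functor.obj (simple k j a) ≅ simple k j a) := fun j a => by
    have := h j a
    rwa [hc, Pi.zero_apply, add_zero] at this
  have h1 := nonempty_id_iso_of_fix e.toEquiv.functor (isFGProj_map_sh e)
    (fun j => by rw [← simple_zero]; exact h0 j 0) (fun j => by rw [← simple_one]; exact h0 j 1)
  refine Subtype.ext (he.symm.trans ?_)
  exact Quotient.sound ⟨h1.some.symm⟩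

variable (k) in
/-- The class of the autoequivalence `ι_j`. -/
noncomputable def iotaClass (j : ℤ) : Pic₀ k :=
  ⟨Quotient.mk _ (iotaEquiv k j), iotaEquiv k j, rfl, numericallyTrivial_iota j⟩

theorem isIota_iff (j : ℤ) (c : Pic k) : IsIota k j c ↔ c = iotaClass k j :=
  ⟨fun h => isIota_unique h (isIota_iotaEquiv k j), fun h => h ▸ isIota_iotaEquiv k j⟩

theorem swapHom_iotaClass (j : ℤ) :
    swapHom k (Additive.ofMul (iotaClass k j)) = Pi.single j 1 := by
  funext i
  refine swap_eq (e := iotaEquiv k j) rfl ?_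
  by_cases h : i = j
  · subst h
    rw [Pi.single_eq_same]
    exact isSwap_one (nonempty_iota_X i) (nonempty_iota_Y i)
  · rw [Pi.single_eq_of_ne h]
    exact isSwap_zero (nonempty_iota_X_of_ne h) (nonempty_iota_Y_of_ne h)

theorem swapHom_iotaProd (J : Finset ℤ) (i : ℤ) :
    swapHom k (Additive.ofMul (iotaProd (iotaClass k) J)) i = if i ∈ J then 1 else 0 := by
  have h : swapHom k (Additive.ofMul (iotaProd (iotaClass k) J)) =
      ∑ j ∈ J, Pi.single j (1 : ZMod 2) := by
    rw [iotaProd, ofMul_list_prod, map_list_sum, List.map_map, List.map_map,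
      ← Finset.sum_map_val, ← Finset.sort_eq J (· ≤ ·), Multiset.map_coe, Multiset.sum_coe]
    congr 2
    funext j
    exact swapHom_iotaClass j
  rw [h, Finset.sum_apply]
  simp [Pi.single_apply]

/-- Every `A⟨n⟩` is of the form `ι_J A`. -/
theorem exists_iotaProd (n : ℤ) : ∃ J : Finset ℤ,
    PicGroup.evalRegular (grading k) (iotaProd (iotaClass k) J) =
      FGProjClass.mk (sh k n) (GrMod.isFGProj_shift_regular n) := by
  -- At least one of the intervals is empty. Together they consist of the j for which A and A⟨n⟩ map
  -- onto different members of the pair.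
  let J := Finset.Ico 0 n ∪ Finset.Ico n 0
  refine ⟨J, ?_⟩
  obtain ⟨e, he, h⟩ := exists_isSwap_swapHom (Additive.ofMul (iotaProd (iotaClass k) J))
  have he' : Quotient.mk _ e = (iotaProd (iotaClass k) J).1 := he
  rw [← he']
  have hs : ∀ j, swapHom k (Additive.ofMul (iotaProd (iotaClass k) J)) j =
      coType 0 j + coType n j := fun j => by
    rw [swapHom_iotaProd]
    have h2 : (1 : ZMod 2) + 1 = 0 := by decide
    simp only [J, coType, Finset.mem_union, Finset.mem_Ico]
    split_ifs <;> first | omega | simp [h2]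
  -- After the swaps in J the image of A has the same dimensions of morphisms to all these simples
  -- as A⟨n⟩, and those dimensions characterise A⟨n⟩.
  have hf : ∀ j a, Module.finrank k (e.toEquiv.functor.obj (sh k 0) ⟶ simple k j a) =
      Module.finrank k (sh k n ⟶ simple k j a) := fun j a => by
    rw [(h j).finrank_map_sh, finrank_sh_simple, finrank_sh_simple, hs]
    generalize coType 0 j = b, coType n j = c
    revert a b c
    decide
  obtain ⟨i⟩ := nonempty_iso_sh_of_finrank (isFGProj_map_sh e 0) (n := n)
    (fun j => by rw [← simple_zero, hf, simple_zero, finrank_sh_xMod])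
    (fun j => by rw [← simple_one, hf, simple_one, finrank_sh_yMod])
  obtain ⟨r⟩ := nonempty_regular_iso_sh (k := k)
  exact GrMod.FGProjClass_mk_eq _ _ (e.toEquiv.functor.mapIso r.symm ≪≫ i.symm)

end CharZero

/-! ### The invariants of classes in the Grothendieck group -/

theorem finrank_biprod_hom {P Q T : Gr k} (b : BinaryBicone P Q) (hb : b.IsBilimit)
    [Module.Finite k (P ⟶ T)] [Module.Finite k (Q ⟶ T)] :
    Module.finrank k (b.pt ⟶ T) = Module.finrank k (P ⟶ T) + Module.finrank k (Q ⟶ T) := by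
  rw [← Module.finrank_prod]
  refine LinearEquiv.finrank_eq
    { toFun := fun f => (b.inl ≫ f, b.inr ≫ f)
      invFun := fun g => b.fst ≫ g.1 + b.snd ≫ g.2
      map_add' := fun f g => by simp
      map_smul' := fun c f => by simp
      left_inv := fun f => ?_
      right_inv := fun g => by simp }
  have h := IsBilimit.binary_total hb
  beta_reduce
  rw [← Category.assoc, ← Category.assoc, ← Preadditive.add_comp, h, Category.id_comp]

variable (k) in
/-- The parity of the dimension of the space of morphisms to the simple module with parameter `j`
which is not a quotient of `A`. -/
noncomputable def parityClass (j : ℤ) : FGProjClass (grading k) → ZMod 2 :=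
  Quotient.lift (fun P => (Module.finrank k (P.1 ⟶ simple k j (coType 0 j)) : ZMod 2))
    fun _ _ ⟨i⟩ => congrArg Nat.cast (Linear.homCongr k
      ((GrMod.IsFGProj (𝒜 := grading k)).ι.mapIso i) (Iso.refl _)).finrank_eq

variable (k) in
/-- The parity, on the Grothendieck group. -/
noncomputable def parityK0 (j : ℤ) : GrK0 (grading k) →+ ZMod 2 :=
  QuotientAddGroup.lift _ (FreeAbelianGroup.lift (parityClass k j)) (by
    refine (AddSubgroup.closure_le _).2 ?_
    rintro _ ⟨P, Q, S, hP, hQ, hS, b, ⟨hb⟩, ⟨i⟩, rfl⟩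
    have := finite_hom hP.1 (finite_deg_simple j (coType 0 j))
    have := finite_hom hQ.1 (finite_deg_simple j (coType 0 j))
    have h1 := (Linear.homCongr k i (Iso.refl (simple k j (coType 0 j)))).finrank_eq
    rw [finrank_biprod_hom b hb] at h1
    rw [SetLike.mem_coe, AddMonoidHom.mem_ker, map_sub, map_add, FreeAbelianGroup.lift_apply_of,
      FreeAbelianGroup.lift_apply_of, FreeAbelianGroup.lift_apply_of, sub_eq_zero]
    change ((Module.finrank k (S ⟶ _) : ℕ) : ZMod 2) = (Module.finrank k (P ⟶ _) : ℕ) +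
      (Module.finrank k (Q ⟶ _) : ℕ)
    rw [← h1, Nat.cast_add])

theorem parityK0_mk (j : ℤ) {P : Gr k} (hP : GrMod.IsFGProj P) :
    parityK0 k j (GrK0.of _ (FGProjClass.mk P hP)) =
      Module.finrank k (P ⟶ simple k j (coType 0 j)) :=
  FreeAbelianGroup.lift_apply_of _ _

theorem mk_sh_zero : FGProjClass.mk (sh k 0) (GrMod.isFGProj_shift_regular 0) =
    FGProjClass.mk (reg k) GrMod.isFGProj_regular :=
  GrMod.FGProjClass_mk_eq _ _ nonempty_regular_iso_sh.some

variable (k) in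
/-- The parities, on the reduced Grothendieck group. -/
noncomputable def parity : ReducedGrK0 (grading k) →+ ℤ → ZMod 2 :=
  QuotientAddGroup.lift _ (AddMonoidHom.mk' (fun a j => parityK0 k j a)
    fun a b => funext fun j => map_add _ a b) (by
    rw [AddSubgroup.zmultiples_le]
    refine funext fun j => ?_
    change parityK0 k j (GrK0.of _ (FGProjClass.mk (reg k) GrMod.isFGProj_regular)) = 0
    -- The test module was chosen to receive no nonzero morphism from A, so the parity descends to
    -- the quotient by [A].
    rw [← mk_sh_zero, parityK0_mk, finrank_sh_simple, if_pos rfl, Nat.cast_zero])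

variable (k) in
/-- The class of `A⟨n⟩` in the reduced Grothendieck group. -/
noncomputable def shClass (n : ℤ) : ReducedGrK0 (grading k) :=
  QuotientAddGroup.mk (GrK0.of _ (FGProjClass.mk (sh k n) (GrMod.isFGProj_shift_regular n)))

theorem shClass_zero : shClass k 0 = 0 := by
  rw [shClass, mk_sh_zero, QuotientAddGroup.eq_zero_iff]
  exact AddSubgroup.mem_zmultiples _

theorem parity_shClass (n j : ℤ) : parity k (shClass k n) j = coType 0 j + coType n j :=
  (parityK0_mk j _).trans (finrank_sh_simple_cast n j _)

variable (k) in
/-- The linear combinations of the differences `[A⟨j + 1⟩] - [A⟨j⟩]`. -/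
noncomputable def diffComb : (ℤ →₀ ℤ) →+ ReducedGrK0 (grading k) :=
  (Finsupp.linearCombination ℤ fun j => shClass k (j + 1) - shClass k j).toAddMonoidHom

theorem diffComb_single (j c : ℤ) :
    diffComb k (Finsupp.single j c) = c • (shClass k (j + 1) - shClass k j) :=
  Finsupp.linearCombination_single _ _ _

/-- In passing from A⟨j⟩ to A⟨j+1⟩ the simple quotient changes only in the pair with parameter j, so
the difference of classes has parity 1 there and 0 elsewhere. -/
theorem parity_diffComb (c : ℤ →₀ ℤ) (i : ℤ) : parity k (diffComb k c) i = c i := by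
  induction c using Finsupp.induction_linear with
  | zero => simp
  | add c c' h h' => rw [map_add, map_add, Pi.add_apply, h, h', Finsupp.add_apply, Int.cast_add]
  | single j c =>
    rw [diffComb_single, map_zsmul, map_sub, Pi.smul_apply, Pi.sub_apply, parity_shClass,
      parity_shClass, add_sub_add_left_eq_sub, Finsupp.single_apply]
    simp only [coType]
    split_ifs <;> first | omega | simp

section CharZero

variable [CharZero k]

theorem closure_shClass : AddSubgroup.closure (Set.range (shClass k)) = ⊤ := by
  rw [eq_top_iff]
  rintro a -
  obtain ⟨a, rfl⟩ := QuotientAddGroup.mk_surjective a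
  have ha : a ∈ shSubgroup k := by rw [shSubgroup_eq_top]; exact AddSubgroup.mem_top a
  refine AddSubgroup.closure_induction ?_ ?_ ?_ ?_ ha
  · rintro _ ⟨n, rfl⟩
    exact AddSubgroup.subset_closure ⟨n, rfl⟩
  · exact AddSubgroup.zero_mem _
  · exact fun _ _ _ _ => AddSubgroup.add_mem _
  · exact fun _ _ => AddSubgroup.neg_mem _

/-- The morphisms from F A to S_j correspond to the morphisms from A to the preimage of S_j under F.
This preimage is S_j, with none but zero, or the other member of the pair, with a line of them,
according to the swap pattern of F. -/
theorem parity_reducedClass (c : Pic₀ k) :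
    parity k (PicGroup.reducedClass (grading k) c) = swapHom k (Additive.ofMul c) := by
  obtain ⟨e, he, h⟩ := exists_isSwap_swapHom (Additive.ofMul c)
  have he' : Quotient.mk _ e = c.1 := he
  rw [← he']
  funext j
  obtain ⟨r⟩ := nonempty_regular_iso_sh (k := k)
  have h1 := (parityK0_mk j (GrMod.isFGProj_of_equivalence e.toEquiv
    (GrMod.isFGProj_regular (𝒜 := grading k))))
  refine h1.trans ?_
  rw [(Linear.homCongr k (e.toEquiv.functor.mapIso r.symm) (Iso.refl _)).finrank_eq,
    (h j).finrank_map_sh, finrank_sh_simple_cast, add_right_comm, CharTwo.add_self_eq_zero,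
    zero_add]

theorem exists_reducedClass (n : ℤ) : ∃ J : Finset ℤ,
    PicGroup.reducedClass (grading k) (iotaProd (iotaClass k) J) = shClass k n := by
  obtain ⟨J, hJ⟩ := exists_iotaProd (k := k) n
  exact ⟨J, by rw [PicGroup.reducedClass, hJ]; rfl⟩

/-- It suffices to treat the generators [A⟨n⟩], and each A⟨n⟩ is ι_J A for some J, so its parity is
a swap pattern. -/
theorem parity_mem_range (a : ReducedGrK0 (grading k)) : parity k a ∈ (swapHom k).range := by
  have ha : a ∈ AddSubgroup.closure (Set.range (shClass k)) := by
    rw [closure_shClass]; exact AddSubgroup.mem_top a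
  refine (AddSubgroup.closure_le (K := (swapHom k).range.comap (parity k))).2 ?_ ha
  rintro _ ⟨n, rfl⟩
  obtain ⟨J, hJ⟩ := exists_reducedClass (k := k) n
  exact ⟨_, (parity_reducedClass _).symm.trans (congrArg _ hJ)⟩

variable (k) in
/-- The homomorphism from the reduced Grothendieck group to the group of numerically trivial
autoequivalences. -/
noncomputable def theta : ReducedGrK0 (grading k) →+ Additive (Pic₀ k) :=
  (AddMonoidHom.ofInjective swapHom_injective).symm.toAddMonoidHom.comp
    ((parity k).codRestrict _ parity_mem_range)

theorem swapHom_theta (a : ReducedGrK0 (grading k)) : swapHom k (theta k a) = parity k a :=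
  congrArg Subtype.val ((AddMonoidHom.ofInjective swapHom_injective).apply_symm_apply
    (⟨parity k a, parity_mem_range a⟩ : (swapHom k).range))

/-- Both sides have the same swap pattern. The identity holds for all of Pic₀ and not just for the
ι_J, which yields surjectivity at once. -/
theorem theta_reducedClass (c : Pic₀ k) :
    theta k (PicGroup.reducedClass (grading k) c) = Additive.ofMul c :=
  swapHom_injective ((swapHom_theta _).trans (parity_reducedClass c))

theorem theta_surjective : Function.Surjective (theta k) :=
  fun c => ⟨_, theta_reducedClass c.toMul⟩

theorem theta_unique {θ θ' : ReducedGrK0 (grading k) →+ Additive (Pic₀ k)}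
    (h : ∀ J : Finset ℤ, θ (PicGroup.reducedClass (grading k) (iotaProd (iotaClass k) J)) =
      θ' (PicGroup.reducedClass (grading k) (iotaProd (iotaClass k) J))) : θ = θ' := by
  refine AddMonoidHom.eq_of_eqOn_dense closure_shClass ?_
  rintro _ ⟨n, rfl⟩
  obtain ⟨J, hJ⟩ := exists_reducedClass (k := k) n
  rw [← hJ, h]

theorem two_nsmul_eq_zero (c : Additive (Pic₀ k)) : 2 • c = 0 := by
  refine swapHom_injective ?_
  rw [map_nsmul, map_zero]
  exact funext fun j => (two_nsmul _).trans (CharTwo.add_self_eq_zero _)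

/-- As [A⟨0⟩] = 0 in the reduced group, every [A⟨n⟩] is a telescoping sum of differences. -/
theorem diffComb_surjective : Function.Surjective (diffComb k) := by
  rw [← AddMonoidHom.range_eq_top, ← top_le_iff, ← closure_shClass, AddSubgroup.closure_le]
  rintro _ ⟨n, rfl⟩
  have hd : ∀ j, shClass k (j + 1) - shClass k j ∈ (diffComb k).range := fun j =>
    ⟨Finsupp.single j 1, by rw [diffComb_single, one_smul]⟩
  rw [SetLike.mem_coe]
  induction n using Int.induction_on with
  | zero => rw [shClass_zero]; exact AddSubgroup.zero_mem _
  | succ n ih => simpa using AddSubgroup.add_mem _ ih (hd n)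
  | pred n ih => simpa using AddSubgroup.sub_mem _ ih (hd (-n - 1))

theorem exists_two_nsmul_of_theta {a : ReducedGrK0 (grading k)} (ha : theta k a = 0) :
    ∃ b, a = 2 • b := by
  obtain ⟨c, rfl⟩ := diffComb_surjective a
  have hc : ∀ i, (2 : ℤ) ∣ c i := fun i => by
    rw [← Nat.cast_ofNat, ← ZMod.intCast_zmod_eq_zero_iff_dvd, ← parity_diffComb (k := k) c i,
      ← swapHom_theta, ha, map_zero]
    rfl
  -- The parities of a are the coefficients c i modulo two, all zero here, so the coefficients can
  -- be halved.
  refine ⟨diffComb k (c.mapRange (· / 2) rfl), ?_⟩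
  rw [← map_nsmul]
  congr 1
  ext i
  have := hc i
  simp only [Finsupp.smul_apply, Finsupp.mapRange_apply, nsmul_eq_mul]
  push_cast
  omega

end CharZero

end Weyl

/-! ### Reduction modulo two -/

/-- The isomorphism induced by a surjective homomorphism to a group of exponent two, whose kernel
consists of the multiples of two. -/
theorem exists_tensor_zmod_two {K G : Type*} [AddCommGroup K] [AddGroup G] (θ : K →+ G)
    (hθ : Function.Surjective θ) (hG : ∀ g : G, 2 • g = 0)
    (hker : ∀ a, θ a = 0 → ∃ b, a = 2 • b) :
    ∃ Φ : K ⊗[ℤ] ZMod 2 ≃+ G, ∀ a, Φ (a ⊗ₜ[ℤ] (1 : ZMod 2)) = θ a := by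
  -- The target is only assumed to be a group; it is commutative as a quotient of K.
  let _ : AddCommGroup G :=
    { (inferInstance : AddGroup G) with
      add_comm := fun a b => by
        obtain ⟨a, rfl⟩ := hθ a
        obtain ⟨b, rfl⟩ := hθ b
        rw [← map_add, add_comm, map_add] }
  let h : K →+ ZMod 2 →+ G := AddMonoidHom.mk' (fun a => ZMod.lift 2
    ⟨(zmultiplesHom G) (θ a), (natCast_zsmul (θ a) 2).trans (hG (θ a))⟩) (fun a b => by
      refine AddMonoidHom.ext fun n => ?_
      obtain ⟨n, rfl⟩ := ZMod.intCast_surjective n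
      rw [AddMonoidHom.add_apply, ZMod.lift_coe, ZMod.lift_coe, ZMod.lift_coe]
      simp)
  let Φ : K ⊗[ℤ] ZMod 2 →+ G := TensorProduct.liftAddHom h fun n a b => by
    rw [map_zsmul, map_zsmul]; rfl
  have hΦ : ∀ a, Φ (a ⊗ₜ[ℤ] (1 : ZMod 2)) = θ a := fun a => by
    have h1 : Φ (a ⊗ₜ[ℤ] (1 : ZMod 2)) = h a ((1 : ℤ) : ZMod 2) := by
      rw [Int.cast_one]; exact TensorProduct.liftAddHom_tmul _ _ _ _
    rw [h1]
    exact (ZMod.lift_coe 2 _ 1).trans (one_zsmul _)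
  -- Since 1 generates ℤ/2, every tensor is pure of the form a ⊗ 1, so injectivity only concerns the
  -- kernel of θ.
  have hrep : ∀ t : K ⊗[ℤ] ZMod 2, ∃ a : K, t = a ⊗ₜ[ℤ] (1 : ZMod 2) := fun t => by
    induction t using TensorProduct.induction_on with
    | zero => exact ⟨0, (TensorProduct.zero_tmul _ _).symm⟩
    | tmul a n =>
      obtain ⟨n, rfl⟩ := ZMod.intCast_surjective n
      exact ⟨n • a, by rw [TensorProduct.smul_tmul, zsmul_one]⟩
    | add s t hs ht =>
      obtain ⟨a, rfl⟩ := hs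
      obtain ⟨b, rfl⟩ := ht
      exact ⟨a + b, (TensorProduct.add_tmul _ _ _).symm⟩
  refine ⟨AddEquiv.ofBijective Φ ⟨?_, fun g => ?_⟩, hΦ⟩
  · rw [injective_iff_map_eq_zero]
    intro t ht
    obtain ⟨a, rfl⟩ := hrep t
    rw [hΦ] at ht
    obtain ⟨b, rfl⟩ := hker a ht
    have h2 : (2 : ℕ) • (1 : ZMod 2) = 0 := by decide
    rw [TensorProduct.smul_tmul, h2, TensorProduct.tmul_zero]
  · obtain ⟨a, rfl⟩ := hθ g
    exact ⟨_, hΦ a⟩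

/-! ### The theorem -/

theorem corollary7p3 (k : Type u) [Field k] [IsAlgClosed k] [CharZero k] :
    ∃ ι : ℤ → Weyl.Pic₀ k,
      (∀ (j : ℤ) (c : Weyl.Pic k), Weyl.IsIota k j c ↔ c = ι j) ∧
      ∃ θ : ReducedGrK0 (Weyl.grading k) →+ Additive (Weyl.Pic₀ k),
        (∀ J : Finset ℤ, θ (PicGroup.reducedClass (Weyl.grading k) (Weyl.iotaProd ι J)) =
          Additive.ofMul (Weyl.iotaProd ι J)) ∧
        (∀ θ' : ReducedGrK0 (Weyl.grading k) →+ Additive (Weyl.Pic₀ k),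
          (∀ J : Finset ℤ, θ' (PicGroup.reducedClass (Weyl.grading k) (Weyl.iotaProd ι J)) =
            Additive.ofMul (Weyl.iotaProd ι J)) → θ' = θ) ∧
        ∃ Φ : ReducedGrK0 (Weyl.grading k) ⊗[ℤ] ZMod 2 ≃+ Additive (Weyl.Pic₀ k),
          ∀ a : ReducedGrK0 (Weyl.grading k), Φ (a ⊗ₜ[ℤ] (1 : ZMod 2)) = θ a := by
  refine ⟨Weyl.iotaClass k, Weyl.isIota_iff, Weyl.theta k,
    fun J => Weyl.theta_reducedClass _, fun θ' h => Weyl.theta_unique fun J =>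
      (h J).trans (Weyl.theta_reducedClass _).symm, ?_⟩
  have hker : ∀ a, Weyl.theta k a = 0 → ∃ b, a = 2 • b :=
    fun a h => Weyl.exists_two_nsmul_of_theta h
  exact exists_tensor_zmod_two _ Weyl.theta_surjective Weyl.two_nsmul_eq_zero hker
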